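/- Setting. An embedded planar graph $G$ is a simple graph with an injective map $z$ of its vertices to $\mathbb{C}$, whose edges are drawn as straight segments that meet each other and the vertices only at end-points, such that every face (connected component of the complement of the drawing) is a convex polygon, the closed faces cover the plane, and every open disk meets only finitely many faces. $G$ is an isoradial Delaunay graph of circumradius $R$ if every face is inscribed in a circle of radius $R$, no vertex lies in the interior of the circumdisk of a face, and no two distinct faces have the same circumcircle. Its rhombic graph $G^\lozenge$ has as vertices the vertices of $G$ and the circumcentres $o_f$ of the faces (with their positions in the plane, still denoted $z$), a vertex $v$ of $G$ being joined to $o_f$ exactly when $v\in\partial f$. To each edge $\overline{ab}$ of $G$ with adjacent faces $f,g$ corresponds the rhomb $(a,o_f,b,o_g)$. A train-track $t$ is a sequence of rhombs $(\lozenge_n)_{n\in\mathbb{Z}}$, up to shift and inversion of the index, such that $\lozenge_n\neq\lozenge_{n+1}$ share an edge $e_n$ (a tie of $t$) and $e_n,e_{n+1}$ are opposite (parallel) sides of $\lozenge_{n+1}$. It separates two vertices if they lie in different components of $G^\lozenge$ with the ties of $t$ removed. For vertices $u,v$ of $G^\lozenge$ put $\theta_0=\theta_0(u,v)=\arg(z(v)-z(u))$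 (with $\theta_0=0$ if $u=v$). For a path $\mathbf{v}=(v_0,\dots,v_k)$ in $G^\lozenge$ let $\theta_j=\arg(z(v_j)-z(v_{j-1}))$, and for an integer $n$ let $\lfloor\mathbf{v}\rfloor_n=\sum_{j=1}^k e^{\mathrm{i}n\theta_j}$. If $t$ separates $v_0$ from $v_k$, the intersection angle $\vartheta(\mathbf{v},t)$ is $\theta_j$ for the first $j$ such that $\overline{v_{j-1}v_j}$ is a tie of $t$, taken modulo $2\pi$ in $(\theta_0-\pi,\theta_0+\pi]$ with $\theta_0=\theta_0(v_0,v_k)$. Let $\Theta(\mathbf{v})$ be the set of intersection angles of $\mathbf{v}$ with all train-tracks separating $v_0$ from $v_k$, and let the multiplicity of $\vartheta\in\Theta(\mathbf{v})$ be the number of such train-tracks with intersection angle $\vartheta$. Proposition. Let $G$ be an isoradial Delaunay graph. (1) Let $\mathbf{v}$ be a path in $G^\lozenge$ from $u$ to $v$ with $u\neq v$. Then $\Theta(\mathbf{v})$ is finite and non-empty, and with $\alpha=\max\Theta(\mathbf{v})$, $\beta=\min\Theta(\mathbf{v})$ one has $$\alpha-\beta<\pi,\qquad \beta\le\theta_0\le\alpha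 .$$ In particular $\Theta(\mathbf{v})$ and $\theta_0$ are contained in the open interval $\left(\theta_{\mathbf{v}}-\frac{\pi}{2},\theta_{\mathbf{v}}+\frac{\pi}{2}\right)$, where $\theta_{\mathbf{v}}=\frac12(\alpha+\beta)$. (2) Let $u,v$ be vertices of $G^\lozenge$. There is a path from $u$ to $v$, and for odd $n$ the value $p_n(u,v):=\lfloor\mathbf{v}\rfloor_n$ is the same for all paths $\mathbf{v}$ from $u$ to $v$. Moreover the set $\Theta=\Theta(\mathbf{v})$ and the multiplicities $m_\vartheta$ of its elements depend only on $u$ and $v$, not on the path $\mathbf{v}$; $\Theta$ is a finite subset of $(\theta_0-\pi,\theta_0+\pi)$; all $m_\vartheta$, $\vartheta\in\Theta$, are positive integers; $\Theta$ is contained in an open subinterval of $(\theta_0-\pi,\theta_0+\pi)$ of length less than $\pi$, which also contains $\theta_0$ if $u\ne v$; and for every odd integer $n$ $$p_n(u,v)=\sum_{\vartheta\in\Theta}m_\vartheta\,e^{\mathrm{i}n\vartheta}.$$ -/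

import Mathlib

open Real

/-- The drawing of a graph with straight edges: the points of all vertices together with the
line segments of all edges. -/
def graphDrawing {V : Type*} (graph : SimpleGraph V) (z : V → ℂ) : Set ℂ :=
  Set.range z ∪ {x | ∃ u v, graph.Adj u v ∧ x ∈ segment ℝ (z u) (z v)}

/-- The (open) faces determined by the drawing: the connected components of its complement. -/
def graphFaces {V : Type*} (graph : SimpleGraph V) (z : V → ℂ) : Set (Set ℂ) :=
  {f | ∃ x ∈ (graphDrawing graph z)ᶜ, f = connectedComponentIn (graphDrawing graph z)ᶜ x}

/-- The vertices lying on (the closure of) a face. -/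
def graphFaceVertices {V : Type*} (z : V → ℂ) (f : Set ℂ) : Set V :=
  {v | z v ∈ closure f}

/-- An embedded planar graph: straight non-crossing edges, every face is a convex polygon spanned
by its finitely many vertices, the closed faces cover the plane, and each open disk meets only
finitely many faces. -/
structure EmbeddedPlanarGraph (V : Type*) where
  graph : SimpleGraph V
  z : V → ℂ
  z_injective : Function.Injective z
  edges_noncrossing : ∀ u v u' v', graph.Adj u v → graph.Adj u' v' → s(u, v) ≠ s(u', v') →
    Disjoint (openSegment ℝ (z u) (z v)) (openSegment ℝ (z u') (z v'))
  vertex_notMem_edge : ∀ u v w, graph.Adj u v → z w ∉ openSegment ℝ (z u) (z v)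
  face_finite : ∀ f ∈ graphFaces graph z, (graphFaceVertices z f).Finite
  face_polygon : ∀ f ∈ graphFaces graph z,
    f = interior (convexHull ℝ (z '' graphFaceVertices z f))
  faces_cover : (⋃ f ∈ graphFaces graph z, closure f) = Set.univ
  faces_locallyFinite : ∀ (c : ℂ) (r : ℝ),
    {f ∈ graphFaces graph z | (f ∩ Metric.ball c r).Nonempty}.Finite

namespace EmbeddedPlanarGraph

noncomputable section

variable {V : Type*} (G : EmbeddedPlanarGraph V)

/-- The faces of `G`. -/
def Face : Type := {f : Set ℂ // f ∈ graphFaces G.graph G.z}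

/-- `G.OnFace v f`: the vertex `v` belongs to the boundary of the face `f`. -/
def OnFace (v : V) (f : G.Face) : Prop := v ∈ graphFaceVertices G.z f.1

/-- The circle with centre `c` and radius `r` passes through all vertices of the face `f`. -/
def IsCircumcircle (f : G.Face) (c : ℂ) (r : ℝ) : Prop :=
  ∀ v, G.OnFace v f → dist (G.z v) c = r

/-- Every face is a cyclic polygon (the cyclic order of its vertices is automatic, since a face
is the convex polygon spanned by its vertices). -/
def IsPolyhedral : Prop := ∀ f : G.Face, ∃ c r, G.IsCircumcircle f c r

/-- Polyhedral, and all circumradii are equal to `R`. -/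
def IsIsoradial (R : ℝ) : Prop :=
  G.IsPolyhedral ∧ ∀ f c r, G.IsCircumcircle f c r → r = R

/-- Polyhedral, and no vertex lies in the interior of a circumdisk. -/
def IsWeakDelaunay : Prop :=
  G.IsPolyhedral ∧ ∀ f c r, G.IsCircumcircle f c r → ∀ v, r ≤ dist (G.z v) c

/-- No two distinct faces share the same circumcircle. -/
def IsChordless : Prop :=
  ∀ f g c r, G.IsCircumcircle f c r → G.IsCircumcircle g c r → f = g

/-- A Delaunay graph is a chordless weak Delaunay graph. -/
def IsDelaunay : Prop := G.IsWeakDelaunay ∧ G.IsChordless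

open Classical in
/-- The circumcentre of a face (unique when it exists; `0` if the face is not cyclic). -/
def circumcenter (f : G.Face) : ℂ :=
  if h : ∃ c r, G.IsCircumcircle f c r then h.choose else 0

/-- The vertices of the kite graph: the vertices of `G` (black) and its face centres (white). -/
abbrev KiteVertex : Type _ := V ⊕ G.Face

/-- The kite graph, called the rhombic graph when `G` is isoradial: the vertex `v` is joined to
the centre of the face `f` exactly when `v` is on the boundary of `f`. -/
def rhombicGraph : SimpleGraph G.KiteVertex where
  Adj
    | .inl v, .inr f => G.OnFace v f
    | .inr f, .inl v => G.OnFace v f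
    | _, _ => False
  symm := ⟨by rintro (v | f) (w | g) h <;> exact h⟩
  loopless := ⟨by rintro (v | f) h <;> exact h⟩

/-- The embedding of the rhombic graph. -/
def zKite : G.KiteVertex → ℂ
  | .inl v => G.z v
  | .inr f => G.circumcenter f

/-- The rhombs are indexed by the edges of `G`. -/
abbrev Rhomb : Type _ := G.graph.edgeSet

/-- The sides of the rhomb of an edge `e` of `G`: they join an end-point of `e` to the centre of
one of the faces adjacent to `e`. -/
def rhombSides (e : G.Rhomb) : Set (Sym2 G.KiteVertex) :=
  {s | ∃ (w : V) (f : G.Face), w ∈ e.1 ∧ (∀ w' ∈ e.1, G.OnFace w' f) ∧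
    s = s(Sum.inl w, Sum.inr f)}

/-- Two edges of the rhombic graph are parallel in the plane. -/
def Parallel (e e' : Sym2 G.KiteVertex) : Prop :=
  ∃ a b c d, e = s(a, b) ∧ e' = s(c, d) ∧
    ∃ t : ℝ, t ≠ 0 ∧ G.zKite b - G.zKite a = t • (G.zKite d - G.zKite c)

/-- A parametrized train-track: a bi-infinite sequence of rhombs, two consecutive ones being
distinct and incident along a common edge (a tie), such that any two consecutive ties are distinct
and parallel (so they are opposite sides of the rhomb between them). -/
structure TrackSeq where
  rhomb : ℤ → G.Rhomb
  tie : ℤ → Sym2 G.KiteVertex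
  rhomb_ne : ∀ n, rhomb n ≠ rhomb (n + 1)
  tie_mem : ∀ n, tie n ∈ G.rhombSides (rhomb n)
  tie_mem_succ : ∀ n, tie n ∈ G.rhombSides (rhomb (n + 1))
  tie_ne : ∀ n, tie n ≠ tie (n + 1)
  tie_parallel : ∀ n, G.Parallel (tie n) (tie (n + 1))

/-- Equality of rhomb sequences up to shift and inversion. -/
def trackSetoid : Setoid G.TrackSeq where
  r t₁ t₂ := ∃ (ε : ℤˣ) (d : ℤ), ∀ n : ℤ, t₂.rhomb n = t₁.rhomb (ε * n + d)
  iseqv :=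
    { refl := fun t => ⟨1, 0, fun n => by simp⟩
      symm := by
        rintro t₁ t₂ ⟨ε, d, h⟩
        refine ⟨ε, -(ε * d), fun n => ?_⟩
        rw [h]
        congr 1
        have hε : (ε : ℤ) * ε = 1 := by
          rcases Int.units_eq_one_or ε with rfl | rfl <;> rfl
        linear_combination (d - n) * hε
      trans := by
        rintro t₁ t₂ t₃ ⟨ε, d, h⟩ ⟨ε', d', h'⟩
        refine ⟨ε * ε', ε * d' + d, fun n => ?_⟩
        rw [h', h]
        congr 1
        push_cast
        ring }

/-- Train-tracks: sequences of rhombs as above, up to shift and inversion. -/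
def TrainTrack : Type _ := Quotient G.trackSetoid

variable {G}

/-- The set of ties of a train-track. -/
def TrainTrack.ties (T : G.TrainTrack) : Set (Sym2 G.KiteVertex) :=
  {e | ∃ t : G.TrackSeq, Quotient.mk G.trackSetoid t = T ∧ ∃ n, t.tie n = e}

/-- `T` separates `u` from `v`: they lie in different components of the rhombic graph with the
ties of `T` removed. -/
def TrainTrack.Separates (T : G.TrainTrack) (u v : G.KiteVertex) : Prop :=
  ¬ (G.rhombicGraph.deleteEdges T.ties).Reachable u v

variable (G) in
/-- The direction from `u` to `v`: the argument `θ₀` of the difference of their positions. -/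
def direction (u v : G.KiteVertex) : ℝ := Complex.arg (G.zKite v - G.zKite u)

/-- The value on a path `p` of the linear form on 1-chains that sends an oriented edge with angle
`θ` to `exp (i n θ)`. -/
def phaseSum {u v : G.KiteVertex} (p : G.rhombicGraph.Walk u v) (n : ℤ) : ℂ :=
  (p.darts.map fun d =>
    Complex.exp (Complex.I * (n : ℂ) * (G.direction d.fst d.snd : ℂ))).sum

variable (G) in
open Classical in
/-- `p_n(u, v)`: the value of `phaseSum` on a path from `u` to `v` (for odd `n` it does not depend
on the choice of the path). -/
def pSum (n : ℤ) (u v : G.KiteVertex) : ℂ :=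
  if h : Nonempty (G.rhombicGraph.Walk u v) then phaseSum h.some n else 0

open Classical in
/-- The intersection angle of the path `p` with the train-track `T`: the angle of the first
oriented edge of `p` that is a tie of `T`, as a real number in `(θ₀ - π, θ₀ + π]`, where `θ₀` is
the direction of the path. (Only used when `T` separates the end-points of `p`, so that such an
edge exists.) -/
def intersectionAngle {u v : G.KiteVertex} (p : G.rhombicGraph.Walk u v) (T : G.TrainTrack) : ℝ :=
  toIocMod Real.two_pi_pos (G.direction u v - π)
    ((p.darts.find? fun d => d.edge ∈ T.ties).elim 0 fun d => G.direction d.fst d.snd)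

/-- `Θ(p)`: the set of intersection angles of `p` with the train-tracks separating its ends. -/
def angleSet {u v : G.KiteVertex} (p : G.rhombicGraph.Walk u v) : Set ℝ :=
  {ϑ | ∃ T : G.TrainTrack, T.Separates u v ∧ intersectionAngle p T = ϑ}

/-- The multiplicity of `ϑ`: the number of train-tracks that separate the ends of `p` and have
intersection angle `ϑ` with `p`. -/
def angleMult {u v : G.KiteVertex} (p : G.rhombicGraph.Walk u v) (ϑ : ℝ) : ℕ :=
  {T : G.TrainTrack | T.Separates u v ∧ intersectionAngle p T = ϑ}.ncard

end

end EmbeddedPlanarGraph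

/-!
Three facts about train-tracks carry the proof.

A train-track is a bi-infinite ribbon of rhombs glued along parallel ties of one vector `w`, and
the rhombs advance in one direction across `w`. Its boundary is therefore the graph of a piecewise
linear function over an interval, in the coordinates along and across `w`; the ribbon cuts the plane
into two sides, removing its ties separates exactly the vertices on different sides
(`StraightNet.Ribbon.not_reachable_iff`), and every path from the one side to the other crosses the
ties once more with `w` than against it. Since each edge of the rhombic graph is a tie of exactly
one train-track, the sum of an odd function over the steps of a path is the sum of its values at the
tie vectors of the separating train-tracks (`RhombicNet.sum_darts`). For odd `n` this gives the
formula for `p_n`. A path first meets a separating train-track in the direction `w` pointing to its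
end, so that the intersection angles do not depend on the path. The same formula, applied to the
identity, writes `z v - z u` as the sum of those tie vectors, so that its direction `θ₀` cannot lie
strictly on one side of all intersection angles (`RhombicNet.exists_angle_le_and_le`).

It remains to see that two intersection angles differ by less than `π`. If they differ by more, then
`u - v` is a nonnegative combination of the two tie vectors. This is impossible by
`StraightNet.Ribbon.ne_add_smul`: follow the boundary of one ribbon between a ray from `v` and a
ray from `u` in the direction of the other tie vector; it would have to cross the other ribbon in
the wrong direction. If they differ by exactly `π`, the two boundary curves are graphs in the same
coordinates. They exchange their order between `u` and `v`, so they meet, at a finite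
point or in a common vertical asymptote. At a finite point the ribbons would share a tie. At an
asymptote, a third ribbon that crosses the first one far out separates the two tails in an
impossible way (`RhombicNet.false_of_tails`). This is `RhombicNet.false_of_opposite`, and
`RhombicNet.angle_sub_lt` sums up.

The isoradial Delaunay condition enters only in making the rhombic graph such a net of ribbons. The
circumcentre of a face lies inside the face (`circumcenter_mem`), since otherwise the neighbouring
face would have a vertex in the circumdisk. Hence the rhombs are nondegenerate, two of them have
disjoint interiors (`eq_of_mem_rhomb`), and each vertex of a face is the end of exactly two edges of
the face, one on each side of its radius (`exists_neighbor`, `neighbor_unique`). So a side of a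
rhomb belongs to exactly one other rhomb, and the train-tracks are the orbits of a permutation of
the flags of `G` (`exists_flag`).
-/

/-! ### Piecewise linear graphs with possibly bounded domain -/

/-- A bi-infinite polyline in `ℝ × ℝ` with vertices `(q n, p n)` that is the graph of a function
over an interval: the abscissas increase, the jumps of the ordinates are bounded and the vertices
leave every bounded set. The interval need not be the whole line; at a finite end the ordinates
tend to `+∞` or to `-∞`. -/
structure PLCurve where
  q : ℤ → ℝ
  p : ℤ → ℝ
  M : ℝ
  mono : StrictMono q
  step : ∀ n, |p (n + 1) - p n| ≤ M
  proper : ∀ ρ : ℝ, {n | |q n| ≤ ρ ∧ |p n| ≤ ρ}.Finite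

namespace PLCurve

open Filter

variable (C : PLCurve)

/-- The reflection of the curve in the horizontal axis. -/
def flip : PLCurve where
  q := C.q
  p n := -C.p n
  M := C.M
  mono := C.mono
  step n := by
    rw [show -C.p (n + 1) - -C.p n = -(C.p (n + 1) - C.p n) by ring, abs_neg]
    exact C.step n
  proper ρ := by simpa using C.proper ρ

/-- The reflection of the curve in the vertical axis. -/
def mirror : PLCurve where
  q n := -C.q (-n)
  p n := C.p (-n)
  M := C.M
  mono a b h := neg_lt_neg (C.mono (neg_lt_neg h))
  step n := by
    have := C.step (-(n + 1))
    rw [show -(n + 1) + 1 = -n by ring] at this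
    rwa [abs_sub_comm]
  proper ρ := by
    have := (C.proper ρ).preimage (f := fun n : ℤ => -n) (neg_injective.injOn)
    simpa [Set.preimage] using this

/-- The abscissa `a` lies in the column between the vertices number `k` and `k + 1`. -/
def InColumn (k : ℤ) (a : ℝ) : Prop := C.q k ≤ a ∧ a ≤ C.q (k + 1)

/-- The ordinate at the abscissa `a` of the line through the vertices number `k` and `k + 1`. -/
noncomputable def height (k : ℤ) (a : ℝ) : ℝ :=
  C.p k + (a - C.q k) * ((C.p (k + 1) - C.p k) / (C.q (k + 1) - C.q k))

lemma q_lt (k : ℤ) : C.q k < C.q (k + 1) := C.mono (by omega)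

lemma height_left (k : ℤ) : C.height k (C.q k) = C.p k := by simp [height]

lemma height_right (k : ℤ) : C.height k (C.q (k + 1)) = C.p (k + 1) := by
  have := sub_pos.2 (C.q_lt k)
  unfold height
  field_simp
  ring

lemma height_eq_of_lt {j k : ℤ} {a : ℝ} (hj : C.InColumn j a) (hk : C.InColumn k a)
    (h : j < k) : C.height j a = C.height k a := by
  have h1 : C.q (j + 1) ≤ C.q k := C.mono.monotone (by omega)
  have h2 : a = C.q (j + 1) := le_antisymm hj.2 (h1.trans hk.1)
  have h3 : j + 1 = k := C.mono.injective (le_antisymm h1 (hk.1.trans hj.2))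
  subst h3
  rw [h2, height_right, height_left]

lemma height_eq {j k : ℤ} {a : ℝ} (hj : C.InColumn j a) (hk : C.InColumn k a) :
    C.height j a = C.height k a := by
  rcases lt_trichotomy j k with h | rfl | h
  · exact C.height_eq_of_lt hj hk h
  · rfl
  · exact (C.height_eq_of_lt hk hj h).symm

lemma min_le_height {k : ℤ} {a : ℝ} (h : C.InColumn k a) :
    min (C.p k) (C.p (k + 1)) ≤ C.height k a := by
  have h0 := sub_pos.2 (C.q_lt k)
  set t := (a - C.q k) / (C.q (k + 1) - C.q k) with ht
  have ht0 : 0 ≤ t := div_nonneg (by linarith [h.1]) h0.le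
  have ht1 : t ≤ 1 := (div_le_one h0).2 (by linarith [h.2])
  have : C.height k a = (1 - t) * C.p k + t * C.p (k + 1) := by
    rw [ht]; unfold height; field_simp; ring
  rw [this]
  nlinarith [mul_le_mul_of_nonneg_left (min_le_left (C.p k) (C.p (k + 1))) (sub_nonneg.2 ht1),
    mul_le_mul_of_nonneg_left (min_le_right (C.p k) (C.p (k + 1))) ht0]

lemma height_flip (k : ℤ) (a : ℝ) : C.flip.height k a = -C.height k a := by
  simp only [height, flip]; ring

lemma exists_inColumn {a : ℝ} (h₁ : ∃ n, a ≤ C.q n) (h₂ : ∃ n, C.q n ≤ a) :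
    ∃ k, C.InColumn k a := by
  obtain ⟨n₁, h₁⟩ := h₁
  obtain ⟨k, hk, hmax⟩ := Int.exists_greatest_of_bdd (P := fun n => C.q n ≤ a)
    ⟨n₁, fun n hn => C.mono.le_iff_le.1 (hn.trans h₁)⟩ h₂
  refine ⟨k, hk, ?_⟩
  by_contra! h
  have := hmax (k + 1) h.le
  omega

/-- To the right of its domain the curve is at `+∞` or at `-∞`. -/
lemma tendsto_of_bounded {a : ℝ} (h : ∀ n, C.q n < a) :
    Tendsto C.p atTop atTop ∨ Tendsto C.p atTop atBot := by
  have key : ∀ ρ, ∃ N : ℤ, 0 ≤ N ∧ ∀ n, N ≤ n → ρ < |C.p n| := by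
    intro ρ
    have hfin := C.proper (max ρ (max |C.q 0| |a|))
    obtain ⟨B, hB⟩ := hfin.bddAbove
    refine ⟨max 0 (B + 1), le_max_left _ _, fun n hn => ?_⟩
    by_contra! hcon
    have h0 : 0 ≤ n := (le_max_left _ _).trans hn
    have hq0 : C.q 0 ≤ C.q n := C.mono.monotone h0
    have : n ≤ B := hB ⟨(abs_le_max_abs_abs hq0 (h n).le).trans (le_max_right _ _),
      hcon.trans (le_max_left _ _)⟩
    have := (le_max_right 0 (B + 1)).trans hn
    omega
  have hM : 0 ≤ C.M := (abs_nonneg _).trans (C.step 0)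
  obtain ⟨N, hN0, hN⟩ := key C.M
  rcases lt_or_ge 0 (C.p N) with hpos | hneg
  · left
    have hp : ∀ n, N ≤ n → 0 < C.p n := by
      intro n hn
      induction n, hn using Int.leInduction with
      | base => exact hpos
      | succ n hn ih =>
        have h1 := hN n hn
        rw [abs_of_pos ih] at h1
        linarith [(abs_le.1 (C.step n)).1]
    refine tendsto_atTop.2 fun ρ => ?_
    obtain ⟨N', _, hN'⟩ := key ρ
    filter_upwards [eventually_ge_atTop (max N N')] with n hn
    have := hN' n ((le_max_right _ _).trans hn)
    rw [abs_of_pos (hp n ((le_max_left _ _).trans hn))] at this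
    exact this.le
  · right
    have hp : ∀ n, N ≤ n → C.p n ≤ 0 := by
      intro n hn
      induction n, hn using Int.leInduction with
      | base => exact hneg
      | succ n hn ih =>
        have h1 := hN n hn
        rw [abs_of_nonpos ih] at h1
        linarith [(abs_le.1 (C.step n)).2]
    refine tendsto_atBot.2 fun ρ => ?_
    obtain ⟨N', _, hN'⟩ := key (-ρ)
    filter_upwards [eventually_ge_atTop (max N N')] with n hn
    have := hN' n ((le_max_right _ _).trans hn)
    rw [abs_of_nonpos (hp n ((le_max_left _ _).trans hn))] at this
    linarith

lemma tendsto_of_bounded' {a : ℝ} (h : ∀ n, a < C.q n) :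
    Tendsto C.p atBot atTop ∨ Tendsto C.p atBot atBot := by
  have := C.mirror.tendsto_of_bounded (a := -a) fun n => neg_lt_neg (h _)
  have e : C.p = C.mirror.p ∘ fun n => -n := by ext n; simp [mirror]
  rw [e]
  exact this.imp (fun h => h.comp tendsto_neg_atBot_atTop)
    (fun h => h.comp tendsto_neg_atBot_atTop)

/-- The points on or above the curve; a point beyond an end of the domain counts as above when the
curve tends to `-∞` at that end. -/
def epi : Set (ℝ × ℝ) :=
  {x | (∃ k, C.InColumn k x.1 ∧ C.height k x.1 ≤ x.2) ∨
    ((∀ n, C.q n < x.1) ∧ Tendsto C.p atTop atBot) ∨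
    ((∀ n, x.1 < C.q n) ∧ Tendsto C.p atBot atBot)}

/-- The points on or below the curve, with the corresponding convention beyond the ends. -/
def hypo : Set (ℝ × ℝ) := {x | (x.1, -x.2) ∈ C.flip.epi}

lemma mem_hypo {x : ℝ × ℝ} : x ∈ C.hypo ↔ (∃ k, C.InColumn k x.1 ∧ x.2 ≤ C.height k x.1) ∨
    ((∀ n, C.q n < x.1) ∧ Tendsto C.p atTop atTop) ∨
    ((∀ n, x.1 < C.q n) ∧ Tendsto C.p atBot atTop) := by
  have h1 : ∀ l : Filter ℤ, Tendsto C.flip.p l atBot ↔ Tendsto C.p l atTop := fun l =>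
    tendsto_neg_atBot_iff
  change ((∃ k, C.flip.InColumn k x.1 ∧ C.flip.height k x.1 ≤ -x.2) ∨ _) ↔ _
  simp only [height_flip, neg_le_neg_iff, h1]
  rfl

lemma mem_epi_or_mem_hypo (x : ℝ × ℝ) : x ∈ C.epi ∨ x ∈ C.hypo := by
  rw [mem_hypo]
  by_cases h₁ : ∃ n, x.1 ≤ C.q n
  · by_cases h₂ : ∃ n, C.q n ≤ x.1
    · obtain ⟨k, hk⟩ := C.exists_inColumn h₁ h₂
      rcases le_total (C.height k x.1) x.2 with h | h
      · exact .inl (.inl ⟨k, hk, h⟩)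
      · exact .inr (.inl ⟨k, hk, h⟩)
    · push Not at h₂
      rcases C.tendsto_of_bounded' h₂ with h | h
      · exact .inr (.inr (.inr ⟨h₂, h⟩))
      · exact .inl (.inr (.inr ⟨h₂, h⟩))
  · push Not at h₁
    rcases C.tendsto_of_bounded h₁ with h | h
    · exact .inr (.inr (.inl ⟨h₁, h⟩))
    · exact .inl (.inr (.inl ⟨h₁, h⟩))

lemma epi_mono {a b b' : ℝ} (h : (a, b) ∈ C.epi) (hb : b ≤ b') : (a, b') ∈ C.epi := by
  rcases h with ⟨k, hk, h⟩ | h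
  · exact .inl ⟨k, hk, h.trans hb⟩
  · exact .inr h

lemma hypo_mono {a b b' : ℝ} (h : (a, b) ∈ C.hypo) (hb : b' ≤ b) : (a, b') ∈ C.hypo :=
  C.flip.epi_mono h (neg_le_neg hb)

/-- A vertical line meets both `epi` and `hypo` only inside the domain of the curve. -/
lemma exists_height_between {a b b' : ℝ} (h : (a, b) ∈ C.epi) (h' : (a, b') ∈ C.hypo) :
    ∃ k, C.InColumn k a ∧ b' ≤ C.height k a ∧ C.height k a ≤ b := by
  rw [mem_hypo] at h'
  rcases h with ⟨k, hk, h⟩ | ⟨h, ht⟩ | ⟨h, ht⟩ <;>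
    rcases h' with ⟨k', hk', h'⟩ | ⟨h', ht'⟩ | ⟨h', ht'⟩
  · exact ⟨k, hk, by rwa [C.height_eq hk hk'], h⟩
  · exact absurd (h' (k + 1)) (not_lt.2 hk.2)
  · exact absurd (h' k) (not_lt.2 hk.1)
  · exact absurd (h (k' + 1)) (not_lt.2 hk'.2)
  · exact absurd ht' (ht.not_tendsto (disjoint_atBot_atTop))
  · exact absurd (h 0) (not_lt.2 (h' 0).le)
  · exact absurd (h k') (not_lt.2 hk'.1)
  · exact absurd (h 0) (not_lt.2 (h' 0).le)
  · exact absurd ht' (ht.not_tendsto (disjoint_atBot_atTop))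

lemma isClosed_column (k : ℤ) :
    IsClosed {x : ℝ × ℝ | C.InColumn k x.1 ∧ C.height k x.1 ≤ x.2} := by
  unfold InColumn height
  refine IsClosed.and (IsClosed.and ?_ ?_) ?_ <;> exact isClosed_le (by fun_prop) (by fun_prop)

/-- Near a point beyond the right end, where the curve tends to `+∞`, nothing is above it. -/
lemma epi_compl_nhds_right {x : ℝ × ℝ} (h : ∀ n, C.q n < x.1) (ht : Tendsto C.p atTop atTop) :
    C.epiᶜ ∈ nhds x := by
  obtain ⟨N, hN⟩ := eventually_atTop.1 (tendsto_atTop.1 ht (x.2 + 1))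
  have hU : {y : ℝ × ℝ | C.q N < y.1 ∧ y.2 < x.2 + 1} ∈ nhds x := by
    exact IsOpen.mem_nhds ((isOpen_lt continuous_const continuous_fst).inter
      (isOpen_lt continuous_snd continuous_const)) ⟨h N, by linarith⟩
  filter_upwards [hU] with y hy hy'
  rcases hy' with ⟨k, hk, h'⟩ | ⟨h', ht'⟩ | ⟨h', ht'⟩
  · have hk' : N < k + 1 := C.mono.lt_iff_lt.1 (hy.1.trans_le hk.2)
    have := C.min_le_height hk
    have h1 := hN k (by omega)
    have h2 := hN (k + 1) (by omega)
    linarith [le_min h1 h2, hy.2]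
  · exact ht'.not_tendsto disjoint_atBot_atTop ht
  · exact absurd (h' N) (not_lt.2 hy.1.le)

lemma mem_epi_mirror {x : ℝ × ℝ} : x ∈ C.epi ↔ (-x.1, x.2) ∈ C.mirror.epi := by
  have e : C.p = C.mirror.p ∘ fun n => -n := by ext n; simp [mirror]
  have h1 : Tendsto C.p atTop atBot ↔ Tendsto C.mirror.p atBot atBot :=
    ⟨fun h => h.comp tendsto_neg_atBot_atTop, fun h => e ▸ h.comp tendsto_neg_atTop_atBot⟩
  have h2 : Tendsto C.p atBot atBot ↔ Tendsto C.mirror.p atTop atBot :=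
    ⟨fun h => h.comp tendsto_neg_atTop_atBot, fun h => e ▸ h.comp tendsto_neg_atBot_atTop⟩
  have hc : ∀ k, C.InColumn k x.1 ↔ C.mirror.InColumn (-(k + 1)) (-x.1) := by
    intro k
    have e : -(-(k + 1) + 1) = k := by ring
    simp only [InColumn, mirror, neg_neg, neg_le_neg_iff, e]
    exact and_comm
  have hh : ∀ k, C.height k x.1 = C.mirror.height (-(k + 1)) (-x.1) := by
    intro k
    have h0 := sub_pos.2 (C.q_lt k)
    have e : -(-(k + 1) + 1) = k := by ring
    simp only [height, mirror, neg_neg, e]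
    rw [show -C.q k - -C.q (k + 1) = C.q (k + 1) - C.q k by ring]
    field_simp
    ring
  have h3 : (∀ n, C.q n < x.1) ↔ ∀ n, -x.1 < C.mirror.q n :=
    ⟨fun h n => neg_lt_neg (h _), fun h n => by simpa [mirror] using h (-n)⟩
  have h4 : (∀ n, x.1 < C.q n) ↔ ∀ n, C.mirror.q n < -x.1 :=
    ⟨fun h n => neg_lt_neg (h _), fun h n => by simpa [mirror] using h (-n)⟩
  unfold epi
  simp only [Set.mem_ofPred_eq]
  rw [h1, h2, h3, h4, or_comm (a := _ ∧ Tendsto C.mirror.p atTop atBot)]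
  refine or_congr ⟨?_, ?_⟩ Iff.rfl
  · rintro ⟨k, hk, h⟩
    exact ⟨-(k + 1), (hc k).1 hk, hh k ▸ h⟩
  · rintro ⟨k, hk, h⟩
    have e : -(-(k + 1) + 1) = k := by ring
    refine ⟨-(k + 1), (hc _).2 (by rwa [e]), ?_⟩
    rw [hh, e]
    exact h

lemma isClosed_epi : IsClosed C.epi := by
  rw [← isOpen_compl_iff, isOpen_iff_mem_nhds]
  intro x hx
  by_cases h₁ : ∃ n, x.1 ≤ C.q n
  · by_cases h₂ : ∃ n, C.q n ≤ x.1
    · obtain ⟨k, hk⟩ := C.exists_inColumn h₁ h₂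
      have hU : {y : ℝ × ℝ | C.q (k - 1) < y.1 ∧ y.1 < C.q (k + 1 + 1)} ∈ nhds x := by
        exact IsOpen.mem_nhds ((isOpen_lt continuous_const continuous_fst).inter
          (isOpen_lt continuous_fst continuous_const))
          ⟨(C.mono (by omega)).trans_le hk.1, hk.2.trans_lt (C.q_lt _)⟩
      have hcol : ∀ j, {y : ℝ × ℝ | C.InColumn j y.1 ∧ C.height j y.1 ≤ y.2}ᶜ ∈ nhds x := by
        intro j
        exact (C.isClosed_column j).isOpen_compl.mem_nhds fun h => hx (.inl ⟨j, h⟩)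
      filter_upwards [hU, hcol (k - 1), hcol k, hcol (k + 1)] with y hy h0 h1 h2 hy'
      rcases hy' with ⟨j, hj, h'⟩ | ⟨h', -⟩ | ⟨h', -⟩
      · have hj1 : k - 1 < j + 1 := C.mono.lt_iff_lt.1 (hy.1.trans_le hj.2)
        have hj2 : j < k + 1 + 1 := C.mono.lt_iff_lt.1 (hj.1.trans_lt hy.2)
        have : j = k - 1 ∨ j = k ∨ j = k + 1 := by omega
        rcases this with rfl | rfl | rfl
        · exact h0 ⟨hj, h'⟩
        · exact h1 ⟨hj, h'⟩
        · exact h2 ⟨hj, h'⟩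
      · exact absurd (h' _) (not_lt.2 hy.2.le)
      · exact absurd (h' _) (not_lt.2 hy.1.le)
    · push Not at h₂
      have ht := (C.tendsto_of_bounded' h₂).resolve_right fun h => hx (.inr (.inr ⟨h₂, h⟩))
      have := C.mirror.epi_compl_nhds_right (x := (-x.1, x.2)) (fun n => neg_lt_neg (h₂ _))
        (ht.comp tendsto_neg_atTop_atBot)
      have hc : Continuous fun y : ℝ × ℝ => (-y.1, y.2) := by fun_prop
      filter_upwards [hc.continuousAt.preimage_mem_nhds this] with y hy hy'
      exact hy (C.mem_epi_mirror.1 hy')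
  · push Not at h₁
    exact C.epi_compl_nhds_right h₁
      ((C.tendsto_of_bounded h₁).resolve_right fun h => hx (.inr (.inl ⟨h₁, h⟩)))

lemma isClosed_hypo : IsClosed C.hypo := by
  have hc : Continuous fun y : ℝ × ℝ => (y.1, -y.2) := by fun_prop
  exact C.flip.isClosed_epi.preimage hc

end PLCurve

/-! ### Cross and scalar products in the plane -/

namespace Plane

/-- The determinant of two vectors of the plane. -/
def cross (x y : ℂ) : ℝ := x.re * y.im - x.im * y.re

/-- The scalar product of two vectors of the plane. -/
def dot (x y : ℂ) : ℝ := x.re * y.re + x.im * y.im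

lemma cross_add (w x y : ℂ) : cross w (x + y) = cross w x + cross w y := by
  simp [cross]; ring

lemma cross_sub (w x y : ℂ) : cross w (x - y) = cross w x - cross w y := by
  simp [cross]; ring

lemma cross_smul (w : ℂ) (t : ℝ) (x : ℂ) : cross w (t • x) = t * cross w x := by
  simp [cross]; ring

lemma cross_neg (w x : ℂ) : cross w (-x) = -cross w x := by
  simp [cross]; ring

lemma cross_neg_left (w x : ℂ) : cross (-w) x = -cross w x := by
  simp [cross]; ring

lemma cross_self_eq (w : ℂ) : cross w w = 0 := by
  simp [cross]; ring

lemma cross_comm (w x : ℂ) : cross x w = -cross w x := by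
  simp [cross]; ring

lemma dot_add (w x y : ℂ) : dot w (x + y) = dot w x + dot w y := by
  simp [dot]; ring

lemma dot_sub (w x y : ℂ) : dot w (x - y) = dot w x - dot w y := by
  simp [dot]; ring

lemma dot_smul (w : ℂ) (t : ℝ) (x : ℂ) : dot w (t • x) = t * dot w x := by
  simp [dot]; ring

lemma dot_neg (w x : ℂ) : dot w (-x) = -dot w x := by
  simp [dot]; ring

lemma dot_neg_left (w x : ℂ) : dot (-w) x = -dot w x := by
  simp [dot]; ring

lemma dot_self_eq_norm_sq (x : ℂ) : dot x x = ‖x‖ ^ 2 := by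
  rw [← Complex.normSq_eq_norm_sq, Complex.normSq_apply]; rfl

lemma dot_self_pos {w : ℂ} (h : w ≠ 0) : 0 < dot w w := by
  rw [dot_self_eq_norm_sq]; positivity

lemma cross_sq_add_dot_sq (x y : ℂ) : cross x y ^ 2 + dot x y ^ 2 = dot x x * dot y y := by
  simp only [cross, dot]; ring

lemma eq_of_cross_of_dot {w x y : ℂ} (hw : w ≠ 0) (h : cross w x = cross w y)
    (h' : dot w x = dot w y) : x = y := by
  have h1 : cross w (x - y) = 0 := by rw [cross_sub]; linarith
  have h2 : dot w (x - y) = 0 := by rw [dot_sub]; linarith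
  have h3 := cross_sq_add_dot_sq w (x - y)
  rw [h1, h2, dot_self_eq_norm_sq (x - y)] at h3
  have h4 : ‖x - y‖ ^ 2 = 0 := by
    have := (dot_self_pos hw).ne'
    have h5 : dot w w * ‖x - y‖ ^ 2 = 0 := by linarith
    exact (mul_eq_zero.1 h5).resolve_left this
  exact sub_eq_zero.1 (norm_eq_zero.1 (pow_eq_zero_iff (two_ne_zero) |>.1 h4))

lemma continuous_cross (w : ℂ) : Continuous (cross w) := by
  unfold cross; fun_prop

lemma continuous_dot (w : ℂ) : Continuous (dot w) := by
  unfold dot; fun_prop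

lemma abs_dot_le (x y : ℂ) : |dot x y| ≤ ‖x‖ * ‖y‖ := by
  refine abs_le_of_sq_le_sq ?_ (by positivity)
  have := cross_sq_add_dot_sq x y
  rw [dot_self_eq_norm_sq, dot_self_eq_norm_sq] at this
  nlinarith [sq_nonneg (cross x y)]

lemma norm_mul_norm_le (x y : ℂ) : ‖x‖ * ‖y‖ ≤ |cross x y| + |dot x y| := by
  refine le_of_sq_le_sq ?_ (by positivity)
  have := cross_sq_add_dot_sq x y
  rw [dot_self_eq_norm_sq, dot_self_eq_norm_sq, ← sq_abs (cross x y), ← sq_abs (dot x y)] at this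
  nlinarith [mul_nonneg (abs_nonneg (cross x y)) (abs_nonneg (dot x y))]

end Plane

open Plane

/-! ### Ribbons in a graph with straight edges of equal length -/

/-- A connected graph drawn in the plane with straight edges of length `R`, finitely many vertices
in each disk. -/
structure StraightNet (K : Type*) where
  graph : SimpleGraph K
  z : K → ℂ
  R : ℝ
  norm_sub : ∀ {a b}, graph.Adj a b → ‖z b - z a‖ = R
  reachable : ∀ a b, graph.Reachable a b
  finite : ∀ ρ : ℝ, {k | ‖z k‖ ≤ ρ}.Finite

/-- A ribbon with set of ties `E`: a bi-infinite sequence of rhombs, each glued to the next along a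
tie. The tie number `n` leads from `l n` to `r n` and has the fixed vector `w`; the rhombs advance
in one direction (`cross_pos`), and an edge of the graph that meets the open ribbon is a tie
(`clear`). -/
structure StraightNet.Ribbon {K : Type*} (N : StraightNet K) (E : Set (Sym2 K)) where
  l : ℤ → K
  r : ℤ → K
  w : ℂ
  z_r : ∀ n, N.z (r n) = N.z (l n) + w
  adj_l : ∀ n, N.graph.Adj (l n) (l (n + 1))
  adj_r : ∀ n, N.graph.Adj (r n) (r (n + 1))
  adj_lr : ∀ n, N.graph.Adj (l n) (r n)
  cross_pos : ∀ n, 0 < cross w (N.z (l (n + 1)) - N.z (l n))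
  mem_iff : ∀ e, e ∈ E ↔ ∃ n, e = s(l n, r n)
  clear : ∀ {a b}, N.graph.Adj a b → ∀ (n : ℤ) (α β : ℝ), 0 < α → α < 1 → 0 ≤ β → β ≤ 1 →
    N.z (l n) + α • w + β • (N.z (l (n + 1)) - N.z (l n)) ∈ segment ℝ (N.z a) (N.z b) →
    s(a, b) ∈ E

namespace StraightNet.Ribbon

variable {K : Type*} {N : StraightNet K} {E : Set (Sym2 K)} (B : N.Ribbon E)

lemma w_ne_zero : B.w ≠ 0 := by
  intro h
  have := B.cross_pos 0
  simp [h, cross] at this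

lemma strictMono_cross : StrictMono fun n => cross B.w (N.z (B.l n)) := by
  refine strictMono_int_of_lt_succ fun n => ?_
  have := B.cross_pos n
  rw [cross_sub] at this
  linarith

lemma l_injective : Function.Injective B.l := fun a b h =>
  B.strictMono_cross.injective (by simp only [h])

/-- The left boundary of the ribbon, in the coordinates across and along the direction `w`. -/
noncomputable def curve : PLCurve where
  q n := cross B.w (N.z (B.l n))
  p n := dot B.w (N.z (B.l n))
  M := ‖B.w‖ * N.R
  mono := B.strictMono_cross
  step n := by
    rw [← dot_sub, ← N.norm_sub (B.adj_l n)]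
    exact abs_dot_le _ _
  proper ρ := by
    refine ((N.finite ((ρ + ρ) / ‖B.w‖)).preimage B.l_injective.injOn).subset ?_
    rintro n ⟨h1, h2⟩
    have := norm_mul_norm_le B.w (N.z (B.l n))
    have h0 := norm_pos_iff.2 B.w_ne_zero
    change ‖N.z (B.l n)‖ ≤ _
    rw [le_div_iff₀ h0]
    linarith

/-- The closed region on the left of the ribbon. -/
def lower : Set ℂ := {x | (cross B.w x, dot B.w x) ∈ B.curve.hypo}

/-- The closed region on the right of the ribbon, the side to which the ties point. -/
def upper : Set ℂ := {x | (cross B.w x, dot B.w x - dot B.w B.w) ∈ B.curve.epi}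

lemma isClosed_lower : IsClosed B.lower :=
  B.curve.isClosed_hypo.preimage ((continuous_cross _).prodMk (continuous_dot _))

lemma isClosed_upper : IsClosed B.upper :=
  B.curve.isClosed_epi.preimage
    ((continuous_cross _).prodMk ((continuous_dot _).sub continuous_const))

lemma upper_ray {x : ℂ} (h : x ∈ B.upper) {t : ℝ} (ht : 0 ≤ t) : x + t • B.w ∈ B.upper := by
  have h0 := dot_self_pos B.w_ne_zero
  change (_, _) ∈ B.curve.epi
  rw [cross_add, cross_smul, cross_self_eq, mul_zero, add_zero, dot_add, dot_smul]
  exact B.curve.epi_mono h (by nlinarith)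

lemma lower_ray {x : ℂ} (h : x ∈ B.lower) {t : ℝ} (ht : 0 ≤ t) : x - t • B.w ∈ B.lower := by
  have h0 := dot_self_pos B.w_ne_zero
  change (_, _) ∈ B.curve.hypo
  rw [cross_sub, cross_smul, cross_self_eq, mul_zero, sub_zero, dot_sub, dot_smul]
  exact B.curve.hypo_mono h (by nlinarith)

lemma notMem_upper_of_mem_lower {x : ℂ} (h : x ∈ B.lower) : x ∉ B.upper := by
  intro h'
  obtain ⟨k, -, h1, h2⟩ := B.curve.exists_height_between h' h
  linarith [dot_self_pos B.w_ne_zero]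

lemma l_mem_lower (n : ℤ) : N.z (B.l n) ∈ B.lower :=
  B.curve.mem_hypo.2 (.inl ⟨n, ⟨le_rfl, (B.curve.q_lt n).le⟩, (B.curve.height_left n).ge⟩)

lemma r_mem_upper (n : ℤ) : N.z (B.r n) ∈ B.upper := by
  rw [B.z_r]
  change (_, _) ∈ B.curve.epi
  rw [cross_add, cross_self_eq, add_zero, dot_add, add_sub_cancel_right]
  exact .inl ⟨n, ⟨le_rfl, (B.curve.q_lt n).le⟩, (B.curve.height_left n).le⟩

/-- A point at an abscissa in the column `k`, in terms of the side of the left boundary below it. -/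
lemma eq_of_inColumn {k : ℤ} {x : ℂ} (h : B.curve.InColumn k (cross B.w x)) :
    ∃ β : ℝ, 0 ≤ β ∧ β ≤ 1 ∧ x = N.z (B.l k) +
      ((dot B.w x - B.curve.height k (cross B.w x)) / dot B.w B.w) • B.w +
      β • (N.z (B.l (k + 1)) - N.z (B.l k)) := by
  have h0 := sub_pos.2 (B.curve.q_lt k)
  have hw := dot_self_pos B.w_ne_zero
  refine ⟨(cross B.w x - B.curve.q k) / (B.curve.q (k + 1) - B.curve.q k),
    div_nonneg (by linarith [h.1]) h0.le, (div_le_one h0).2 (by linarith [h.2]), ?_⟩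
  refine eq_of_cross_of_dot B.w_ne_zero ?_ ?_
  · simp only [cross_add, cross_smul, cross_self_eq, cross_sub]
    change _ = B.curve.q k + _ + _ * (B.curve.q (k + 1) - B.curve.q k)
    field_simp
    ring
  · simp only [dot_add, dot_smul, dot_sub, PLCurve.height]
    change _ = B.curve.p k + _ + _ * (B.curve.p (k + 1) - B.curve.p k)
    field_simp
    ring

/-- A point on neither side lies in the open ribbon. -/
lemma exists_of_notMem {x : ℂ} (h : x ∉ B.lower) (h' : x ∉ B.upper) :
    ∃ (n : ℤ) (α β : ℝ), 0 < α ∧ α < 1 ∧ 0 ≤ β ∧ β ≤ 1 ∧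
      x = N.z (B.l n) + α • B.w + β • (N.z (B.l (n + 1)) - N.z (B.l n)) := by
  have h1 := (B.curve.mem_epi_or_mem_hypo _).resolve_right h
  have h2 := (B.curve.mem_epi_or_mem_hypo _).resolve_left h'
  obtain ⟨k, hk, h3, h4⟩ := B.curve.exists_height_between h1 h2
  have h5 : B.curve.height k (cross B.w x) ≠ dot B.w x := fun e =>
    h (B.curve.mem_hypo.2 (.inl ⟨k, hk, e.ge⟩))
  have h6 : B.curve.height k (cross B.w x) ≠ dot B.w x - dot B.w B.w := fun e =>
    h' (.inl ⟨k, hk, e.le⟩)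
  have hw := dot_self_pos B.w_ne_zero
  obtain ⟨β, hβ0, hβ1, hx⟩ := B.eq_of_inColumn hk
  refine ⟨k, _, β, div_pos (sub_pos.2 (lt_of_le_of_ne h4 h5)) hw, ?_, hβ0, hβ1, hx⟩
  rw [div_lt_one hw]
  have := lt_of_le_of_ne h3 (Ne.symm h6)
  linarith

/-- An edge that is not a tie stays on one side of the ribbon. -/
lemma segment_subset {a b : K} (hab : N.graph.Adj a b) (h : s(a, b) ∉ E) :
    segment ℝ (N.z a) (N.z b) ⊆ B.lower ∨ segment ℝ (N.z a) (N.z b) ⊆ B.upper := by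
  have hcov : segment ℝ (N.z a) (N.z b) ⊆ B.lower ∪ B.upper := by
    intro x hx
    by_contra hcon
    rw [Set.mem_union, not_or] at hcon
    obtain ⟨n, α, β, h1, h2, h3, h4, rfl⟩ := B.exists_of_notMem hcon.1 hcon.2
    exact h (B.clear hab n α β h1 h2 h3 h4 hx)
  refine isPreconnected_iff_subset_of_disjoint_closed.1
    (convex_segment (N.z a) (N.z b)).isPreconnected _ _ B.isClosed_lower B.isClosed_upper hcov ?_
  ext x
  simp only [Set.mem_inter_iff, Set.mem_empty_iff_false, iff_false, not_and]
  exact fun _ h => B.notMem_upper_of_mem_lower h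

/-- The vertex `k` lies on the right of the ribbon. -/
def side (k : K) : Prop := N.z k ∈ B.upper

lemma not_side_l (n : ℤ) : ¬B.side (B.l n) := B.notMem_upper_of_mem_lower (B.l_mem_lower n)

lemma side_r (n : ℤ) : B.side (B.r n) := B.r_mem_upper n

lemma mem_ties (n : ℤ) : s(B.l n, B.r n) ∈ E := (B.mem_iff _).2 ⟨n, rfl⟩

lemma tie_cases {a b : K} (h : s(a, b) ∈ E) :
    (¬B.side a ∧ B.side b ∧ N.z b - N.z a = B.w ∧ ∃ n, a = B.l n ∧ b = B.r n) ∨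
    (B.side a ∧ ¬B.side b ∧ N.z b - N.z a = -B.w ∧ ∃ n, a = B.r n ∧ b = B.l n) := by
  obtain ⟨n, hn⟩ := (B.mem_iff _).1 h
  rcases Sym2.eq_iff.1 hn with ⟨rfl, rfl⟩ | ⟨rfl, rfl⟩
  · exact .inl ⟨B.not_side_l n, B.side_r n, by rw [B.z_r]; ring, n, rfl, rfl⟩
  · exact .inr ⟨B.side_r n, B.not_side_l n, by rw [B.z_r]; ring, n, rfl, rfl⟩

lemma side_iff {a b : K} (hab : N.graph.Adj a b) (h : s(a, b) ∉ E) : B.side a ↔ B.side b := by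
  rcases B.segment_subset hab h with h | h
  · exact iff_of_false (B.notMem_upper_of_mem_lower (h (left_mem_segment _ _ _)))
      (B.notMem_upper_of_mem_lower (h (right_mem_segment _ _ _)))
  · exact iff_of_true (h (left_mem_segment _ _ _)) (h (right_mem_segment _ _ _))

lemma tie_of_side {a b : K} (hab : N.graph.Adj a b) (ha : ¬B.side a) (hb : B.side b) :
    s(a, b) ∈ E ∧ N.z b - N.z a = B.w := by
  have h : s(a, b) ∈ E := by
    by_contra h
    exact ha ((B.side_iff hab h).2 hb)
  refine ⟨h, ?_⟩
  rcases B.tie_cases h with h | h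
  · exact h.2.2.1
  · exact absurd h.1 ha

lemma mem_lower_of_not_side {a b : K} (hab : N.graph.Adj a b) (ha : ¬B.side a) :
    N.z a ∈ B.lower := by
  by_cases h : s(a, b) ∈ E
  · rcases B.tie_cases h with ⟨-, -, -, n, rfl, -⟩ | h
    · exact B.l_mem_lower n
    · exact absurd h.1 ha
  · rcases B.segment_subset hab h with h | h
    · exact h (left_mem_segment _ _ _)
    · exact absurd (h (left_mem_segment _ _ _)) ha

lemma exists_adj (B : N.Ribbon E) (a : K) : ∃ b, N.graph.Adj a b := by
  by_cases h : a = B.l 0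
  · exact ⟨_, h ▸ B.adj_l 0⟩
  · obtain ⟨p⟩ := N.reachable a (B.l 0)
    cases p with
    | nil => exact absurd rfl h
    | cons h _ => exact ⟨_, h⟩

lemma not_side_iff {a : K} : ¬B.side a ↔ N.z a ∈ B.lower := by
  refine ⟨fun h => ?_, B.notMem_upper_of_mem_lower⟩
  obtain ⟨b, hab⟩ := B.exists_adj a
  exact B.mem_lower_of_not_side hab h

/-- The same ribbon with the two sides exchanged. -/
def reverse : N.Ribbon E where
  l n := B.r (-n)
  r n := B.l (-n)
  w := -B.w
  z_r n := by rw [B.z_r]; ring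
  adj_l n := by
    have := (B.adj_r (-(n + 1))).symm
    rwa [show -(n + 1) + 1 = -n by ring] at this
  adj_r n := by
    have := (B.adj_l (-(n + 1))).symm
    rwa [show -(n + 1) + 1 = -n by ring] at this
  adj_lr n := (B.adj_lr _).symm
  cross_pos n := by
    have := B.cross_pos (-(n + 1))
    rw [show -(n + 1) + 1 = -n by ring] at this
    rw [B.z_r, B.z_r, cross_neg_left, ← cross_neg]
    convert this using 2
    ring
  mem_iff e := by
    rw [B.mem_iff]
    refine ⟨?_, ?_⟩
    · rintro ⟨n, rfl⟩
      exact ⟨-n, by rw [neg_neg, Sym2.eq_swap]⟩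
    · rintro ⟨n, rfl⟩
      exact ⟨-n, Sym2.eq_swap⟩
  clear {a b} hab n α β h1 h2 h3 h4 h := by
    refine B.clear hab (-(n + 1)) (1 - α) (1 - β) (by linarith) (by linarith) (by linarith)
      (by linarith) ?_
    rw [show -(n + 1) + 1 = -n by ring]
    rw [B.z_r, B.z_r] at h
    convert h using 1
    module

/-! ### Separation by a ribbon -/

/-- The left ends of the ties are joined by a path that contains no tie. -/
lemma reachable_l (n : ℤ) : (N.graph.deleteEdges E).Reachable (B.l n) (B.l 0) := by
  have key : ∀ n, (N.graph.deleteEdges E).Reachable (B.l n) (B.l (n + 1)) := by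
    intro n
    refine SimpleGraph.Adj.reachable (SimpleGraph.deleteEdges_adj.2 ⟨B.adj_l n, fun h => ?_⟩)
    rcases B.tie_cases h with h | h
    · exact B.not_side_l _ h.2.1
    · exact B.not_side_l _ h.1
  induction n using Int.induction_on with
  | zero => exact .refl _
  | succ n ih => exact (key n).symm.trans ih
  | pred n ih =>
    have := key (-n - 1)
    rw [sub_add_cancel] at this
    exact this.trans ih

lemma reachable_r (n : ℤ) : (N.graph.deleteEdges E).Reachable (B.r n) (B.r 0) := by
  simpa [reverse] using B.reverse.reachable_l (-n)

lemma reachable_zero (a : K) : (¬B.side a → (N.graph.deleteEdges E).Reachable a (B.l 0)) ∧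
    (B.side a → (N.graph.deleteEdges E).Reachable a (B.r 0)) := by
  obtain ⟨p⟩ := N.reachable a (B.l 0)
  induction h : p.length generalizing a with
  | zero =>
    cases p with
    | nil => exact ⟨fun _ => .refl _, fun h => absurd h (B.not_side_l 0)⟩
    | cons _ _ => simp at h
  | succ m ih =>
    cases p with
    | nil => simp at h
    | @cons _ b _ hab p =>
      simp only [SimpleGraph.Walk.length_cons, Nat.add_right_cancel_iff] at h
      have := ih b p h
      by_cases hE : s(a, b) ∈ E
      · rcases B.tie_cases hE with ⟨h1, -, -, n, rfl, -⟩ | ⟨h1, -, -, n, rfl, -⟩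
        · exact ⟨fun _ => B.reachable_l n, fun h => absurd h h1⟩
        · exact ⟨fun h => absurd h1 h, fun _ => B.reachable_r n⟩
      · have hr := SimpleGraph.Adj.reachable (SimpleGraph.deleteEdges_adj.2 ⟨hab, hE⟩)
        rw [B.side_iff hab hE]
        exact ⟨fun h => hr.trans (this.1 h), fun h => hr.trans (this.2 h)⟩

/-- Two vertices are separated by the ties exactly when they lie on different sides. -/
lemma not_reachable_iff {a b : K} :
    ¬(N.graph.deleteEdges E).Reachable a b ↔ ¬(B.side a ↔ B.side b) := by
  refine not_congr ⟨?_, fun h => ?_⟩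
  · rintro ⟨p⟩
    induction p with
    | nil => rfl
    | cons h _ ih =>
      rw [SimpleGraph.deleteEdges_adj] at h
      exact (B.side_iff h.1 h.2).trans ih
  · by_cases hs : B.side a
    · exact ((B.reachable_zero a).2 hs).trans ((B.reachable_zero b).2 (h.1 hs)).symm
    · exact ((B.reachable_zero a).1 hs).trans
        ((B.reachable_zero b).1 (fun h' => hs (h.2 h'))).symm

/-- Between two separated vertices the ribbon can be oriented from the first to the second. -/
lemma exists_oriented (B : N.Ribbon E) {a b : K} (h : ¬(N.graph.deleteEdges E).Reachable a b) :
    ∃ B' : N.Ribbon E, ¬B'.side a ∧ B'.side b := by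
  have h0 := B.not_reachable_iff.1 h
  by_cases ha : B.side a
  · have h1 : ¬(N.graph.deleteEdges E).Reachable a (B.l 0) :=
      B.not_reachable_iff.2 fun h => B.not_side_l 0 (h.1 ha)
    have h2 := B.reverse.not_reachable_iff.1 h1
    have h3 : B.reverse.side (B.l 0) := B.reverse.side_r 0
    have h4 := B.reverse.not_reachable_iff.1 h
    have h5 : ¬B.reverse.side a := fun h => h2 (iff_of_true h h3)
    exact ⟨B.reverse, h5, by_contra fun hb => h4 (iff_of_false h5 hb)⟩
  · exact ⟨B, ha, by_contra fun hb => h0 (iff_of_false ha hb)⟩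

/-- A path from the left to the right side first meets a tie in the direction `w`. -/
lemma find_dart {a b : K} (p : N.graph.Walk a b) (f : N.graph.Dart → Bool)
    (hf : ∀ d, f d = true ↔ d.edge ∈ E) (ha : ¬B.side a) (hb : B.side b) :
    ∃ d, p.darts.find? f = some d ∧ N.z d.snd - N.z d.fst = B.w := by
  induction p with
  | nil => exact absurd hb ha
  | @cons a c b hac p ih =>
    rw [SimpleGraph.Walk.darts_cons]
    by_cases hE : s(a, c) ∈ E
    · refine ⟨⟨(a, c), hac⟩, List.find?_cons_of_pos ((hf _).2 hE), ?_⟩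
      rcases B.tie_cases hE with h | h
      · exact h.2.2.1
      · exact absurd h.1 ha
    · rw [List.find?_cons_of_neg (fun h => hE ((hf ⟨(a, c), hac⟩).1 h))]
      exact ih (fun h => ha ((B.side_iff hac hE).2 h)) hb

open Classical in
/-- The contribution of the ribbon to the sum of an odd function over the steps of a path. -/
lemma sum_darts {A : Type*} [AddCommGroup A] (c : ℂ → A) (hc : ∀ x, c (-x) = -c x) {a b : K}
    (p : N.graph.Walk a b) :
    (p.darts.map fun d => if d.edge ∈ E then c (N.z d.snd - N.z d.fst) else 0).sum =
      (if B.side b then c B.w else 0) - (if B.side a then c B.w else 0) := by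
  induction p with
  | nil => simp
  | @cons a e b hae p ih =>
    rw [SimpleGraph.Walk.darts_cons, List.map_cons, List.sum_cons, ih]
    change (if s(a, e) ∈ E then c (N.z e - N.z a) else 0) + _ = _
    by_cases hE : s(a, e) ∈ E
    · rcases B.tie_cases hE with ⟨h1, h2, h3, -⟩ | ⟨h1, h2, h3, -⟩
      · simp [hE, h1, h2, h3]
      · simp [hE, h1, h2, h3, hc]
        abel
    · simp [hE, B.side_iff hae hE]

end StraightNet.Ribbon

/-! ### Two ribbons separating the same points -/

namespace StraightNet.Ribbon

open Filter

variable {K : Type*} {N : StraightNet K} {E E' : Set (Sym2 K)}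

/-- The closed region on or to the right of the left boundary of the ribbon. -/
def rightOfLeft (B : N.Ribbon E) : Set ℂ := {x | (cross B.w x, dot B.w x) ∈ B.curve.epi}

lemma isClosed_rightOfLeft (B : N.Ribbon E) : IsClosed B.rightOfLeft :=
  B.curve.isClosed_epi.preimage ((continuous_cross _).prodMk (continuous_dot _))

lemma upper_subset_rightOfLeft (B : N.Ribbon E) : B.upper ⊆ B.rightOfLeft := fun _ h =>
  B.curve.epi_mono h (by linarith [dot_self_pos B.w_ne_zero])

lemma rightOfLeft_ray (B : N.Ribbon E) {x : ℂ} (h : x ∈ B.rightOfLeft) {t : ℝ} (ht : 0 ≤ t) :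
    x + t • B.w ∈ B.rightOfLeft := by
  have h0 := dot_self_pos B.w_ne_zero
  change (_, _) ∈ B.curve.epi
  rw [cross_add, cross_smul, cross_self_eq, mul_zero, add_zero, dot_add, dot_smul]
  exact B.curve.epi_mono h (by nlinarith)

lemma exists_mem_segment (B : N.Ribbon E) {x y : ℂ} (hx : x ∈ B.rightOfLeft) (hy : y ∈ B.lower) :
    ∃ t : ℝ, 0 ≤ t ∧ t ≤ 1 ∧ x + t • (y - x) ∈ B.rightOfLeft ∧ x + t • (y - x) ∈ B.lower := by
  have hcov : segment ℝ x y ⊆ B.rightOfLeft ∪ B.lower := fun z _ => B.curve.mem_epi_or_mem_hypo _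
  obtain ⟨z, hz, h1, h2⟩ := isPreconnected_closed_iff.1 (convex_segment x y).isPreconnected _ _
    B.isClosed_rightOfLeft B.isClosed_lower hcov ⟨x, left_mem_segment _ _ _, hx⟩
    ⟨y, right_mem_segment _ _ _, hy⟩
  rw [segment_eq_image'] at hz
  obtain ⟨t, ht, rfl⟩ := hz
  exact ⟨t, ht.1, ht.2, h1, h2⟩

/-- A point in both regions lies on the left boundary. -/
lemma exists_on_left (B : N.Ribbon E) {x : ℂ} (h : x ∈ B.rightOfLeft) (h' : x ∈ B.lower) :
    ∃ k, B.curve.InColumn k (cross B.w x) ∧ B.curve.height k (cross B.w x) = dot B.w x ∧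
      ∃ β : ℝ, 0 ≤ β ∧ β ≤ 1 ∧ x = N.z (B.l k) + β • (N.z (B.l (k + 1)) - N.z (B.l k)) := by
  obtain ⟨k, hk, h1, h2⟩ := B.curve.exists_height_between h h'
  have h3 := le_antisymm h2 h1
  obtain ⟨β, h4, h5, h6⟩ := B.eq_of_inColumn hk
  refine ⟨k, hk, h3, β, h4, h5, ?_⟩
  rwa [h3, sub_self, zero_div, zero_smul, add_zero] at h6

variable (B : N.Ribbon E) (B' : N.Ribbon E')

lemma mem_segment_of_eq {a b : K} {x : ℂ} {β : ℝ} (h0 : 0 ≤ β) (h1 : β ≤ 1)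
    (hx : x = N.z a + β • (N.z b - N.z a)) : x ∈ segment ℝ (N.z a) (N.z b) := by
  rw [segment_eq_image']
  exact ⟨β, ⟨h0, h1⟩, hx.symm⟩

/-- A ribbon `B'` whose ties point forward along `B` is crossed by the left boundary of `B` only
from left to right. -/
lemma side_succ (h : 0 < cross B.w B'.w) {n : ℤ} (hn : B'.side (B.l n)) :
    B'.side (B.l (n + 1)) := by
  by_contra hcon
  have h1 := (B'.tie_of_side (B.adj_l n).symm hcon hn).2
  have h2 := B.cross_pos n
  rw [← h1, cross_sub] at h
  rw [cross_sub] at h2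
  linarith

lemma side_of_le (h : 0 < cross B.w B'.w) {n m : ℤ} (hnm : n ≤ m) (hn : B'.side (B.l n)) :
    B'.side (B.l m) := by
  induction m, hnm using Int.leInduction with
  | base => exact hn
  | succ m _ ih => exact B.side_succ B' h ih

lemma not_side_succ (h : cross B.w B'.w < 0) {n : ℤ} (hn : ¬B'.side (B.l n)) :
    ¬B'.side (B.l (n + 1)) := by
  intro hcon
  have h1 := (B'.tie_of_side (B.adj_l n) hn hcon).2
  have h2 := B.cross_pos n
  rw [h1] at h2
  linarith

lemma segment_subset_of_side_eq {a b : K} (hab : N.graph.Adj a b) (h : B.side a ↔ B.side b) :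
    segment ℝ (N.z a) (N.z b) ⊆ B.lower ∨ segment ℝ (N.z a) (N.z b) ⊆ B.upper := by
  refine B.segment_subset hab fun hE => ?_
  rcases B.tie_cases hE with h' | h'
  · exact h'.1 (h.2 h'.2.1)
  · exact h'.2.1 (h.1 h'.1)

lemma segment_subset_lower {a b : K} (hab : N.graph.Adj a b) (ha : ¬B.side a) (hb : ¬B.side b) :
    segment ℝ (N.z a) (N.z b) ⊆ B.lower :=
  (B.segment_subset_of_side_eq hab (iff_of_false ha hb)).resolve_right
    fun h => ha (h (left_mem_segment _ _ _))

lemma segment_subset_upper {a b : K} (hab : N.graph.Adj a b) (ha : B.side a) (hb : B.side b) :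
    segment ℝ (N.z a) (N.z b) ⊆ B.upper :=
  (B.segment_subset_of_side_eq hab (iff_of_true ha hb)).resolve_left
    fun h => B.notMem_upper_of_mem_lower (h (left_mem_segment _ _ _)) ha

/-- If `v` is on the right and `u` on the left of two ribbons, then `u - v` is not a nonnegative
combination of their directions. Otherwise the left boundary of the first ribbon meets the ray from
`v` along the second direction, on the right of the second ribbon, and later the ray from `u`
against the second direction, on its left; but it can only cross the second ribbon from left to
right. -/
lemma ne_add_smul_of_cross_pos (h : 0 < cross B.w B'.w) {u v : ℂ} (hu : u ∈ B.lower)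
    (hu' : u ∈ B'.lower) (hv : v ∈ B.upper) (hv' : v ∈ B'.upper) {a b : ℝ} (ha : 0 ≤ a)
    (hb : 0 ≤ b) : u ≠ v + a • B.w + b • B'.w := by
  intro huv
  have hy : v + b • B'.w ∈ B.lower := by
    have := B.lower_ray hu ha
    rwa [huv, show v + a • B.w + b • B'.w - a • B.w = v + b • B'.w by module] at this
  obtain ⟨t, ht0, ht1, hA, hA'⟩ := B.exists_mem_segment (B.upper_subset_rightOfLeft hv) hy
  rw [show v + t • (v + b • B'.w - v) = v + (t * b) • B'.w by module] at hA hA'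
  set q₀ := t * b with hq₀
  have hq0 : 0 ≤ q₀ := mul_nonneg ht0 hb
  have hqb : q₀ ≤ b := by nlinarith
  set A := v + q₀ • B'.w with hAdef
  have hAu : A ∈ B'.upper := B'.upper_ray hv' hq0
  obtain ⟨t', ht0', ht1', hC, hC'⟩ := B.exists_mem_segment (B.rightOfLeft_ray hA ha) hu
  have hCeq : A + a • B.w + t' • (u - (A + a • B.w)) = A + a • B.w + (t' * (b - q₀)) • B'.w := by
    rw [huv, hAdef]; module
  rw [hCeq] at hC hC'
  set q₁ := t' * (b - q₀) with hq₁
  have hq10 : 0 ≤ q₁ := mul_nonneg ht0' (by linarith)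
  have hq1b : q₁ ≤ b - q₀ := by nlinarith
  set C := A + a • B.w + q₁ • B'.w with hCdef
  have hCl : C ∈ B'.lower := by
    have := B'.lower_ray hu' (sub_nonneg.2 hq1b)
    rwa [show u - (b - q₀ - q₁) • B'.w = C by rw [huv, hCdef, hAdef]; module] at this
  have hcr : cross B.w C = cross B.w A + q₁ * cross B.w B'.w := by
    rw [hCdef, cross_add, cross_add, cross_smul, cross_smul, cross_self_eq]; ring
  obtain ⟨k, hk, hkh, β, hβ0, hβ1, hβ⟩ := B.exists_on_left hA hA'
  obtain ⟨k', hk', hkh', β', hβ0', hβ1', hβ'⟩ := B.exists_on_left hC hC'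
  have hsegA := mem_segment_of_eq hβ0 hβ1 hβ
  have hsegC := mem_segment_of_eq hβ0' hβ1' hβ'
  have hdisj : A ≠ C := fun e => B'.notMem_upper_of_mem_lower hCl (e ▸ hAu)
  rcases hq10.eq_or_lt with h0 | hpos
  · have e : cross B.w A = cross B.w C := by rw [hcr, ← h0]; ring
    refine hdisj (eq_of_cross_of_dot B.w_ne_zero e ?_)
    rw [← hkh, ← hkh', e]
    exact B.curve.height_eq (e ▸ hk) hk'
  have hlt : cross B.w A < cross B.w C := by rw [hcr]; linarith [mul_pos hpos h]
  have hS1 : B'.side (B.l (k + 1)) := by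
    by_contra hcon
    have h1 : ¬B'.side (B.l k) := fun h' => hcon (B.side_succ B' h h')
    exact B'.notMem_upper_of_mem_lower (B'.segment_subset_lower (B.adj_l k) h1 hcon hsegA) hAu
  have hS2 : ¬B'.side (B.l k') := by
    intro h1
    exact B'.notMem_upper_of_mem_lower hCl
      (B'.segment_subset_upper (B.adj_l k') h1 (B.side_succ B' h h1) hsegC)
  have hkk : k < k' + 1 := B.curve.mono.lt_iff_lt.1 (hk.1.trans_lt (hlt.trans_le hk'.2))
  rcases (Int.lt_add_one_iff.1 hkk).eq_or_lt with rfl | hkk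
  · have hw := (B'.tie_of_side (B.adj_l k) hS2 hS1).2
    rw [hw] at hβ hβ'
    rcases le_total β β' with hle | hle
    · refine B'.notMem_upper_of_mem_lower hCl ?_
      have := B'.upper_ray hAu (sub_nonneg.2 hle)
      rwa [hβ, show N.z (B.l k) + β • B'.w + (β' - β) • B'.w = N.z (B.l k) + β' • B'.w by module,
        ← hβ'] at this
    · rw [hβ, hβ', cross_add, cross_add, cross_smul, cross_smul] at hlt
      nlinarith
  · exact hS2 (B.side_of_le B' h (by omega) hS1)

lemma ne_add_smul (h : cross B.w B'.w ≠ 0) {u v : ℂ} (hu : u ∈ B.lower)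
    (hu' : u ∈ B'.lower) (hv : v ∈ B.upper) (hv' : v ∈ B'.upper) {a b : ℝ} (ha : 0 ≤ a)
    (hb : 0 ≤ b) : u ≠ v + a • B.w + b • B'.w := by
  rcases h.lt_or_gt with h | h
  · rw [add_right_comm]
    refine B'.ne_add_smul_of_cross_pos B ?_ hu' hu hv' hv hb ha
    rw [cross_comm]; linarith
  · exact B.ne_add_smul_of_cross_pos B' h hu hu' hv hv' ha hb

end StraightNet.Ribbon

/-! ### Nets in which every edge is a tie -/

/-- A net with a family of ribbons such that every edge is a tie of exactly one of them. -/
structure RhombicNet (K τ : Type*) extends StraightNet K where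
  ties : τ → Set (Sym2 K)
  ribbon : ∀ T, Nonempty (toStraightNet.Ribbon (ties T))
  exists_tie : ∀ {a b}, graph.Adj a b → ∃ T, s(a, b) ∈ ties T
  tie_unique : ∀ {T T' e}, e ∈ ties T → e ∈ ties T' → T = T'

namespace RhombicNet

open Filter StraightNet

variable {K τ : Type*} (N : RhombicNet K τ)

lemma exists_ribbon {a b : K} (hab : N.graph.Adj a b) :
    ∃ (T : τ) (B : N.Ribbon (N.ties T)), ¬B.side a ∧ B.side b ∧ B.w = N.z b - N.z a := by
  obtain ⟨T, hT⟩ := N.exists_tie hab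
  obtain ⟨B⟩ := N.ribbon T
  rcases B.tie_cases hT with h | h
  · exact ⟨T, B, h.1, h.2.1, h.2.2.1.symm⟩
  · have : ¬(N.graph.deleteEdges (N.ties T)).Reachable a b :=
      B.not_reachable_iff.2 fun e => h.2.1 (e.1 h.1)
    obtain ⟨B', h1, h2⟩ := B.exists_oriented this
    exact ⟨T, B', h1, h2, (B'.tie_of_side hab h1 h2).2.symm⟩

lemma exists_le_of_tendsto {x : ℕ → ℝ} (hx : Tendsto x atTop atTop) {Λ : ℝ} (h : x 0 ≤ Λ) :
    ∃ k, x k ≤ Λ ∧ Λ ≤ x (k + 1) := by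
  classical
  have hex : ∃ k, Λ < x k := (hx.eventually_gt_atTop Λ).exists
  obtain ⟨k, hk⟩ : ∃ k, Nat.find hex = k + 1 := by
    refine Nat.exists_eq_succ_of_ne_zero fun h0 => ?_
    have := Nat.find_spec hex
    rw [h0] at this
    linarith
  refine ⟨k, not_lt.1 (Nat.find_min hex (by omega)), ?_⟩
  have := Nat.find_spec hex
  rw [hk] at this
  exact this.le

lemma tendsto_cross {w c : ℂ} (h : 0 < cross w c) {x : ℕ → ℂ} {ρ : ℝ}
    (hb : ∀ n, |cross w (x n)| ≤ ρ) (hx : Tendsto (fun n => dot w (x n)) atTop atBot) :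
    Tendsto (fun n => cross c (x n)) atTop atTop := by
  have hw : w ≠ 0 := by
    rintro rfl
    simp [cross] at h
  have h0 := dot_self_pos hw
  have hlim : Tendsto (fun n => (-(|dot w c| * ρ) + cross w c * -dot w (x n)) / dot w w)
      atTop atTop :=
    (tendsto_atTop_add_const_left _ _
      ((tendsto_neg_atBot_atTop.comp hx).const_mul_atTop h)).atTop_div_const h0
  refine tendsto_atTop_mono (fun n => ?_) hlim
  rw [div_le_iff₀ h0]
  have e : cross c (x n) * dot w w = dot w c * cross w (x n) - cross w c * dot w (x n) := by
    simp only [cross, dot]; ring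
  have h1 : |dot w c * cross w (x n)| ≤ |dot w c| * ρ := by
    rw [abs_mul]
    exact mul_le_mul_of_nonneg_left (hb n) (abs_nonneg _)
  rw [e]
  linarith [neg_abs_le (dot w c * cross w (x n))]

/-- A point of the polyline `x` at the level `Λ` of the linear form `cross c`. -/
lemma exists_level {c : ℂ} {x : ℕ → ℂ} (hx : Tendsto (fun n => cross c (x n)) atTop atTop)
    {Λ : ℝ} (h : cross c (x 0) ≤ Λ) :
    ∃ k, ∃ y ∈ segment ℝ (x k) (x (k + 1)), cross c y = Λ := by
  obtain ⟨k, h1, h2⟩ := exists_le_of_tendsto hx h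
  have : Λ ∈ cross c '' segment ℝ (x k) (x (k + 1)) := by
    refine ((convex_segment (x k) (x (k + 1))).isPreconnected.image _
      (continuous_cross c).continuousOn).Icc_subset
      ⟨_, left_mem_segment _ _ _, rfl⟩ ⟨_, right_mem_segment _ _ _, rfl⟩ ⟨h1, h2⟩
  obtain ⟨y, hy, h⟩ := this
  exact ⟨k, y, hy, h⟩

/-- Two ribbons with opposite directions cannot run against the direction of the first one on the
two sides of a common line, the first ribbon before and the second one beyond the line. For a ribbon crossing the first
one far out does not separate the origins of the two tails, hence has the tail of the first ribbon
on its right and the tail of the second one on its left. Its direction points from the former to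
the latter, which is absurd. -/
lemma false_of_tails {T₁ T₂ : τ} (B₁ : N.Ribbon (N.ties T₁)) (B₂ : N.Ribbon (N.ties T₂))
    (hw : B₂.w = -B₁.w) {a : ℝ} (h₁ : ∀ n, cross B₁.w (N.z (B₁.l n)) < a)
    (h₂ : ∀ n, a < cross B₁.w (N.z (B₂.l n)))
    (ht₁ : Tendsto (fun n => dot B₁.w (N.z (B₁.l n))) atTop atBot)
    (ht₂ : Tendsto (fun n => dot B₁.w (N.z (B₂.l n))) atTop atBot) : False := by
  choose T B hBl hBr hBw using fun n : ℕ => N.exists_ribbon (B₁.adj_l n)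
  have hcp : ∀ n, 0 < cross B₁.w (B n).w := fun n => by rw [hBw]; exact B₁.cross_pos n
  obtain ⟨path⟩ := N.reachable (B₁.l 0) (B₂.l 0)
  -- Some ribbon crossing the first tail does not separate the origins.
  obtain ⟨n, hn⟩ : ∃ n, ¬(B n).side (B₂.l 0) := by
    by_contra! hcon
    classical
    have hex : ∀ n, ∃ e : {e // e ∈ path.edges}, e.1 ∈ N.ties (T n) := by
      intro n
      have h0 : ¬(B n).side (B₁.l 0) := fun h =>
        hBl n (B₁.side_of_le (B n) (hcp n) (Int.natCast_nonneg n) h)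
      obtain ⟨d, hd, -⟩ := (B n).find_dart path (fun d => decide (d.edge ∈ N.ties (T n)))
        (fun d => by simp) h0 (hcon n)
      exact ⟨⟨d.edge, List.mem_map_of_mem (List.mem_of_find?_eq_some hd)⟩,
        by simpa using List.find?_some hd⟩
    choose e he using hex
    have : Finite {e // e ∈ path.edges} := List.finite_toSet path.edges
    obtain ⟨n, m, hne, hnm⟩ := Finite.exists_ne_map_eq_of_infinite e
    have key : ∀ n m, e n = e m → n < m → False := by
      intro n m hnm hlt
      have hT : T n = T m := N.tie_unique (he n) (hnm ▸ he m)
      have htie : s(B₁.l m, B₁.l (m + 1)) ∈ N.ties (T n) := by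
        rw [hT]
        exact ((B m).tie_of_side (B₁.adj_l m) (hBl m) (hBr m)).1
      have hs : (B n).side (B₁.l m) :=
        B₁.side_of_le (B n) (hcp n) (by exact_mod_cast hlt) (hBr n)
      rcases (B n).tie_cases htie with h | h
      · exact h.1 hs
      · exact h.2.1 (B₁.side_succ (B n) (hcp n) hs)
    rcases hne.lt_or_gt with h | h
    · exact key n m hnm h
    · exact key m n hnm.symm h
  set D := B n with hD
  have hS₁ : ∀ k : ℕ, D.side (B₁.l (n + 1 + k)) := fun k =>
    B₁.side_of_le D (hcp n) (by omega) (hBr n)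
  have hS₂ : ∀ k : ℕ, ¬D.side (B₂.l k) := by
    intro k
    induction k with
    | zero => exact hn
    | succ k ih =>
      refine B₂.not_side_succ D ?_ ih
      rw [hw, cross_neg_left]
      linarith [hcp n]
  have hl₁ : Tendsto (fun k : ℕ => cross D.w (N.z (B₁.l (n + 1 + k)))) atTop atTop := by
    refine tendsto_cross (hcp n) (ρ := max |cross B₁.w (N.z (B₁.l 0))| |a|) (fun k => ?_)
      (ht₁.comp (tendsto_atTop_add_const_left _ _ tendsto_natCast_atTop_atTop))
    exact abs_le_max_abs_abs (B₁.strictMono_cross.monotone (by omega)) (h₁ _).le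
  have hl₂ : Tendsto (fun k : ℕ => cross D.w (N.z (B₂.l k))) atTop atTop := by
    refine tendsto_cross (hcp n) (ρ := max |a| |cross B₁.w (N.z (B₂.l 0))|) (fun k => ?_)
      (ht₂.comp tendsto_natCast_atTop_atTop)
    refine abs_le_max_abs_abs (h₂ _).le ?_
    have := B₂.strictMono_cross.monotone (Int.natCast_nonneg k)
    simp only [hw, cross_neg_left] at this
    linarith
  set Λ := max (cross D.w (N.z (B₁.l (n + 1 + (0 : ℕ))))) (cross D.w (N.z (B₂.l (0 : ℕ))))
  obtain ⟨k, x, hx, hxΛ⟩ := exists_level (x := fun k : ℕ => N.z (B₁.l (n + 1 + k))) hl₁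
    (le_max_left _ _ : _ ≤ Λ)
  obtain ⟨j, y, hy, hyΛ⟩ := exists_level (x := fun k : ℕ => N.z (B₂.l k)) hl₂
    (le_max_right _ _ : _ ≤ Λ)
  have hxu : x ∈ D.upper := by
    refine D.segment_subset_upper ?_ (hS₁ k) (hS₁ (k + 1)) hx
    have := B₁.adj_l (n + 1 + k)
    push_cast
    rwa [add_assoc (n + 1 : ℤ)] at this
  have hyl : y ∈ D.lower := by
    refine D.segment_subset_lower ?_ (hS₂ j) (hS₂ (j + 1)) hy
    push_cast
    exact B₂.adj_l j
  have hhalf : ∀ (c : ℂ), Convex ℝ {x : ℂ | cross c x < a} ∧ Convex ℝ {x : ℂ | a < cross c x} := by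
    intro c
    have hlin : IsLinearMap ℝ (cross c) :=
      ⟨cross_add c, fun t x => by rw [cross_smul, smul_eq_mul]⟩
    exact ⟨convex_halfSpace_lt hlin a, convex_halfSpace_gt hlin a⟩
  have hxa : cross B₁.w x < a :=
    (hhalf B₁.w).1.segment_subset (h₁ _) (h₁ _) hx
  have hya : a < cross B₁.w y :=
    (hhalf B₁.w).2.segment_subset (h₂ _) (h₂ _) hy
  have hC := dot_self_pos D.w_ne_zero
  have hyx : y = x + (dot D.w (y - x) / dot D.w D.w) • D.w := by
    refine eq_of_cross_of_dot D.w_ne_zero ?_ ?_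
    · rw [cross_add, cross_smul, cross_self_eq, hyΛ, hxΛ]; ring
    · rw [dot_add, dot_smul, div_mul_cancel₀ _ hC.ne', dot_sub]; ring
  refine D.notMem_upper_of_mem_lower hyl ?_
  rw [hyx]
  refine D.upper_ray hxu (le_of_lt ?_)
  rw [hyx, cross_add, cross_smul] at hya
  have : 0 < dot D.w (y - x) / dot D.w D.w * cross B₁.w D.w := by linarith
  exact pos_of_mul_pos_left this (hcp n).le

end RhombicNet

namespace PLCurve

open Filter

variable (C : PLCurve)

lemma forall_lt_or_forall_gt_of_not_inColumn {a : ℝ} (h : ∀ k, ¬C.InColumn k a) :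
    ((∀ n, C.q n < a) ∨ ∀ n, a < C.q n) := by
  by_contra! hcon
  obtain ⟨k, hk⟩ := C.exists_inColumn hcon.1 hcon.2
  exact h k hk

/-- A vertical line that is entirely below the curve lies beyond an end of the domain. -/
lemma beyond_of_forall_mem_hypo {a : ℝ} (h : ∀ b, (a, b) ∈ C.hypo) :
    ((∀ n, C.q n < a) ∧ Tendsto C.p atTop atTop) ∨
    ((∀ n, a < C.q n) ∧ Tendsto C.p atBot atTop) := by
  have hcol : ∀ k, ¬C.InColumn k a := by
    intro k hk
    rcases C.mem_hypo.1 (h (C.height k a + 1)) with ⟨j, hj, h'⟩ | ⟨h', -⟩ | ⟨h', -⟩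
    · rw [C.height_eq hj hk] at h'
      linarith
    · exact absurd (h' (k + 1)) (not_lt.2 hk.2)
    · exact absurd (h' k) (not_lt.2 hk.1)
  rcases C.mem_hypo.1 (h 0) with ⟨j, hj, -⟩ | h' | h'
  · exact absurd hj (hcol j)
  · exact .inl h'
  · exact .inr h'

lemma beyond_of_forall_mem_epi {a : ℝ} (h : ∀ b, (a, b) ∈ C.epi) :
    ((∀ n, C.q n < a) ∧ Tendsto C.p atTop atBot) ∨
    ((∀ n, a < C.q n) ∧ Tendsto C.p atBot atBot) := by
  have h1 : ∀ b, (a, b) ∈ C.flip.hypo := by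
    intro b
    rw [mem_hypo]
    simp only [height_flip]
    have h2 : ∀ l : Filter ℤ, Tendsto C.flip.p l atTop ↔ Tendsto C.p l atBot := fun l =>
      tendsto_neg_atTop_iff
    rcases h (-b) with ⟨k, hk, h'⟩ | h' | h'
    · exact .inl ⟨k, hk, by simp only at h' ⊢; linarith⟩
    · exact .inr (.inl ⟨h'.1, (h2 _).2 h'.2⟩)
    · exact .inr (.inr ⟨h'.1, (h2 _).2 h'.2⟩)
  have h2 : ∀ l : Filter ℤ, Tendsto C.flip.p l atTop ↔ Tendsto C.p l atBot := fun l =>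
    tendsto_neg_atTop_iff
  have := C.flip.beyond_of_forall_mem_hypo h1
  rwa [h2, h2] at this

end PLCurve

namespace RhombicNet

open Filter StraightNet

variable {K τ : Type*} (N : RhombicNet K τ)

/-- The case of `false_of_opposite` in which `v` lies ahead of `u`: somewhere between them the two
boundary curves pass each other, and as the ribbons have no common tie this can only happen at
infinity. -/
lemma false_of_opposite_of_lt {T₁ T₂ : τ} (hT : T₁ ≠ T₂) (B₁ : N.Ribbon (N.ties T₁))
    (B₂ : N.Ribbon (N.ties T₂)) (hw : B₂.w = -B₁.w) {u v : ℂ} (hu₁ : u ∈ B₁.lower)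
    (hu₂ : u ∈ B₂.lower) (hv₁ : v ∈ B₁.upper) (hv₂ : v ∈ B₂.upper)
    (huv : cross B₁.w u < cross B₁.w v) : False := by
  have hc0 := dot_self_pos B₁.w_ne_zero
  set c := dot B₁.w B₁.w with hc
  have hc2 : dot B₂.w B₂.w = c := by rw [hw, dot_neg, dot_neg_left, neg_neg]
  change (_, _) ∈ B₁.curve.hypo at hu₁
  change (_, _) ∈ B₂.curve.hypo at hu₂
  change (_, _) ∈ B₁.curve.epi at hv₁
  change (_, _) ∈ B₂.curve.epi at hv₂
  rw [hc2] at hv₂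
  simp only [hw, cross_neg_left, dot_neg_left] at hu₂ hv₂
  rw [← hc] at hv₁
  set qu := cross B₁.w u
  set qv := cross B₁.w v
  set pu := dot B₁.w u
  set pv := dot B₁.w v
  -- The abscissas where the left boundary of the first ribbon is strictly below, respectively
  -- above, the right boundary of the second one.
  let O₁ : Set ℝ := ⋃ b : ℝ, {a | (a, b) ∉ B₁.curve.hypo ∧ (-a, -b - c) ∉ B₂.curve.hypo}
  let O₂ : Set ℝ := ⋃ b : ℝ, {a | (a, b) ∉ B₁.curve.epi ∧ (-a, -b - c) ∉ B₂.curve.epi}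
  have hO₁ : IsOpen O₁ := by
    refine isOpen_iUnion fun b => IsOpen.inter ?_ ?_
    · exact B₁.curve.isClosed_hypo.isOpen_compl.preimage
        (show Continuous fun a : ℝ => (a, b) by fun_prop)
    · exact B₂.curve.isClosed_hypo.isOpen_compl.preimage
        (show Continuous fun a : ℝ => (-a, -b - c) by fun_prop)
  have hO₂ : IsOpen O₂ := by
    refine isOpen_iUnion fun b => IsOpen.inter ?_ ?_
    · exact B₁.curve.isClosed_epi.isOpen_compl.preimage
        (show Continuous fun a : ℝ => (a, b) by fun_prop)
    · exact B₂.curve.isClosed_epi.isOpen_compl.preimage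
        (show Continuous fun a : ℝ => (-a, -b - c) by fun_prop)
  have hdisj : ∀ a, a ∈ O₁ → a ∈ O₂ → False := by
    intro a h h'
    obtain ⟨b, h1, h2⟩ := Set.mem_iUnion.1 h
    obtain ⟨b', h3, h4⟩ := Set.mem_iUnion.1 h'
    have h1' := (B₁.curve.mem_epi_or_mem_hypo _).resolve_right h1
    have h2' := (B₂.curve.mem_epi_or_mem_hypo _).resolve_right h2
    have h3' := (B₁.curve.mem_epi_or_mem_hypo _).resolve_left h3
    have h4' := (B₂.curve.mem_epi_or_mem_hypo _).resolve_left h4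
    obtain ⟨k, -, h5, h6⟩ := B₁.curve.exists_height_between h1' h3'
    obtain ⟨k', -, h7, h8⟩ := B₂.curve.exists_height_between h2' h4'
    have : b = b' := by linarith
    subst this
    exact h3 h1'
  have hquO : qu ∈ O₂ := by
    refine Set.mem_iUnion.2 ⟨pu - c / 2, fun h => ?_, fun h => ?_⟩
    · obtain ⟨k, -, h1, h2⟩ := B₁.curve.exists_height_between h hu₁
      linarith
    · obtain ⟨k, -, h1, h2⟩ := B₂.curve.exists_height_between h hu₂
      linarith
  have hqvO : qv ∈ O₁ := by
    refine Set.mem_iUnion.2 ⟨pv - c / 2, fun h => ?_, fun h => ?_⟩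
    · obtain ⟨k, -, h1, h2⟩ := B₁.curve.exists_height_between hv₁ h
      linarith
    · obtain ⟨k, -, h1, h2⟩ := B₂.curve.exists_height_between hv₂ h
      linarith
  obtain ⟨a, ha, ha₁, ha₂⟩ : ∃ a ∈ Set.Icc qu qv, a ∉ O₁ ∧ a ∉ O₂ := by
    by_contra! hcon
    obtain ⟨a, -, h1, h2⟩ := isPreconnected_Icc (a := qu) (b := qv) O₁ O₂ hO₁ hO₂
      (fun a ha => by
        by_cases h : a ∈ O₁
        · exact .inl h
        · exact .inr (hcon a ha h))
      ⟨qv, ⟨huv.le, le_rfl⟩, hqvO⟩ ⟨qu, ⟨le_rfl, huv.le⟩, hquO⟩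
    exact hdisj a h1 h2
  have ha₁' : ∀ b, (a, b) ∉ B₁.curve.hypo → (-a, -b - c) ∈ B₂.curve.hypo := fun b h =>
    by_contra fun h' => ha₁ (Set.mem_iUnion.2 ⟨b, h, h'⟩)
  have ha₂' : ∀ b, (a, b) ∉ B₁.curve.epi → (-a, -b - c) ∈ B₂.curve.epi := fun b h =>
    by_contra fun h' => ha₂ (Set.mem_iUnion.2 ⟨b, h, h'⟩)
  by_cases hcol : ∃ k, B₁.curve.InColumn k a
  · -- The curves meet at a finite point; then the ribbons have a tie in common.
    obtain ⟨k, hk⟩ := hcol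
    set h := B₁.curve.height k a with hh
    have hlow : ∀ ε, 0 < ε → (-a, -(h + ε) - c) ∈ B₂.curve.hypo := by
      intro ε hε
      refine ha₁' _ fun h' => ?_
      obtain ⟨j, hj, h1, -⟩ := B₁.curve.exists_height_between
        (b := h) (.inl ⟨k, hk, hh.ge⟩) h'
      rw [B₁.curve.height_eq hj hk] at h1
      linarith
    have hup : ∀ ε, 0 < ε → (-a, -(h - ε) - c) ∈ B₂.curve.epi := by
      intro ε hε
      refine ha₂' _ fun h' => ?_
      obtain ⟨j, hj, -, h1⟩ := B₁.curve.exists_height_between (b' := h) h'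
        (B₁.curve.mem_hypo.2 (.inl ⟨k, hk, hh.le⟩))
      rw [B₁.curve.height_eq hj hk] at h1
      linarith
    have hlow0 : (-a, -h - c) ∈ B₂.curve.hypo := by
      have ht : Tendsto (fun ε : ℝ => (-a, -(h + ε) - c)) (nhdsWithin 0 (Set.Ioi 0))
          (nhds (-a, -h - c)) := by
        have : Continuous fun ε : ℝ => (-a, -(h + ε) - c) := by fun_prop
        simpa using (this.tendsto 0).mono_left nhdsWithin_le_nhds
      exact B₂.curve.isClosed_hypo.mem_of_tendsto ht
        (eventually_nhdsWithin_of_forall fun ε hε => hlow ε hε)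
    have hup0 : (-a, -h - c) ∈ B₂.curve.epi := by
      have ht : Tendsto (fun ε : ℝ => (-a, -(h - ε) - c)) (nhdsWithin 0 (Set.Ioi 0))
          (nhds (-a, -h - c)) := by
        have : Continuous fun ε : ℝ => (-a, -(h - ε) - c) := by fun_prop
        simpa using (this.tendsto 0).mono_left nhdsWithin_le_nhds
      exact B₂.curve.isClosed_epi.mem_of_tendsto ht
        (eventually_nhdsWithin_of_forall fun ε hε => hup ε hε)
    set x : ℂ := (h / c) • B₁.w + (a / c) • (Complex.I * B₁.w) with hx
    have hxa : cross B₁.w x = a := by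
      have h1 : cross B₁.w (Complex.I * B₁.w) = c := by simp [cross, hc, dot]
      rw [hx, cross_add, cross_smul, cross_smul, cross_self_eq, h1]
      field_simp
      ring
    have hxh : dot B₁.w x = h := by
      have h1 : dot B₁.w (Complex.I * B₁.w) = 0 := by simp [dot]; ring
      rw [hx, dot_add, dot_smul, dot_smul, h1, ← hc]
      field_simp
      ring
    obtain ⟨β, hβ0, hβ1, hβ⟩ := B₁.eq_of_inColumn (k := k) (x := x) (by rwa [hxa])
    rw [hxa, hxh, ← hh, sub_self, zero_div, zero_smul, add_zero] at hβ
    have hxu : x ∈ B₂.upper := by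
      change (cross B₂.w x, dot B₂.w x - dot B₂.w B₂.w) ∈ B₂.curve.epi
      rw [hc2, hw, cross_neg_left, dot_neg_left, hxa, hxh]
      exact hup0
    have hxl : x + B₁.w ∈ B₂.lower := by
      change (cross B₂.w (x + B₁.w), dot B₂.w (x + B₁.w)) ∈ B₂.curve.hypo
      rw [hw, cross_neg_left, dot_neg_left, cross_add, cross_self_eq, hxa, dot_add, hxh, ← hc,
        add_zero, neg_add']
      exact hlow0
    have hnot : ∀ {p q : K}, N.graph.Adj p q → N.z q - N.z p =
        N.z (B₁.l (k + 1)) - N.z (B₁.l k) → s(p, q) ∉ N.ties T₂ := by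
      intro p q _ he hE
      have h0 := B₁.cross_pos k
      rw [← he] at h0
      rcases B₂.tie_cases hE with h' | h'
      · rw [h'.2.2.1, hw, cross_neg, cross_self_eq] at h0
        linarith
      · rw [h'.2.2.1, hw, neg_neg, cross_self_eq] at h0
        linarith
    have hl : B₂.side (B₁.l k) := by
      rcases B₂.segment_subset (B₁.adj_l k) (hnot (B₁.adj_l k) rfl) with h' | h'
      · exact absurd hxu (B₂.notMem_upper_of_mem_lower
          (h' (Ribbon.mem_segment_of_eq hβ0 hβ1 hβ)))
      · exact h' (left_mem_segment _ _ _)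
    have hr : ¬B₂.side (B₁.r k) := by
      rcases B₂.segment_subset (B₁.adj_r k)
        (hnot (B₁.adj_r k) (by rw [B₁.z_r, B₁.z_r]; ring)) with h' | h'
      · exact B₂.notMem_upper_of_mem_lower (h' (left_mem_segment _ _ _))
      · refine absurd (h' (Ribbon.mem_segment_of_eq hβ0 hβ1 ?_))
          (B₂.notMem_upper_of_mem_lower hxl)
        rw [hβ, B₁.z_r, B₁.z_r]
        module
    have h1 := (B₂.tie_of_side (B₁.adj_lr k).symm hr hl).1
    rw [Sym2.eq_swap] at h1
    exact hT (N.tie_unique (B₁.mem_ties k) h1)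
  · push Not at hcol
    have hq₂ : ∀ n, B₂.curve.q n = -cross B₁.w (N.z (B₂.l n)) := fun n => by
      change cross B₂.w _ = _
      rw [hw, cross_neg_left]
    have hp₂ : B₂.curve.p = fun n => -dot B₁.w (N.z (B₂.l n)) := by
      ext n
      change dot B₂.w _ = _
      rw [hw, dot_neg_left]
    rcases B₁.curve.forall_lt_or_forall_gt_of_not_inColumn hcol with h1 | h1
    · rcases B₁.curve.tendsto_of_bounded h1 with h2 | h2
      · have h3 : (qv, pv) ∈ B₁.curve.hypo :=
          B₁.curve.mem_hypo.2 (.inr (.inl ⟨fun n => (h1 n).trans_le ha.2, h2⟩))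
        obtain ⟨k, hk, -⟩ := B₁.curve.exists_height_between hv₁ h3
        exact absurd hk.2 (not_le.2 ((h1 _).trans_le ha.2))
      · have h3 : ∀ b, (-a, b) ∈ B₂.curve.hypo := by
          intro b
          have := ha₁' (-b - c) fun h => by
            obtain ⟨k, hk, -⟩ := B₁.curve.exists_height_between
              (b := 0) (.inr (.inl ⟨h1, h2⟩)) h
            exact hcol k hk
          rwa [show -(-b - c) - c = b by ring] at this
        rcases B₂.curve.beyond_of_forall_mem_hypo h3 with ⟨h4, h5⟩ | ⟨h4, h5⟩
        · refine N.false_of_tails B₁ B₂ hw h1 (fun n => ?_) h2 ?_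
          · have := h4 n
            rw [hq₂] at this
            linarith
          · rw [hp₂] at h5
            exact tendsto_neg_atTop_iff.1 h5
        · have h6 : (-qv, -pv) ∈ B₂.curve.hypo :=
            B₂.curve.mem_hypo.2 (.inr (.inr ⟨fun n => (neg_le_neg ha.2).trans_lt (h4 n), h5⟩))
          obtain ⟨k, hk, -⟩ := B₂.curve.exists_height_between hv₂ h6
          exact absurd hk.1 (not_le.2 ((neg_le_neg ha.2).trans_lt (h4 _)))
    · rcases B₁.curve.tendsto_of_bounded' h1 with h2 | h2
      · have h3 : ∀ b, (-a, b) ∈ B₂.curve.epi := by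
          intro b
          have := ha₂' (-b - c) fun h => by
            obtain ⟨k, hk, -⟩ := B₁.curve.exists_height_between (b' := 0) h
              (B₁.curve.mem_hypo.2 (.inr (.inr ⟨h1, h2⟩)))
            exact hcol k hk
          rwa [show -(-b - c) - c = b by ring] at this
        rcases B₂.curve.beyond_of_forall_mem_epi h3 with ⟨h4, h5⟩ | ⟨h4, h5⟩
        · have h6 : (-qu, -pu) ∈ B₂.curve.epi :=
            .inr (.inl ⟨fun n => (h4 n).trans_le (neg_le_neg ha.1), h5⟩)
          obtain ⟨k, hk, -⟩ := B₂.curve.exists_height_between h6 hu₂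
          exact absurd hk.2 (not_le.2 ((h4 _).trans_le (neg_le_neg ha.1)))
        · -- Both curves are at `+∞`: reverse both ribbons.
          refine N.false_of_tails B₁.reverse B₂.reverse (a := -a) (by simp [Ribbon.reverse, hw])
            (fun n => ?_) (fun n => ?_) ?_ ?_
          · change cross (-B₁.w) (N.z (B₁.r (-n))) < _
            rw [B₁.z_r, cross_neg_left, cross_add, cross_self_eq, add_zero]
            exact neg_lt_neg (h1 _)
          · change _ < cross (-B₁.w) (N.z (B₂.r (-n)))
            have := h4 (-n)
            rw [hq₂] at this
            rwa [B₂.z_r, hw, cross_neg_left, cross_add, cross_neg, cross_self_eq, neg_zero, add_zero]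
          · change Tendsto (fun n => dot (-B₁.w) (N.z (B₁.r (-n)))) _ _
            have e : (fun n : ℤ => dot (-B₁.w) (N.z (B₁.r (-n)))) =
                fun n => -(B₁.curve.p (-n) + c) := by
              ext n
              rw [B₁.z_r, dot_neg_left, dot_add]
              rfl
            rw [e]
            exact tendsto_neg_atTop_atBot.comp (tendsto_atTop_add_const_right _ _
              (h2.comp tendsto_neg_atTop_atBot))
          · change Tendsto (fun n => dot (-B₁.w) (N.z (B₂.r (-n)))) _ _
            have e : (fun n : ℤ => dot (-B₁.w) (N.z (B₂.r (-n)))) =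
                fun n => B₂.curve.p (-n) + c := by
              ext n
              rw [B₂.z_r, dot_neg_left, dot_add, hp₂, hw, dot_neg]
              ring
            rw [e]
            exact tendsto_atBot_add_const_right _ _ (h5.comp tendsto_neg_atTop_atBot)
      · have h3 : (qu, pu) ∈ B₁.curve.epi :=
          .inr (.inr ⟨fun n => ha.1.trans_lt (h1 n), h2⟩)
        obtain ⟨k, hk, -⟩ := B₁.curve.exists_height_between h3 hu₁
        exact absurd hk.1 (not_le.2 (ha.1.trans_lt (h1 _)))

/-- Two different ribbons that separate `u` from `v` do not have opposite directions. -/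
lemma false_of_opposite {T₁ T₂ : τ} (hT : T₁ ≠ T₂) (B₁ : N.Ribbon (N.ties T₁))
    (B₂ : N.Ribbon (N.ties T₂)) (hw : B₂.w = -B₁.w) {u v : ℂ} (hu₁ : u ∈ B₁.lower)
    (hu₂ : u ∈ B₂.lower) (hv₁ : v ∈ B₁.upper) (hv₂ : v ∈ B₂.upper) : False := by
  rcases lt_trichotomy (cross B₁.w u) (cross B₁.w v) with h | h | h
  · exact N.false_of_opposite_of_lt hT B₁ B₂ hw hu₁ hu₂ hv₁ hv₂ h
  · set t := dot B₁.w (u - v) / dot B₁.w B₁.w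
    have hu : u = v + t • B₁.w := by
      refine eq_of_cross_of_dot B₁.w_ne_zero ?_ ?_
      · rw [cross_add, cross_smul, cross_self_eq, h]; ring
      · rw [dot_add, dot_smul, div_mul_cancel₀ _ (dot_self_pos B₁.w_ne_zero).ne', dot_sub]; ring
    rcases le_total 0 t with ht | ht
    · exact B₁.notMem_upper_of_mem_lower hu₁ (hu ▸ B₁.upper_ray hv₁ ht)
    · have := B₂.upper_ray hv₂ (neg_nonneg.2 ht)
      rw [hw, neg_smul_neg, ← hu] at this
      exact B₂.notMem_upper_of_mem_lower hu₂ this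
  · refine N.false_of_opposite_of_lt hT.symm B₂ B₁ (by rw [hw, neg_neg]) hu₂ hu₁ hv₂ hv₁ ?_
    rw [hw, cross_neg_left, cross_neg_left]
    linarith

end RhombicNet

/-! ### Sums over separating ribbons and their angles -/

namespace Plane

lemma cross_polar (r s α β : ℝ) :
    cross (r • Complex.exp (α * Complex.I)) (s • Complex.exp (β * Complex.I)) =
      r * s * sin (β - α) := by
  simp only [cross, Complex.smul_re, Complex.smul_im, Complex.exp_ofReal_mul_I_re,
    Complex.exp_ofReal_mul_I_im, smul_eq_mul, sin_sub]
  ring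

lemma cramer {a b : ℂ} (h : cross a b ≠ 0) (x : ℂ) :
    x = (cross x b / cross a b) • a + (cross a x / cross a b) • b := by
  have e : ∀ y : ℂ, cross a b • y = cross y b • a + cross a y • b := by
    intro y
    apply Complex.ext <;> simp [cross] <;> ring
  have := e x
  rw [div_eq_inv_mul, div_eq_inv_mul, mul_smul, mul_smul, ← smul_add, ← this, smul_smul,
    inv_mul_cancel₀ h, one_smul]

lemma cross_sum {ι : Type*} (w : ℂ) (s : Finset ι) (f : ι → ℂ) :
    cross w (∑ i ∈ s, f i) = ∑ i ∈ s, cross w (f i) := by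
  classical
  induction s using Finset.induction_on with
  | empty => simp [cross]
  | insert i s hi ih => rw [Finset.sum_insert hi, Finset.sum_insert hi, cross_add, ih]

/-- The argument may be replaced by its representative in any half-open interval of length `2π`. -/
lemma exp_toIocMod (n : ℤ) (a θ : ℝ) :
    Complex.exp (Complex.I * n * (toIocMod Real.two_pi_pos a θ : ℝ)) =
      Complex.exp (Complex.I * n * θ) := by
  rw [Complex.exp_eq_exp_iff_exists_int]
  refine ⟨-(n * toIocDiv Real.two_pi_pos a θ), ?_⟩
  rw [← self_sub_toIocDiv_zsmul]
  push_cast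
  rw [zsmul_eq_mul]
  ring

lemma eq_norm_smul_exp_toIocMod (a : ℝ) (w : ℂ) :
    w = ‖w‖ • Complex.exp ((toIocMod Real.two_pi_pos a w.arg : ℝ) * Complex.I) := by
  have := exp_toIocMod 1 a w.arg
  rw [Int.cast_one, mul_one, mul_comm, mul_comm Complex.I] at this
  rw [this, Complex.real_smul, Complex.norm_mul_exp_arg_mul_I]

end Plane

namespace RhombicNet

open StraightNet

variable {K τ : Type*} (N : RhombicNet K τ)

/-- The ribbon `T` separates the vertices `u` and `v`. -/
def Sep (T : τ) (u v : K) : Prop := ¬(N.graph.deleteEdges (N.ties T)).Reachable u v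

lemma exists_separating {T : τ} {u v : K} (h : N.Sep T u v) :
    ∃ B : N.Ribbon (N.ties T), ¬B.side u ∧ B.side v := by
  obtain ⟨B⟩ := N.ribbon T
  exact B.exists_oriented h

open Classical in
/-- The vector of the ties of a separating ribbon, pointing to the side of `v`. -/
noncomputable def vec (T : τ) (u v : K) : ℂ :=
  if h : N.Sep T u v then (N.exists_separating h).choose.w else 0

lemma exists_ribbon_vec {T : τ} {u v : K} (h : N.Sep T u v) :
    ∃ B : N.Ribbon (N.ties T), ¬B.side u ∧ B.side v ∧ B.w = N.vec T u v := by
  have := (N.exists_separating h).choose_spec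
  exact ⟨_, this.1, this.2, by rw [vec, dif_pos h]⟩

lemma norm_vec {T : τ} {u v : K} (h : N.Sep T u v) : ‖N.vec T u v‖ = N.R := by
  obtain ⟨B, -, -, hw⟩ := N.exists_ribbon_vec h
  rw [← hw, ← N.norm_sub (B.adj_lr 0), B.z_r, add_sub_cancel_left]

lemma R_pos {T : τ} {u v : K} (h : N.Sep T u v) : 0 < N.R := by
  obtain ⟨B, -, -, hw⟩ := N.exists_ribbon_vec h
  rw [← N.norm_vec h, ← hw]
  exact norm_pos_iff.2 B.w_ne_zero

lemma find_dart {T : τ} {u v : K} (h : N.Sep T u v) (p : N.graph.Walk u v)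
    (f : N.graph.Dart → Bool) (hf : ∀ d, f d = true ↔ d.edge ∈ N.ties T) :
    ∃ d, p.darts.find? f = some d ∧ N.z d.snd - N.z d.fst = N.vec T u v := by
  obtain ⟨B, hu, hv, hw⟩ := N.exists_ribbon_vec h
  rw [← hw]
  exact B.find_dart p f hf hu hv

/-- Only finitely many ribbons meet a given path. -/
lemma finite_touching {u v : K} (p : N.graph.Walk u v) :
    {T | ∃ d ∈ p.darts, d.edge ∈ N.ties T}.Finite := by
  have : {T | ∃ d ∈ p.darts, d.edge ∈ N.ties T} = ⋃ d ∈ {d | d ∈ p.darts},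
      {T | d.edge ∈ N.ties T} := by
    ext T; simp
  rw [this]
  refine Set.Finite.biUnion (List.finite_toSet _) fun d _ => Set.Subsingleton.finite ?_
  exact fun T hT T' hT' => N.tie_unique hT hT'

lemma touching_of_sep {T : τ} {u v : K} (h : N.Sep T u v) (p : N.graph.Walk u v) :
    ∃ d ∈ p.darts, d.edge ∈ N.ties T := by
  classical
  obtain ⟨d, hd, -⟩ := N.find_dart h p (fun d => decide (d.edge ∈ N.ties T)) (fun d => by simp)
  exact ⟨d, List.mem_of_find?_eq_some hd, by simpa using List.find?_some hd⟩

lemma finite_sep (u v : K) : {T | N.Sep T u v}.Finite := by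
  obtain ⟨p⟩ := N.reachable u v
  exact (N.finite_touching p).subset fun T hT => N.touching_of_sep hT p

/-- The sum of an odd function over the steps of a path: ribbons that do not separate the ends
contribute nothing, and a separating one contributes its value at the direction of crossing. -/
lemma sum_darts {A : Type*} [AddCommGroup A] (c : ℂ → A) (hc : ∀ x, c (-x) = -c x) {u v : K}
    (p : N.graph.Walk u v) :
    (p.darts.map fun d => c (N.z d.snd - N.z d.fst)).sum =
      ∑ T ∈ (N.finite_sep u v).toFinset, c (N.vec T u v) := by
  classical
  set F := (N.finite_touching p).toFinset
  have h1 : ∀ L : List N.graph.Dart, (∀ d ∈ L, d ∈ p.darts) →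
      (L.map fun d => c (N.z d.snd - N.z d.fst)).sum = ∑ T ∈ F, (L.map fun d =>
        if d.edge ∈ N.ties T then c (N.z d.snd - N.z d.fst) else 0).sum := by
    intro L hL
    induction L with
    | nil => simp
    | cons d L ih =>
      simp only [List.map_cons, List.sum_cons, Finset.sum_add_distrib]
      rw [← ih fun d' hd' => hL d' (List.mem_cons_of_mem _ hd')]
      congr 1
      obtain ⟨T, hT⟩ := N.exists_tie d.adj
      have hT' : d.edge ∈ N.ties T := hT
      rw [Finset.sum_eq_single T, if_pos hT']
      · exact fun T' _ hne => if_neg fun h => hne (N.tie_unique h hT')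
      · intro hF
        exact absurd ((N.finite_touching p).mem_toFinset.2 ⟨d, hL d (List.mem_cons_self ..), hT'⟩) hF
  have h2 : ∀ T, (p.darts.map fun d =>
      if d.edge ∈ N.ties T then c (N.z d.snd - N.z d.fst) else 0).sum =
      if N.Sep T u v then c (N.vec T u v) else 0 := by
    intro T
    by_cases h : N.Sep T u v
    · obtain ⟨B, hu, hv, hw⟩ := N.exists_ribbon_vec h
      rw [B.sum_darts c hc p, if_pos hv, if_neg hu, if_pos h, hw, sub_zero]
    · obtain ⟨B⟩ := N.ribbon T
      have hs : B.side u ↔ B.side v := not_not.1 fun h' => h (B.not_reachable_iff.2 h')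
      rw [B.sum_darts c hc p, if_neg h]
      simp [hs]
  rw [h1 _ fun d hd => hd, Finset.sum_congr rfl fun T _ => h2 T, ← Finset.sum_filter]
  refine Finset.sum_congr ?_ fun _ _ => rfl
  ext T
  simp only [Finset.mem_filter, Set.Finite.mem_toFinset, F, Set.mem_ofPred_eq]
  exact ⟨fun h => h.2, fun h => ⟨N.touching_of_sep h p, h⟩⟩

lemma sub_eq_sum_vec (u v : K) :
    N.z v - N.z u = ∑ T ∈ (N.finite_sep u v).toFinset, N.vec T u v := by
  obtain ⟨p⟩ := N.reachable u v
  have hsum := N.sum_darts id (fun _ => rfl) p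
  simp only [id] at hsum
  rw [← hsum]
  clear hsum
  induction p with
  | nil => simp
  | cons h p ih =>
    rw [SimpleGraph.Walk.darts_cons, List.map_cons, List.sum_cons, ← ih]
    simp

/-- The angle, in `(θ₀ - π, θ₀ + π]`, in which the separating ribbon `T` is crossed on the way from
`u` to `v`, where `θ₀` is the direction from `u` to `v`. -/
noncomputable def angle (T : τ) (u v : K) : ℝ :=
  toIocMod Real.two_pi_pos ((N.z v - N.z u).arg - π) (N.vec T u v).arg

lemma vec_eq {T : τ} {u v : K} (h : N.Sep T u v) :
    N.vec T u v = N.R • Complex.exp ((N.angle T u v : ℝ) * Complex.I) := by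
  rw [← N.norm_vec h]
  exact eq_norm_smul_exp_toIocMod _ _

lemma sub_eq (u v : K) : N.z v - N.z u =
    ‖N.z v - N.z u‖ • Complex.exp (((N.z v - N.z u).arg : ℝ) * Complex.I) := by
  rw [Complex.real_smul, Complex.norm_mul_exp_arg_mul_I]

lemma angle_mem (T : τ) (u v : K) : (N.z v - N.z u).arg - π < N.angle T u v ∧
    N.angle T u v ≤ (N.z v - N.z u).arg + π := by
  have := toIocMod_mem_Ioc Real.two_pi_pos ((N.z v - N.z u).arg - π) (N.vec T u v).arg
  refine ⟨this.1, this.2.trans_eq ?_⟩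
  ring

/-- A separating ribbon is not crossed against the direction from `u` to `v`, for the ray from `v`
in the direction of crossing stays on the side of `v`. -/
lemma angle_lt {T : τ} {u v : K} (h : N.Sep T u v) :
    N.angle T u v < (N.z v - N.z u).arg + π := by
  refine lt_of_le_of_ne (N.angle_mem T u v).2 fun e => ?_
  obtain ⟨B, hu, hv, hw⟩ := N.exists_ribbon_vec h
  have hR := N.R_pos h
  have h1 := N.vec_eq h
  rw [e] at h1
  push_cast at h1
  rw [add_mul, Complex.exp_add, Complex.exp_pi_mul_I] at h1
  refine hu (?_ : N.z u ∈ B.upper)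
  have h2 : N.z u = N.z v + (‖N.z v - N.z u‖ / N.R) • B.w := by
    have h3 := N.sub_eq u v
    rw [hw, h1, smul_smul, div_mul_cancel₀ _ hR.ne', mul_neg, mul_one, smul_neg, ← h3]
    ring
  rw [h2]
  exact B.upper_ray hv (by positivity)

/-- All the angles of crossing lie in an open half plane: if two of them differ by more than `π`,
then `u - v` is a nonnegative combination of their directions. -/
lemma angle_sub_lt {T T' : τ} {u v : K} (h : N.Sep T u v) (h' : N.Sep T' u v)
    (huv : N.z u ≠ N.z v) : N.angle T u v - N.angle T' u v < π := by
  by_contra! hcon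
  obtain ⟨B, hu, hv, hw⟩ := N.exists_ribbon_vec h
  obtain ⟨B', hu', hv', hw'⟩ := N.exists_ribbon_vec h'
  rw [B.not_side_iff] at hu
  rw [B'.not_side_iff] at hu'
  have hR := N.R_pos h
  have hv1 := N.vec_eq h
  have hv2 := N.vec_eq h'
  have hpi := Real.pi_pos
  have ha := N.angle_lt h
  have hb := (N.angle_mem T' u v).1
  set θ := (N.z v - N.z u).arg with hθ
  set α := N.angle T u v
  set β := N.angle T' u v
  rcases hcon.eq_or_lt with heq | hlt
  · have hT : T ≠ T' := by
      rintro rfl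
      simp only [α, β] at heq
      linarith
    refine N.false_of_opposite hT B B' ?_ hu hu' hv hv'
    have e : α = β + π := by linarith
    rw [hw, hw', hv1, hv2, e]
    push_cast
    rw [add_mul, Complex.exp_add, Complex.exp_pi_mul_I]
    simp
  · have hs : 0 < sin (β - α) := by
      rw [← sin_add_two_pi]
      exact sin_pos_of_pos_of_lt_pi (by linarith) (by linarith)
    have hcr : 0 < cross B.w B'.w := by
      rw [hw, hw', hv1, hv2, cross_polar]
      positivity
    have hD : 0 < ‖N.z v - N.z u‖ := norm_pos_iff.2 (sub_ne_zero.2 huv.symm)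
    have h1 : 0 ≤ cross (-(N.z v - N.z u)) B'.w := by
      rw [cross_neg_left, hw', hv2, N.sub_eq u v, cross_polar, ← hθ]
      have : sin (β - θ) < 0 := sin_neg_of_neg_of_neg_pi_lt (by linarith) (by linarith)
      nlinarith [mul_pos hD hR]
    have h2 : 0 ≤ cross B.w (-(N.z v - N.z u)) := by
      rw [cross_neg, hw, hv1, N.sub_eq u v, cross_polar, ← hθ]
      have : sin (θ - α) < 0 := sin_neg_of_neg_of_neg_pi_lt (by linarith) (by linarith)
      nlinarith [mul_pos hD hR]
    refine B.ne_add_smul B' hcr.ne' hu hu' hv hv' (div_nonneg h1 hcr.le) (div_nonneg h2 hcr.le) ?_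
    rw [add_assoc, ← cramer hcr.ne']
    ring

/-- The direction from `u` to `v` is a positive combination of the directions of crossing, hence
does not lie strictly on one side of all of them. -/
lemma exists_angle_le_and_le {u v : K} (huv : N.z u ≠ N.z v) :
    (∃ T, N.Sep T u v ∧ N.angle T u v ≤ (N.z v - N.z u).arg) ∧
    (∃ T, N.Sep T u v ∧ (N.z v - N.z u).arg ≤ N.angle T u v) := by
  have hD : 0 < ‖N.z v - N.z u‖ := norm_pos_iff.2 (sub_ne_zero.2 huv.symm)
  have hsum := N.sub_eq_sum_vec u v
  have hne : (N.finite_sep u v).toFinset.Nonempty := by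
    by_contra h
    rw [Finset.not_nonempty_iff_eq_empty] at h
    rw [h, Finset.sum_empty] at hsum
    rw [hsum, norm_zero] at hD
    exact lt_irrefl _ hD
  have hmem : ∀ T ∈ (N.finite_sep u v).toFinset, N.Sep T u v := fun T hT =>
    (N.finite_sep u v).mem_toFinset.1 hT
  have h0 : ∑ T ∈ (N.finite_sep u v).toFinset, cross (N.z v - N.z u) (N.vec T u v) = 0 := by
    rw [← cross_sum, ← hsum, cross_self_eq]
  have hval : ∀ T, N.Sep T u v → cross (N.z v - N.z u) (N.vec T u v) =
      ‖N.z v - N.z u‖ * N.R * sin (N.angle T u v - (N.z v - N.z u).arg) := by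
    intro T hT
    conv_lhs => rw [N.vec_eq hT, N.sub_eq u v]
    rw [cross_polar]
  constructor
  · by_contra! hcon
    refine (Finset.sum_pos (fun T hT => ?_) hne).ne' h0
    have hT := hmem T hT
    rw [hval T hT]
    have := sin_pos_of_pos_of_lt_pi (sub_pos.2 (hcon T hT)) (by linarith [N.angle_lt hT])
    have := N.R_pos hT
    positivity
  · by_contra! hcon
    refine (Finset.sum_neg (fun T hT => ?_) hne).ne h0
    have hT := hmem T hT
    rw [hval T hT]
    have := sin_neg_of_neg_of_neg_pi_lt (sub_neg.2 (hcon T hT))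
      (by linarith [(N.angle_mem T u v).1])
    have := N.R_pos hT
    exact mul_neg_of_pos_of_neg (by positivity) (by assumption)

end RhombicNet

/-! ### Points on circles and finite convex hulls in the plane -/

namespace Plane

lemma eq_smul_of_cross_eq_zero {w x : ℂ} (hw : w ≠ 0) (h : cross w x = 0) :
    x = (dot w x / dot w w) • w := by
  refine eq_of_cross_of_dot hw ?_ ?_
  · rw [h, cross_smul, cross_self_eq, mul_zero]
  · rw [dot_smul, div_mul_cancel₀ _ (dot_self_pos hw).ne']

lemma norm_eq_iff_dot {x y : ℂ} : ‖x‖ = ‖y‖ ↔ dot x x = dot y y := by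
  rw [dot_self_eq_norm_sq, dot_self_eq_norm_sq]
  exact (pow_left_inj₀ (norm_nonneg _) (norm_nonneg _) two_ne_zero).symm

/-- A line meets a circle in at most two points. -/
lemma eq_or_eq_of_cross_eq_zero {a b c o : ℂ} (hb : ‖b - o‖ = ‖a - o‖) (hc : ‖c - o‖ = ‖a - o‖)
    (hab : a ≠ b) (h : cross (b - a) (c - a) = 0) : c = a ∨ c = b := by
  have hw : b - a ≠ 0 := sub_ne_zero.2 hab.symm
  have h1 := eq_smul_of_cross_eq_zero hw h
  set t := dot (b - a) (c - a) / dot (b - a) (b - a)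
  have hpos := dot_self_pos hw
  rw [norm_eq_iff_dot] at hb hc
  have hc' : c = a + t • (b - a) := by rw [← h1]; ring
  have key : t * (t - 1) * dot (b - a) (b - a) = 0 := by
    rw [hc'] at hc
    simp only [dot, Complex.sub_re, Complex.sub_im, Complex.add_re, Complex.add_im,
      Complex.smul_re, Complex.smul_im, smul_eq_mul] at hb hc ⊢
    linear_combination hc - t * hb
  rcases mul_eq_zero.1 ((mul_eq_zero.1 key).resolve_right hpos.ne') with h0 | h0
  · left; rw [hc', h0, zero_smul, add_zero]
  · right
    rw [hc', sub_eq_zero.1 h0, one_smul]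
    ring

/-- Two circles of equal radius through `a` and `b` have centres symmetric about the midpoint. -/
lemma add_eq_add_of_norm_eq {a b o o' : ℂ} (h₁ : ‖b - o‖ = ‖a - o‖) (h₂ : ‖a - o'‖ = ‖a - o‖)
    (h₃ : ‖b - o'‖ = ‖a - o‖) (hab : a ≠ b) (hoo : o ≠ o') : o + o' = a + b := by
  rw [norm_eq_iff_dot] at h₁ h₂ h₃
  have he : o - o' ≠ 0 := sub_ne_zero.2 hoo
  have hd : b - a ≠ 0 := sub_ne_zero.2 hab.symm
  have hde : dot (o - o') (b - a) = 0 := by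
    simp only [dot, Complex.sub_re, Complex.sub_im] at h₁ h₂ h₃ ⊢
    linear_combination (-1 / 2) * h₁ - (1 / 2) * h₂ + (1 / 2) * h₃
  have h4 : dot (o - o') (o + o' - (a + b)) = 0 := by
    simp only [dot, Complex.sub_re, Complex.sub_im, Complex.add_re, Complex.add_im] at h₁ h₂ h₃ ⊢
    linear_combination (1 / 2) * h₁ - (1 / 2) * h₂ - (1 / 2) * h₃
  have h5 : dot (b - a) (o + o' - (a + b)) = 0 := by
    simp only [dot, Complex.sub_re, Complex.sub_im, Complex.add_re, Complex.add_im] at h₁ h₂ h₃ ⊢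
    linear_combination (-1 / 2) * h₁ + (1 / 2) * h₂ - (1 / 2) * h₃
  have h6 : cross (o - o') (b - a) ≠ 0 := by
    intro h
    have := cross_sq_add_dot_sq (o - o') (b - a)
    rw [h, hde] at this
    have := mul_pos (dot_self_pos he) (dot_self_pos hd)
    linarith
  have h7 : cross (o - o') (o + o' - (a + b)) = 0 := by
    have : cross (o - o') (b - a) * cross (o - o') (o + o' - (a + b)) = 0 := by
      have e : cross (o - o') (b - a) * cross (o - o') (o + o' - (a + b)) =
          dot (o - o') (o - o') * dot (b - a) (o + o' - (a + b)) -
          dot (o - o') (b - a) * dot (o - o') (o + o' - (a + b)) := by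
        simp only [cross, dot]; ring
      rw [e, h4, h5]; ring
    exact (mul_eq_zero.1 this).resolve_left h6
  have := eq_of_cross_of_dot (w := o - o') (x := o + o' - (a + b)) (y := 0) he
    (by rw [h7]; simp [cross]) (by rw [h4]; simp [dot])
  exact sub_eq_zero.1 this

lemma convex_cross_nonneg (e y : ℂ) : Convex ℝ {x : ℂ | 0 ≤ cross e (x - y)} := by
  have hlin : IsLinearMap ℝ (cross e) := ⟨cross_add e, fun t x => by rw [cross_smul, smul_eq_mul]⟩
  have : {x : ℂ | 0 ≤ cross e (x - y)} = {x | cross e y ≤ cross e x} := by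
    ext x; simp [cross_sub]
  rw [this]
  exact convex_halfSpace_ge hlin _

lemma isClosed_cross_nonneg (e y : ℂ) : IsClosed {x : ℂ | 0 ≤ cross e (x - y)} :=
  isClosed_le continuous_const ((continuous_cross e).comp (continuous_id.sub continuous_const))

lemma cross_mul_I (e : ℂ) : cross e (Complex.I * e) = dot e e := by
  simp [cross, dot]

/-- From a point of an open set one can move a little in any direction. -/
lemma exists_add_smul_mem {U : Set ℂ} (hU : IsOpen U) {x : ℂ} (hx : x ∈ U) (y : ℂ) :
    ∃ ε : ℝ, 0 < ε ∧ x + ε • y ∈ U := by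
  have hc : Continuous fun ε : ℝ => x + ε • y := by fun_prop
  have h : ∀ᶠ ε in nhdsWithin (0 : ℝ) (Set.Ioi 0), x + ε • y ∈ U := by
    refine (hc.tendsto 0).mono_left nhdsWithin_le_nhds |>.eventually (hU.mem_nhds ?_)
    simpa using hx
  obtain ⟨ε, h1, h2⟩ := (h.and self_mem_nhdsWithin).exists
  exact ⟨ε, h2, h1⟩

/-- A point of a finite convex hull on a supporting line, not one of the spanning points, has
spanning points of that line on both sides. -/
lemma exists_on_supporting_line {S : Set ℂ} (hS : S.Finite) {m e : ℂ} (he : e ≠ 0)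
    (hm : m ∈ convexHull ℝ S) (hmS : m ∉ S) (hsup : ∀ s ∈ S, 0 ≤ cross e (s - m)) :
    ∃ p ∈ S, ∃ q ∈ S, cross e (p - m) = 0 ∧ cross e (q - m) = 0 ∧ dot e (p - m) < 0 ∧
      0 < dot e (q - m) := by
  lift S to Finset ℂ using hS
  obtain ⟨w, hw0, hw1, hwm⟩ := Finset.mem_convexHull'.1 hm
  have hlin : ∀ φ : ℂ → ℝ, IsLinearMap ℝ φ → ∑ s ∈ S, w s * φ (s - m) = 0 := by
    intro φ hφ
    have h0 : ∑ s ∈ S, w s • (s - m) = 0 := by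
      simp only [smul_sub, Finset.sum_sub_distrib, ← Finset.sum_smul, hw1, one_smul, hwm, sub_self]
    have h1 := congrArg (hφ.mk' φ) h0
    simpa only [map_sum, map_smul, map_zero, IsLinearMap.mk'_apply, smul_eq_mul] using h1
  have hcr : ∀ s ∈ S, w s * cross e (s - m) = 0 :=
    (Finset.sum_eq_zero_iff_of_nonneg fun s hs => mul_nonneg (hw0 s hs) (hsup s hs)).1
      (hlin _ ⟨cross_add e, cross_smul e⟩)
  have hdot := hlin _ ⟨dot_add e, dot_smul e⟩
  obtain ⟨s₀, hs₀, hws₀⟩ : ∃ s ∈ S, 0 < w s := by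
    by_contra! h
    have := Finset.sum_nonpos h
    linarith
  have hne : ∀ s ∈ S, 0 < w s → cross e (s - m) = 0 ∧ dot e (s - m) ≠ 0 := by
    intro s hs hws
    have h1 := (mul_eq_zero.1 (hcr s hs)).resolve_left hws.ne'
    refine ⟨h1, fun h2 => hmS ?_⟩
    have := eq_of_cross_of_dot (w := e) (x := s - m) (y := 0) he
      (by rw [h1]; simp [cross]) (by rw [h2]; simp [dot])
    rwa [← sub_eq_zero.1 this]
  have hneg : ∃ p ∈ S, w p * dot e (p - m) < 0 := by
    by_contra! h
    have := (Finset.sum_eq_zero_iff_of_nonneg h).1 hdot s₀ hs₀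
    exact (hne s₀ hs₀ hws₀).2 ((mul_eq_zero.1 this).resolve_left hws₀.ne')
  have hpos : ∃ q ∈ S, 0 < w q * dot e (q - m) := by
    by_contra! h
    have := (Finset.sum_eq_zero_iff_of_nonpos h).1 hdot s₀ hs₀
    exact (hne s₀ hs₀ hws₀).2 ((mul_eq_zero.1 this).resolve_left hws₀.ne')
  obtain ⟨p, hp, hp'⟩ := hneg
  obtain ⟨q, hq, hq'⟩ := hpos
  have hwp : 0 < w p := (hw0 p hp).lt_of_ne fun h => by rw [← h, zero_mul] at hp'; linarith
  have hwq : 0 < w q := (hw0 q hq).lt_of_ne fun h => by rw [← h, zero_mul] at hq'; linarith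
  exact ⟨p, hp, q, hq, (hne p hp hwp).1, (hne q hq hwq).1, by nlinarith,
    pos_of_mul_pos_right hq' hwq.le⟩

/-- Let the closure of a convex set contain a segment around `m`. Then the segment from `m` to any
point strictly on the same side as an interior point `x₀` meets the interior. -/
lemma exists_mem_interior_of_cross_pos {C : Set ℂ} (hC : Convex ℝ C) {p q m x₀ y : ℂ}
    (hp : p ∈ closure C) (hq : q ∈ closure C) (hx₀ : x₀ ∈ interior C)
    {s : ℝ} (hs0 : 0 < s) (hs1 : s < 1) (hm : m = p + s • (q - p))
    (hx : 0 < cross (q - p) (x₀ - m)) (hy : 0 < cross (q - p) (y - m)) :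
    ∃ ε : ℝ, 0 ≤ ε ∧ ε ≤ 1 ∧ m + ε • (y - m) ∈ interior C := by
  set α := cross (y - m) (x₀ - m) / cross (q - p) (x₀ - m) with hα
  set β := cross (q - p) (y - m) / cross (q - p) (x₀ - m) with hβ
  have hβ0 : 0 < β := div_pos hy hx
  have hy' : y - m = α • (q - p) + β • (x₀ - m) := cramer hx.ne' _
  set ρ := min s (1 - s) with hρ
  have hρ0 : 0 < ρ := lt_min hs0 (by linarith)
  set D := ρ * β + |α| + ρ with hD
  have hα0 := abs_nonneg α
  have hρβ := mul_pos hρ0 hβ0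
  have hD0 : 0 < D := by linarith
  set ε := ρ / D with hε
  have hεD : ε * D = ρ := div_mul_cancel₀ _ hD0.ne'
  have hε0 : 0 < ε := div_pos hρ0 hD0
  have hε1 : ε ≤ 1 := (div_le_one hD0).2 (by linarith)
  have hεβ : ε * β < 1 := by
    have : ρ * (ε * β) < ρ := by nlinarith
    nlinarith
  have hεα : ε * |α| ≤ ρ * (1 - ε * β) := by nlinarith
  refine ⟨ε, hε0.le, hε1, ?_⟩
  set δ := ε * α / (1 - ε * β) with hδ
  have h1 : 0 < 1 - ε * β := by linarith
  have hδρ : |δ| ≤ ρ := by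
    rw [hδ, abs_div, abs_mul, abs_of_pos hε0, abs_of_pos h1, div_le_iff₀ h1]
    exact hεα
  have hδs := abs_le.1 hδρ
  have hm' : p + (s + δ) • (q - p) ∈ closure C := by
    refine hC.closure.segment_subset hp hq ?_
    rw [segment_eq_image']
    exact ⟨s + δ, ⟨by linarith [min_le_left s (1 - s)], by linarith [min_le_right s (1 - s)]⟩, rfl⟩
  have := hC.combo_interior_closure_mem_interior hx₀ hm' (mul_pos hε0 hβ0) h1.le (by ring)
  convert this using 1
  have e : ε * α = δ * (1 - ε * β) := (div_mul_cancel₀ _ h1.ne').symm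
  rw [hy', smul_add, smul_smul, smul_smul, e, hm]
  module

end Plane

/-! ### Faces of an embedded planar graph -/

namespace EmbeddedPlanarGraph

variable {V : Type*} {G : EmbeddedPlanarGraph V}

lemma isOpen_face (f : G.Face) : IsOpen f.1 := by
  rw [G.face_polygon f.1 f.2]; exact isOpen_interior

lemma convex_face (f : G.Face) : Convex ℝ f.1 := by
  rw [G.face_polygon f.1 f.2]; exact (convex_convexHull ℝ _).interior

lemma nonempty_face (f : G.Face) : f.1.Nonempty := by
  obtain ⟨x, hx, h⟩ := f.2
  exact ⟨x, h ▸ mem_connectedComponentIn hx⟩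

lemma notMem_drawing {f : G.Face} {x : ℂ} (hx : x ∈ f.1) : x ∉ graphDrawing G.graph G.z := by
  obtain ⟨y, hy, h⟩ := f.2
  rw [h] at hx
  exact connectedComponentIn_subset _ _ hx

lemma face_eq_of_mem {f g : G.Face} {x : ℂ} (hf : x ∈ f.1) (hg : x ∈ g.1) : f = g := by
  obtain ⟨y, hy, h⟩ := f.2
  obtain ⟨y', hy', h'⟩ := g.2
  refine Subtype.ext ?_
  rw [h] at hf
  rw [h'] at hg
  rw [h, h', connectedComponentIn_eq hf, connectedComponentIn_eq hg]

lemma notMem_face_of_vertex (v : V) (f : G.Face) : G.z v ∉ f.1 := fun h =>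
  notMem_drawing h (.inl ⟨v, rfl⟩)

lemma notMem_face_of_edge {a b : V} (hab : G.graph.Adj a b) {x : ℂ}
    (hx : x ∈ segment ℝ (G.z a) (G.z b)) (f : G.Face) : x ∉ f.1 := fun h =>
  notMem_drawing h (.inr ⟨a, b, hab, hx⟩)

/-- The positions of the vertices of a face. -/
def corners (f : G.Face) : Set ℂ := G.z '' graphFaceVertices G.z f.1

lemma finite_corners (f : G.Face) : (corners f).Finite := (G.face_finite f.1 f.2).image _

lemma face_eq_interior (f : G.Face) : f.1 = interior (convexHull ℝ (corners f)) :=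
  G.face_polygon f.1 f.2

lemma closure_face (f : G.Face) : closure f.1 = convexHull ℝ (corners f) := by
  have h := nonempty_face f
  rw [face_eq_interior] at h
  conv_lhs => rw [face_eq_interior f]
  rw [(convex_convexHull ℝ _).closure_interior_eq_closure_of_nonempty_interior h]
  exact ((finite_corners f).isCompact_convexHull (𝕜 := ℝ)).isClosed.closure_eq

/-- A frontier point of a face that is not one of its vertices lies between two of them, on a
supporting line. -/
lemma exists_supporting_side {f : G.Face} {m : ℂ} (hm : m ∈ closure f.1) (hmf : m ∉ f.1)
    (hmv : ∀ v, m ≠ G.z v) : ∃ p ∈ corners f, ∃ q ∈ corners f, ∃ s : ℝ, 0 < s ∧ s < 1 ∧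
      m = p + s • (q - p) ∧ p ≠ q ∧ ∀ x ∈ f.1, 0 < cross (q - p) (x - m) := by
  obtain ⟨φ, hφ⟩ := geometric_hahn_banach_open_point (convex_face f) (isOpen_face f) hmf
  set e : ℂ := ⟨-φ Complex.I, φ 1⟩ with he
  have hcr : ∀ x, cross e x = -φ x := by
    intro x
    have : φ x = x.re * φ 1 + x.im * φ Complex.I := by
      conv_lhs => rw [show x = x.re • (1 : ℂ) + x.im • Complex.I by
        apply Complex.ext <;> simp]
      rw [map_add, map_smul, map_smul, smul_eq_mul, smul_eq_mul]
    rw [this]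
    simp only [cross, he]
    ring
  have hpos : ∀ x ∈ f.1, 0 < cross e (x - m) := by
    intro x hx
    rw [hcr, map_sub]
    linarith [hφ x hx]
  obtain ⟨x₀, hx₀⟩ := nonempty_face f
  have he0 : e ≠ 0 := by
    intro h
    have := hpos x₀ hx₀
    simp [h, cross] at this
  have hcl : closure f.1 ⊆ {x | 0 ≤ cross e (x - m)} :=
    closure_minimal (fun x hx => (hpos x hx).le) (isClosed_cross_nonneg e m)
  have hmS : m ∉ corners f := by
    rintro ⟨v, -, h⟩
    exact hmv v h.symm
  obtain ⟨p, hp, q, hq, hp0, hq0, hp1, hq1⟩ := exists_on_supporting_line (finite_corners f) he0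
    (closure_face f ▸ hm) hmS fun s hs => hcl (by
      rw [closure_face]; exact subset_convexHull ℝ _ hs)
  have h0 := dot_self_pos he0
  have hp' := eq_smul_of_cross_eq_zero he0 hp0
  have hq' := eq_smul_of_cross_eq_zero he0 hq0
  set a := dot e (p - m) / dot e e
  set b := dot e (q - m) / dot e e
  have ha : a < 0 := div_neg_of_neg_of_pos hp1 h0
  have hb : 0 < b := div_pos hq1 h0
  have hqp : q - p = (b - a) • e := by
    rw [sub_smul, ← hp', ← hq']; ring
  have hba : 0 < b - a := by linarith
  refine ⟨p, hp, q, hq, -a / (b - a), div_pos (by linarith) hba, (div_lt_one hba).2 (by linarith),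
    ?_, ?_, fun x hx => ?_⟩
  · rw [hqp, smul_smul, div_mul_cancel₀ _ hba.ne', neg_smul, ← hp']
    ring
  · rintro rfl
    linarith
  · rw [hqp, cross_comm, cross_smul, cross_comm, mul_neg, neg_neg]
    exact mul_pos hba (hpos x hx)

/-- A face that has an inner point of an edge on its frontier contains the ends of the edge and
lies on one side of it. -/
lemma onFace_of_mem_edge {a b : V} (hab : G.graph.Adj a b) {f : G.Face} {m : ℂ}
    (hm : m ∈ openSegment ℝ (G.z a) (G.z b)) (hmf : m ∈ closure f.1) :
    G.OnFace a f ∧ G.OnFace b f ∧ ((∀ x ∈ f.1, 0 < cross (G.z b - G.z a) (x - G.z a)) ∨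
      ∀ x ∈ f.1, 0 < cross (G.z a - G.z b) (x - G.z b)) := by
  have hmseg := openSegment_subset_segment ℝ _ _ hm
  obtain ⟨p, hp, q, hq, s, hs0, hs1, hms, hpq, hpos⟩ := exists_supporting_side hmf
    (notMem_face_of_edge hab hmseg f) fun v h => G.vertex_notMem_edge a b v hab (h ▸ hm)
  have hclp : ∀ y ∈ corners f, y ∈ closure f.1 := fun y hy => by
    rw [closure_face]; exact subset_convexHull ℝ _ hy
  obtain ⟨x₀, hx₀⟩ := nonempty_face f
  -- The edge does not enter the face, so it does not leave the supporting line.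
  have hno : ∀ y ∈ segment ℝ (G.z a) (G.z b), cross (q - p) (y - m) ≤ 0 := by
    intro y hy
    by_contra! h
    obtain ⟨ε, h0, h1, hε⟩ := exists_mem_interior_of_cross_pos (convex_face f) (hclp p hp)
      (hclp q hq) (by rwa [(isOpen_face f).interior_eq]) hs0 hs1 hms (hpos x₀ hx₀) h
    refine notMem_face_of_edge hab ?_ f (interior_subset hε)
    refine (convex_segment (G.z a) (G.z b)).segment_subset hmseg hy ?_
    rw [segment_eq_image']
    exact ⟨ε, ⟨h0, h1⟩, rfl⟩
  rw [openSegment_eq_image'] at hm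
  obtain ⟨t, ⟨ht0, ht1⟩, hmt⟩ := hm
  simp only at hmt
  have ha := hno _ (left_mem_segment _ _ _)
  have hb := hno _ (right_mem_segment _ _ _)
  have hab' : (1 - t) * cross (q - p) (G.z a - m) + t * cross (q - p) (G.z b - m) = 0 := by
    rw [← cross_smul, ← cross_smul, ← cross_add, ← hmt,
      show (1 - t) • (G.z a - (G.z a + t • (G.z b - G.z a))) +
        t • (G.z b - (G.z a + t • (G.z b - G.z a))) = (0 : ℂ) by module]
    simp [cross]
  have ha0 : cross (q - p) (G.z a - m) = 0 := by nlinarith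
  have hb0 : cross (q - p) (G.z b - m) = 0 := by nlinarith
  have hqp : q - p ≠ 0 := sub_ne_zero.2 hpq.symm
  have ha' := eq_smul_of_cross_eq_zero hqp ha0
  have hb' := eq_smul_of_cross_eq_zero hqp hb0
  set σ := dot (q - p) (G.z a - m) / dot (q - p) (q - p)
  set τ := dot (q - p) (G.z b - m) / dot (q - p) (q - p)
  have haσ : G.z a = p + (s + σ) • (q - p) := by
    rw [add_smul, ← ha', hms]; ring
  have hbτ : G.z b = p + (s + τ) • (q - p) := by
    rw [add_smul, ← hb', hms]; ring
  have hστ : (1 - t) * σ + t * τ = 0 := by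
    have h : ((1 - t) * σ + t * τ) • (q - p) = 0 := by
      rw [add_smul, mul_smul, mul_smul, ← ha', ← hb', ← hmt]
      module
    exact (smul_eq_zero.1 h).resolve_right hqp
  have hne : G.z a ≠ G.z b := fun h => hab.ne (G.z_injective h)
  have hσ : σ ≠ 0 := by
    intro h
    rw [h, mul_zero, zero_add] at hστ
    have := (mul_eq_zero.1 hστ).resolve_left ht0.ne'
    exact hne (by rw [haσ, hbτ, h, this])
  -- No vertex of the face is an inner point of the edge.
  have hcorner : ∀ r : ℝ, p + r • (q - p) ∈ corners f → ∀ u : ℝ, 0 < u → u < 1 →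
      r ≠ s + σ + u * (τ - σ) := by
    rintro r ⟨v, -, hv⟩ u hu0 hu1 rfl
    refine G.vertex_notMem_edge a b v hab ?_
    rw [openSegment_eq_image']
    refine ⟨u, ⟨hu0, hu1⟩, ?_⟩
    simp only
    rw [hv, haσ, hbτ]
    module
  have hp' := hcorner 0 (by simpa using hp)
  have hq' := hcorner 1 (by simpa using hq)
  have hbounds : (0 ≤ s + σ ∧ s + σ ≤ 1) ∧ 0 ≤ s + τ ∧ s + τ ≤ 1 := by
    have hd : τ - σ ≠ 0 := fun h => hne (by rw [haσ, hbτ, sub_eq_zero.1 h])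
    have hp2 : ¬(0 < -(s + σ) / (τ - σ) ∧ -(s + σ) / (τ - σ) < 1) := fun h =>
      hp' _ h.1 h.2 (by rw [div_mul_cancel₀ _ hd]; ring)
    have hq2 : ¬(0 < (1 - (s + σ)) / (τ - σ) ∧ (1 - (s + σ)) / (τ - σ) < 1) := fun h =>
      hq' _ h.1 h.2 (by rw [div_mul_cancel₀ _ hd]; ring)
    have h1t : 0 < 1 - t := by linarith
    rcases hσ.lt_or_gt with hlt | hlt
    · have hτ : 0 < τ := by nlinarith
      have hdp : 0 < τ - σ := by linarith
      rw [div_pos_iff_of_pos_right hdp, div_lt_one hdp] at hp2 hq2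
      refine ⟨⟨?_, by linarith⟩, by linarith, ?_⟩
      · by_contra! h; exact hp2 ⟨by linarith, by linarith⟩
      · by_contra! h; exact hq2 ⟨by linarith, by linarith⟩
    · have hτ : τ < 0 := by nlinarith
      have hdn : τ - σ < 0 := by linarith
      rw [div_pos_iff, div_lt_one_of_neg hdn] at hp2 hq2
      refine ⟨⟨by linarith, ?_⟩, ?_, by linarith⟩
      · by_contra! h; exact hq2 ⟨.inr ⟨by linarith, hdn⟩, by linarith⟩
      · by_contra! h; exact hp2 ⟨.inr ⟨by linarith, hdn⟩, by linarith⟩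
  have hon : ∀ r : ℝ, 0 ≤ r → r ≤ 1 → p + r • (q - p) ∈ closure f.1 := by
    intro r h0 h1
    refine (convex_face f).closure.segment_subset (hclp p hp) (hclp q hq) ?_
    rw [segment_eq_image']
    exact ⟨r, ⟨h0, h1⟩, rfl⟩
  refine ⟨?_, ?_, ?_⟩
  · change G.z a ∈ closure f.1
    rw [haσ]
    exact hon _ hbounds.1.1 hbounds.1.2
  · change G.z b ∈ closure f.1
    rw [hbτ]
    exact hon _ hbounds.2.1 hbounds.2.2
  · have hba : G.z b - G.z a = (τ - σ) • (q - p) := by rw [haσ, hbτ]; module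
    have hcomp : ∀ (k : ℝ) (y x : ℂ), cross (q - p) (y - m) = 0 →
        cross (k • (q - p)) (x - y) = k * cross (q - p) (x - m) := by
      intro k y x h
      rw [cross_comm, cross_smul, cross_comm, show x - y = (x - m) - (y - m) by ring, cross_sub, h]
      ring
    have hd : τ - σ ≠ 0 := fun h => hne (by rw [haσ, hbτ, sub_eq_zero.1 h])
    rcases hd.lt_or_gt with h | h
    · right
      intro x hx
      rw [show G.z a - G.z b = (-(τ - σ)) • (q - p) by rw [neg_smul, ← hba]; ring, hcomp _ _ _ hb0]
      exact mul_pos (by linarith) (hpos x hx)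
    · left
      intro x hx
      rw [hba, hcomp _ _ _ ha0]
      exact mul_pos h (hpos x hx)

lemma midpoint_mem_openSegment (x y : ℂ) : x + (1 / 2 : ℝ) • (y - x) ∈ openSegment ℝ x y := by
  rw [openSegment_eq_image']
  exact ⟨1 / 2, ⟨by norm_num, by norm_num⟩, rfl⟩

lemma midpoint_mem_closure {f : G.Face} {x y : ℂ} (hx : x ∈ closure f.1) (hy : y ∈ closure f.1) :
    x + (1 / 2 : ℝ) • (y - x) ∈ closure f.1 :=
  (convex_face f).closure.segment_subset hx hy
    (openSegment_subset_segment ℝ _ _ (midpoint_mem_openSegment x y))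

/-- The face `f` lies strictly to the left of the line from `a` to `b`. -/
def LeftOf (f : G.Face) (a b : V) : Prop := ∀ x ∈ f.1, 0 < cross (G.z b - G.z a) (x - G.z a)

lemma leftOf_or_leftOf {a b : V} (hab : G.graph.Adj a b) {f : G.Face} (ha : G.OnFace a f)
    (hb : G.OnFace b f) : LeftOf f a b ∨ LeftOf f b a :=
  (onFace_of_mem_edge hab (midpoint_mem_openSegment _ _) (midpoint_mem_closure ha hb)).2.2

lemma LeftOf.closure_nonneg {f : G.Face} {a b : V} (h : LeftOf f a b) {x : ℂ}
    (hx : x ∈ closure f.1) : 0 ≤ cross (G.z b - G.z a) (x - G.z a) :=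
  closure_minimal (fun x hx => (h x hx).le) (isClosed_cross_nonneg (G.z b - G.z a) (G.z a)) hx

lemma cross_swap (a b x : ℂ) : cross (a - b) (x - b) = -cross (b - a) (x - a) := by
  simp only [cross, Complex.sub_re, Complex.sub_im]; ring

/-- A frontier point of a face is a vertex or an inner point of an edge of `G`. -/
lemma exists_edge_of_mem_closure {f : G.Face} {x : ℂ} (hx : x ∈ closure f.1) (hxf : x ∉ f.1)
    (hv : ∀ v, x ≠ G.z v) : ∃ a b, G.graph.Adj a b ∧ x ∈ openSegment ℝ (G.z a) (G.z b) := by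
  have hxD : x ∈ graphDrawing G.graph G.z := by
    by_contra hxD
    obtain ⟨y, hy, hfy⟩ := f.2
    have hpre : IsPreconnected (insert x f.1) := by
      refine IsPreconnected.subset_closure (s := f.1) ?_ (Set.subset_insert _ _) ?_
      · exact (convex_face f).isPreconnected
      · exact Set.insert_subset hx subset_closure
    have hsub : insert x f.1 ⊆ (graphDrawing G.graph G.z)ᶜ :=
      Set.insert_subset hxD fun z hz => notMem_drawing hz
    have hyf : y ∈ f.1 := hfy ▸ mem_connectedComponentIn hy
    have := hpre.subset_connectedComponentIn (Set.mem_insert_of_mem _ hyf) hsub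
    rw [← hfy] at this
    exact hxf (this (Set.mem_insert _ _))
  rcases hxD with ⟨v, hv'⟩ | ⟨a, b, hab, hx'⟩
  · exact absurd hv'.symm (hv v)
  · refine ⟨a, b, hab, ?_⟩
    rw [← insert_endpoints_openSegment] at hx'
    rcases hx' with h | h | h
    · exact absurd h (hv a)
    · exact absurd h (hv b)
    · exact h

lemma finite_meeting (c : ℂ) (r : ℝ) : {f : G.Face | (f.1 ∩ Metric.ball c r).Nonempty}.Finite := by
  refine ((G.faces_locallyFinite c r).preimage Subtype.val_injective.injOn).subset ?_
  exact fun f hf => ⟨f.2, hf⟩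

lemma exists_mem_closure (x : ℂ) : ∃ f : G.Face, x ∈ closure f.1 := by
  have : x ∈ ⋃ f ∈ graphFaces G.graph G.z, closure f := G.faces_cover ▸ Set.mem_univ x
  obtain ⟨f, hf, hx⟩ := Set.mem_iUnion₂.1 this
  exact ⟨⟨f, hf⟩, hx⟩

lemma meets_ball {f : G.Face} {x c : ℂ} {r : ℝ} (hx : x ∈ closure f.1) (hb : x ∈ Metric.ball c r) :
    (f.1 ∩ Metric.ball c r).Nonempty := by
  rw [Set.inter_comm]
  exact mem_closure_iff.1 hx _ Metric.isOpen_ball hb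

/-- The union of the closures of any family of faces is closed. -/
lemma isClosed_iUnion_closure (P : G.Face → Prop) :
    IsClosed (⋃ f : {f : G.Face // P f}, closure f.1.1) := by
  refine LocallyFinite.isClosed_iUnion ?_ fun _ => isClosed_closure
  intro x
  refine ⟨Metric.ball x 1, Metric.ball_mem_nhds x one_pos, ?_⟩
  refine ((finite_meeting (G := G) x 1).preimage Subtype.val_injective.injOn).subset ?_
  rintro ⟨f, hf⟩ ⟨y, hy, hyb⟩
  exact meets_ball hy hyb

/-- Every edge has a face on its left. -/
lemma exists_leftOf {a b : V} (hab : G.graph.Adj a b) :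
    ∃ f : G.Face, G.OnFace a f ∧ G.OnFace b f ∧ LeftOf f a b := by
  set d := G.z b - G.z a with hd
  have hd0 : d ≠ 0 := sub_ne_zero.2 fun h => hab.ne (G.z_injective h).symm
  set m := G.z a + (1 / 2 : ℝ) • d with hm
  set U := ⋃ f : {f : G.Face // m ∉ closure f.1}, closure f.1.1 with hU
  have hUm : m ∈ Uᶜ := by
    intro h
    obtain ⟨⟨f, hf⟩, h⟩ := Set.mem_iUnion.1 h
    exact hf h
  obtain ⟨ε, hε, hy⟩ := exists_add_smul_mem
    (isClosed_iUnion_closure (G := G) fun f => m ∉ closure f.1).isOpen_compl hUm (Complex.I * d)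
  obtain ⟨f, hf⟩ := exists_mem_closure (G := G) (m + ε • (Complex.I * d))
  have hmf : m ∈ closure f.1 := by
    by_contra h
    exact hy (Set.mem_iUnion.2 ⟨⟨f, h⟩, hf⟩)
  obtain ⟨ha, hb, hside⟩ := onFace_of_mem_edge hab (midpoint_mem_openSegment _ _) hmf
  refine ⟨f, ha, hb, hside.resolve_right fun h => ?_⟩
  have h1 := LeftOf.closure_nonneg (a := b) (b := a) h hf
  rw [cross_swap, ← hd, hm] at h1
  have h2 : cross d (G.z a + (1 / 2 : ℝ) • d + ε • (Complex.I * d) - G.z a) = ε * dot d d := by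
    rw [show G.z a + (1 / 2 : ℝ) • d + ε • (Complex.I * d) - G.z a =
      (1 / 2 : ℝ) • d + ε • (Complex.I * d) by ring, cross_add, cross_smul, cross_smul,
      cross_self_eq, cross_mul_I]
    ring
  rw [h2] at h1
  linarith [mul_pos hε (dot_self_pos hd0)]

end EmbeddedPlanarGraph

/-! ### Circumcentres and rhombs -/

namespace EmbeddedPlanarGraph

variable {V : Type*} {G : EmbeddedPlanarGraph V} {R : ℝ}

/-- `G` is an isoradial Delaunay graph of circumradius `R`. -/
def IsIsoradialDelaunay (G : EmbeddedPlanarGraph V) (R : ℝ) : Prop :=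
  G.IsIsoradial R ∧ G.IsDelaunay

lemma exists_other_face {a b : V} (hab : G.graph.Adj a b)
    (f : G.Face) : ∃ g, g ≠ f ∧ G.OnFace a g ∧ G.OnFace b g := by
  obtain ⟨f₁, ha₁, hb₁, h₁⟩ := exists_leftOf hab
  obtain ⟨f₂, hb₂, ha₂, h₂⟩ := exists_leftOf hab.symm
  by_cases hf : f₁ = f
  · refine ⟨f₂, ?_, ha₂, hb₂⟩
    rintro rfl
    subst hf
    obtain ⟨x, hx⟩ := nonempty_face f₁
    have h3 := h₁ x hx
    have h4 := h₂ x hx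
    rw [cross_swap] at h4
    linarith
  · exact ⟨f₁, hf, ha₁, hb₁⟩

namespace IsIsoradialDelaunay

lemma isCircumcircle (h : G.IsIsoradialDelaunay R) (f : G.Face) :
    G.IsCircumcircle f (G.circumcenter f) R := by
  have hex := h.1.1 f
  obtain ⟨r, hr⟩ := hex.choose_spec
  have hc : G.circumcenter f = hex.choose := dif_pos hex
  rw [hc, ← h.1.2 f _ r hr]
  exact hr

lemma norm_eq (h : G.IsIsoradialDelaunay R) {f : G.Face} {v : V} (hv : G.OnFace v f) :
    ‖G.z v - G.circumcenter f‖ = R := by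
  rw [← dist_eq_norm]; exact h.isCircumcircle f v hv

lemma le_norm (h : G.IsIsoradialDelaunay R) (f : G.Face) (v : V) :
    R ≤ ‖G.z v - G.circumcenter f‖ := by
  rw [← dist_eq_norm]; exact h.2.1.2 f _ R (h.isCircumcircle f) v

lemma circumcenter_injective (h : G.IsIsoradialDelaunay R) :
    Function.Injective G.circumcenter := fun f g hfg =>
  h.2.2 f g _ R (h.isCircumcircle f) (hfg ▸ h.isCircumcircle g)

lemma norm_le (h : G.IsIsoradialDelaunay R) {f : G.Face} {x : ℂ} (hx : x ∈ closure f.1) :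
    ‖x - G.circumcenter f‖ ≤ R := by
  rw [closure_face] at hx
  have hsub : corners f ⊆ Metric.closedBall (G.circumcenter f) R := by
    rintro _ ⟨v, hv, rfl⟩
    exact (h.isCircumcircle f v hv).le
  have := convexHull_min hsub (convex_closedBall _ _) hx
  rwa [Metric.mem_closedBall, dist_eq_norm] at this

lemma radius_pos (h : G.IsIsoradialDelaunay R) (f : G.Face) : 0 < R := by
  by_contra! hR
  have hx : ∀ x ∈ f.1, x = G.circumcenter f := fun x hx =>
    sub_eq_zero.1 (norm_le_zero_iff.1 ((h.norm_le (subset_closure hx)).trans hR))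
  obtain ⟨x, hxf⟩ := nonempty_face f
  obtain ⟨ε, hε, hy⟩ := exists_add_smul_mem (isOpen_face f) hxf 1
  have := (hx _ hy).trans (hx _ hxf).symm
  simp [hε.ne'] at this

/-- The centres of two faces that share the vertices `a` and `b` form a rhomb with them. -/
lemma add_eq_add (h : G.IsIsoradialDelaunay R) {a b : V} (hab : a ≠ b) {f g : G.Face}
    (hfg : f ≠ g) (haf : G.OnFace a f) (hbf : G.OnFace b f) (hag : G.OnFace a g)
    (hbg : G.OnFace b g) : G.circumcenter f + G.circumcenter g = G.z a + G.z b := by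
  refine add_eq_add_of_norm_eq ?_ ?_ ?_ (fun e => hab (G.z_injective e))
    (fun e => hfg (h.circumcenter_injective e))
  · rw [h.norm_eq haf, h.norm_eq hbf]
  · rw [h.norm_eq haf, h.norm_eq hag]
  · rw [h.norm_eq haf, h.norm_eq hbg]

/-- The circumcentre of a face lies strictly on the inner side of each edge. Otherwise the circle
of the face on the other side of the edge would lie, beyond the edge, inside the circumdisk. -/
lemma cross_circumcenter_pos (h : G.IsIsoradialDelaunay R) {a b : V} (hab : G.graph.Adj a b)
    {f : G.Face} (ha : G.OnFace a f) (hb : G.OnFace b f) (hf : LeftOf f a b) :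
    0 < cross (G.z b - G.z a) (G.circumcenter f - G.z a) := by
  obtain ⟨g, hbg, hag, hg⟩ := exists_leftOf hab.symm
  have hfg : f ≠ g := by
    rintro rfl
    obtain ⟨x, hx⟩ := nonempty_face f
    have h1 := hf x hx
    have h2 := hg x hx
    rw [cross_swap] at h2
    linarith
  have hsum := h.add_eq_add hab.ne hfg ha hb hag hbg
  by_contra! hle
  set d := G.z b - G.z a with hd
  have hd0 : d ≠ 0 := sub_ne_zero.2 fun e => hab.ne (G.z_injective e).symm
  set e := G.circumcenter g - G.circumcenter f with he
  have he0 : e ≠ 0 := sub_ne_zero.2 fun e => hfg (h.circumcenter_injective e).symm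
  have hde : dot d e = 0 := by
    have h1 := norm_eq_iff_dot.1 ((h.norm_eq hb).trans (h.norm_eq ha).symm)
    have hg' : G.circumcenter g = G.z a + G.z b - G.circumcenter f := by rw [← hsum]; ring
    rw [he, hd, hg']
    simp only [dot, Complex.sub_re, Complex.sub_im, Complex.add_re, Complex.add_im] at h1 ⊢
    linear_combination h1
  have hce : 0 ≤ cross d e := by
    have hg' : e = d - (2 : ℝ) • (G.circumcenter f - G.z a) := by
      have : G.circumcenter g = G.z a + G.z b - G.circumcenter f := by rw [← hsum]; ring
      rw [he, this, hd]
      module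
    rw [hg', cross_sub, cross_self_eq, cross_smul]
    linarith
  have hce' : 0 < cross d e := by
    refine hce.lt_of_ne fun h0 => he0 ?_
    have := eq_of_cross_of_dot (x := e) (y := 0) hd0 (by rw [← h0]; simp [cross])
      (by rw [hde]; simp [dot])
    exact this
  -- A vertex of the other face beyond the edge.
  obtain ⟨x, hxg, hx⟩ : ∃ x, G.OnFace x g ∧ cross d (G.z x - G.z a) < 0 := by
    by_contra! hcon
    have hsub : closure g.1 ⊆ {y | 0 ≤ cross d (y - G.z a)} := by
      rw [closure_face]
      refine convexHull_min ?_ (convex_cross_nonneg d (G.z a))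
      rintro _ ⟨v, hv, rfl⟩
      exact hcon v hv
    obtain ⟨y, hy⟩ := nonempty_face g
    have h1 := hsub (subset_closure hy)
    have h2 := hg y hy
    rw [cross_swap] at h2
    change 0 ≤ cross d (y - G.z a) at h1
    linarith
  have h1 := h.norm_eq hxg
  have h2 := h.le_norm f x
  rw [← h1, ← sq_le_sq₀ (norm_nonneg _) (norm_nonneg _), ← dot_self_eq_norm_sq,
    ← dot_self_eq_norm_sq] at h2
  have h3 : dot d d * (dot (G.z x - G.circumcenter f) (G.z x - G.circumcenter f) -
      dot (G.z x - G.circumcenter g) (G.z x - G.circumcenter g)) =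
      2 * (cross d (G.z x - G.z a) * cross d e) := by
    have hb' : G.z b = G.circumcenter f + G.circumcenter g - G.z a := by rw [hsum]; ring
    have h4 : dot (G.z x - G.circumcenter f) (G.z x - G.circumcenter f) -
      dot (G.z x - G.circumcenter g) (G.z x - G.circumcenter g) =
      2 * dot (G.z x - G.z a - (1 / 2 : ℝ) • d) e := by
      rw [hd, he, hb']
      simp only [dot, Complex.sub_re, Complex.sub_im, Complex.add_re, Complex.add_im,
        Complex.smul_re, Complex.smul_im, smul_eq_mul]
      ring
    have h5 : dot d d * dot (G.z x - G.z a - (1 / 2 : ℝ) • d) e =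
        dot d (G.z x - G.z a - (1 / 2 : ℝ) • d) * dot d e +
        cross d (G.z x - G.z a) * cross d e := by
      simp only [dot, cross, Complex.sub_re, Complex.sub_im,
        Complex.smul_re, Complex.smul_im, smul_eq_mul]
      ring
    rw [h4, mul_left_comm, h5, hde]
    ring
  have h6 := mul_neg_of_neg_of_pos hx hce'
  have h7 := mul_nonneg (dot_self_pos hd0).le (sub_nonneg.2 h2)
  linarith

/-- The circumcentre of a face lies in the face. -/
lemma circumcenter_mem (h : G.IsIsoradialDelaunay R) (f : G.Face) : G.circumcenter f ∈ f.1 := by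
  by_contra ho
  obtain ⟨x, hx⟩ := nonempty_face f
  obtain ⟨m, hms, hmcl, hmn⟩ : ∃ m ∈ segment ℝ x (G.circumcenter f), m ∈ closure f.1 ∧ m ∉ f.1 := by
    by_contra! hcon
    obtain ⟨y, -, hy1, hy2⟩ := (convex_segment x (G.circumcenter f)).isPreconnected f.1
      (closure f.1)ᶜ (isOpen_face f) isClosed_closure.isOpen_compl
      (fun m hm => (em (m ∈ closure f.1)).imp (hcon m hm) id) ⟨x, left_mem_segment _ _ _, hx⟩
      ⟨_, right_mem_segment _ _ _, fun hcl => ho (hcon _ (right_mem_segment _ _ _) hcl)⟩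
    exact hy2 (subset_closure hy1)
  rw [segment_eq_image'] at hms
  obtain ⟨t, ⟨ht0, ht1⟩, hm⟩ := hms
  simp only at hm
  have ht : 0 < t := ht0.lt_of_ne fun e => hmn (by rwa [← hm, ← e, zero_smul, add_zero])
  have hR := h.radius_pos f
  have hnv : ∀ v, m ≠ G.z v := by
    intro v e
    have h1 := h.le_norm f v
    rw [← e, ← hm, show x + t • (G.circumcenter f - x) - G.circumcenter f =
      (1 - t) • (x - G.circumcenter f) by module, norm_smul, Real.norm_of_nonneg (by linarith)] at h1
    have h2 := h.norm_le (subset_closure hx)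
    nlinarith [norm_nonneg (x - G.circumcenter f)]
  obtain ⟨a, b, hab, hmab⟩ := exists_edge_of_mem_closure hmcl hmn hnv
  obtain ⟨ha, hb, -⟩ := onFace_of_mem_edge hab hmab hmcl
  have key : ∀ a b, G.graph.Adj a b → m ∈ openSegment ℝ (G.z a) (G.z b) → G.OnFace a f →
      G.OnFace b f → ¬LeftOf f a b := by
    intro a b hab hmab ha hb hl
    have h1 := h.cross_circumcenter_pos hab ha hb hl
    have h2 := hl x hx
    rw [openSegment_eq_image'] at hmab
    obtain ⟨s, -, hs⟩ := hmab
    simp only at hs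
    have h3 : cross (G.z b - G.z a) (m - G.z a) = 0 := by
      rw [← hs, add_sub_cancel_left, cross_smul, cross_self_eq, mul_zero]
    rw [← hm, show x + t • (G.circumcenter f - x) - G.z a =
      (1 - t) • (x - G.z a) + t • (G.circumcenter f - G.z a) by module, cross_add, cross_smul,
      cross_smul] at h3
    nlinarith [mul_pos ht h1]
  rcases leftOf_or_leftOf hab ha hb with hl | hl
  · exact key a b hab hmab ha hb hl
  · exact key b a hab.symm (by rwa [openSegment_symm]) hb ha hl

lemma cross_center (v a o : ℂ) : cross (v - o) (a - o) = cross (a - v) (o - v) := by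
  simp only [cross, Complex.sub_re, Complex.sub_im]; ring

lemma leftOf_of_cross_pos (h : G.IsIsoradialDelaunay R) {v a : V} (hva : G.graph.Adj v a)
    {f : G.Face} (hv : G.OnFace v f) (ha : G.OnFace a f)
    (hc : 0 < cross (G.z v - G.circumcenter f) (G.z a - G.circumcenter f)) : LeftOf f v a := by
  refine (leftOf_or_leftOf hva hv ha).resolve_right fun hl => ?_
  have := h.cross_circumcenter_pos hva.symm ha hv hl
  rw [cross_swap, ← cross_center] at this
  linarith

lemma cross_ne_zero (h : G.IsIsoradialDelaunay R) {v a : V} (hva : G.graph.Adj v a)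
    {f : G.Face} (hv : G.OnFace v f) (ha : G.OnFace a f) :
    cross (G.z v - G.circumcenter f) (G.z a - G.circumcenter f) ≠ 0 := by
  rw [cross_center]
  rcases leftOf_or_leftOf hva hv ha with hl | hl
  · exact (h.cross_circumcenter_pos hva hv ha hl).ne'
  · have := h.cross_circumcenter_pos hva.symm ha hv hl
    rw [cross_swap] at this
    linarith

lemma norm_midpoint_lt (h : G.IsIsoradialDelaunay R) {v a : V} (hva : v ≠ a)
    {f : G.Face} (hv : G.OnFace v f) (ha : G.OnFace a f) :
    ‖G.z v + (1 / 2 : ℝ) • (G.z a - G.z v) - G.circumcenter f‖ < R := by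
  have hR := h.radius_pos f
  have h1 := h.norm_eq hv
  have h2 := h.norm_eq ha
  have hd := dot_self_pos (sub_ne_zero.2 fun e : G.z a = G.z v => hva (G.z_injective e).symm)
  rw [← sq_lt_sq₀ (norm_nonneg _) hR.le, ← dot_self_eq_norm_sq]
  have h1' : dot (G.z v - G.circumcenter f) (G.z v - G.circumcenter f) = R ^ 2 := by
    rw [dot_self_eq_norm_sq, h1]
  have h2' : dot (G.z a - G.circumcenter f) (G.z a - G.circumcenter f) = R ^ 2 := by
    rw [dot_self_eq_norm_sq, h2]
  have e : dot (G.z v + (1 / 2 : ℝ) • (G.z a - G.z v) - G.circumcenter f)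
      (G.z v + (1 / 2 : ℝ) • (G.z a - G.z v) - G.circumcenter f) =
      (1 / 2) * dot (G.z v - G.circumcenter f) (G.z v - G.circumcenter f) +
      (1 / 2) * dot (G.z a - G.circumcenter f) (G.z a - G.circumcenter f) -
      (1 / 4) * dot (G.z a - G.z v) (G.z a - G.z v) := by
    simp only [dot, Complex.sub_re, Complex.sub_im, Complex.add_re, Complex.add_im,
      Complex.smul_re, Complex.smul_im, smul_eq_mul]
    ring
  rw [e, h1', h2']
  linarith

/-- Two vertices of a face are adjacent if the line through them supports the face. -/
lemma adj_of_supporting (h : G.IsIsoradialDelaunay R) {v a : V} (hva : v ≠ a)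
    {f : G.Face} (hv : G.OnFace v f) (ha : G.OnFace a f) {σ : ℝ} (hσ : σ ≠ 0)
    (hsup : ∀ x, G.OnFace x f → 0 ≤ σ * cross (G.z a - G.z v) (G.z x - G.z v)) :
    G.graph.Adj v a := by
  have hne : G.z v ≠ G.z a := fun e => hva (G.z_injective e)
  set d := G.z a - G.z v with hd
  set m := G.z v + (1 / 2 : ℝ) • d with hm
  have hmcl : m ∈ closure f.1 := midpoint_mem_closure hv ha
  have hmul : ∀ x, cross (σ • d) x = σ * cross d x := fun x => by
    rw [cross_comm, cross_smul, cross_comm]; ring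
  have hmn : m ∉ f.1 := by
    intro hmf
    obtain ⟨ε, hε, hy⟩ := exists_add_smul_mem (isOpen_face f) hmf (-(σ • (Complex.I * d)))
    have hsub : closure f.1 ⊆ {y | 0 ≤ cross (σ • d) (y - G.z v)} := by
      rw [closure_face]
      refine convexHull_min ?_ (convex_cross_nonneg _ _)
      rintro _ ⟨x, hx, rfl⟩
      change 0 ≤ cross _ _
      rw [hmul]
      exact hsup x hx
    have h1 := hsub (subset_closure hy)
    change 0 ≤ cross _ _ at h1
    rw [hmul, hm, show G.z v + (1 / 2 : ℝ) • d + ε • -(σ • (Complex.I * d)) - G.z v =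
      (1 / 2 : ℝ) • d - (ε * σ) • (Complex.I * d) by module, cross_sub, cross_smul, cross_smul,
      cross_self_eq, cross_mul_I] at h1
    have h2 := dot_self_pos (sub_ne_zero.2 hne.symm)
    rw [← hd] at h2
    have : 0 < ε * (σ ^ 2 * dot d d) := by positivity
    nlinarith
  have hnv : ∀ x, m ≠ G.z x := by
    intro x e
    have h1 := h.le_norm f x
    rw [← e] at h1
    exact absurd h1 (not_le.2 (h.norm_midpoint_lt hva hv ha))
  obtain ⟨b, c, hbc, hmbc⟩ := exists_edge_of_mem_closure hmcl hmn hnv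
  obtain ⟨hb, hc, -⟩ := onFace_of_mem_edge hbc hmbc hmcl
  have key : ∀ b c, G.graph.Adj b c → m ∈ openSegment ℝ (G.z b) (G.z c) → G.OnFace b f →
      G.OnFace c f → LeftOf f b c → G.graph.Adj v a := by
    intro b c hbc hmbc hb hc hl
    rw [openSegment_eq_image'] at hmbc
    obtain ⟨s, -, hs⟩ := hmbc
    simp only at hs
    have h3 : cross (G.z c - G.z b) (m - G.z b) = 0 := by
      rw [← hs, add_sub_cancel_left, cross_smul, cross_self_eq, mul_zero]
    have h4 := hl.closure_nonneg (x := G.z v) hv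
    have h5 := hl.closure_nonneg (x := G.z a) ha
    rw [hm, hd, show G.z v + (1 / 2 : ℝ) • (G.z a - G.z v) - G.z b =
      (1 / 2 : ℝ) • (G.z v - G.z b) + (1 / 2 : ℝ) • (G.z a - G.z b) by module, cross_add,
      cross_smul, cross_smul] at h3
    have hnebc : G.z b ≠ G.z c := fun e => hbc.ne (G.z_injective e)
    have on : ∀ y, G.OnFace y f → cross (G.z c - G.z b) (G.z y - G.z b) = 0 → y = b ∨ y = c := by
      intro y hy h0
      refine (eq_or_eq_of_cross_eq_zero (o := G.circumcenter f) ?_ ?_ hnebc h0).imp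
        (fun e => G.z_injective e) (fun e => G.z_injective e)
      · rw [h.norm_eq hc, h.norm_eq hb]
      · rw [h.norm_eq hy, h.norm_eq hb]
    rcases on v hv (by linarith) with rfl | rfl <;> rcases on a ha (by linarith) with rfl | rfl
    · exact absurd rfl hva
    · exact hbc
    · exact hbc.symm
    · exact absurd rfl hva
  rcases leftOf_or_leftOf hbc hb hc with hl | hl
  · exact key b c hbc hmbc hb hc hl
  · exact key c b hbc.symm (by rwa [openSegment_symm]) hc hb hl

/-- At a vertex of a face there is an edge of the face on each side of the radius to the vertex:
its other end is the vertex of the face seen from `v` in the extreme direction. -/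
lemma exists_neighbor (h : G.IsIsoradialDelaunay R) {v : V} {f : G.Face} (hv : G.OnFace v f)
    {σ : ℝ} (hσ : σ ≠ 0) : ∃ a, G.graph.Adj v a ∧ G.OnFace a f ∧
      0 < σ * cross (G.z v - G.circumcenter f) (G.z a - G.circumcenter f) := by
  have hR := h.radius_pos f
  set o := G.circumcenter f with ho
  set r := G.z v - o with hr
  have hrr : dot r r = R ^ 2 := by rw [dot_self_eq_norm_sq, h.norm_eq hv]
  have hr0 : r ≠ 0 := by
    intro e
    have : (0 : ℝ) < R ^ 2 := by positivity
    rw [← hrr, e] at this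
    simp [dot] at this
  have hmul : ∀ x, cross (σ • r) x = σ * cross r x := fun x => by
    rw [cross_comm, cross_smul, cross_comm]; ring
  obtain ⟨x₀, hx₀, hx₀'⟩ : ∃ x, G.OnFace x f ∧ 0 < σ * cross r (G.z x - G.z v) := by
    by_contra! hcon
    obtain ⟨ε, hε, hy⟩ := exists_add_smul_mem (isOpen_face f) (h.circumcenter_mem f)
      (σ • (Complex.I * r))
    have hsub : closure f.1 ⊆ {y | 0 ≤ cross (-(σ • r)) (y - G.z v)} := by
      rw [closure_face]
      refine convexHull_min ?_ (convex_cross_nonneg _ _)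
      rintro _ ⟨x, hx, rfl⟩
      change 0 ≤ cross _ _
      rw [cross_neg_left, hmul]
      linarith [hcon x hx]
    have h1 := hsub (subset_closure hy)
    change 0 ≤ cross _ _ at h1
    rw [← ho, show o + ε • σ • (Complex.I * r) - G.z v = (ε * σ) • (Complex.I * r) - r by
      rw [hr]; module, cross_neg_left, hmul, cross_sub, cross_smul, cross_self_eq, cross_mul_I,
      hrr] at h1
    have : 0 < ε * (σ ^ 2 * R ^ 2) := by positivity
    nlinarith
  have hdot : ∀ x, G.OnFace x f → x ≠ v → 0 < -dot r (G.z x - G.z v) := by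
    intro x hx hxv
    have h1 := dot_self_pos (sub_ne_zero.2 fun e : G.z x = G.z v => hxv (G.z_injective e))
    have h2 : dot (G.z x - o) (G.z x - o) = R ^ 2 := by rw [dot_self_eq_norm_sq, h.norm_eq hx]
    have e : dot (G.z x - o) (G.z x - o) = dot (G.z x - G.z v) (G.z x - G.z v) +
        2 * dot r (G.z x - G.z v) + dot r r := by
      simp only [hr, dot, Complex.sub_re, Complex.sub_im]; ring
    rw [h2, hrr] at e
    linarith
  have hfin : (graphFaceVertices G.z f.1 \ {v}).Finite := (G.face_finite f.1 f.2).sdiff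
  have hx₀v : x₀ ≠ v := by
    rintro rfl
    rw [sub_self] at hx₀'
    simp [cross] at hx₀'
  obtain ⟨a, ⟨ha, hav⟩, hmax⟩ := Set.exists_max_image _
    (fun x => σ * cross r (G.z x - G.z v) / -dot r (G.z x - G.z v)) hfin ⟨x₀, hx₀, hx₀v⟩
  have hav' : a ≠ v := hav
  have hda := hdot a ha hav'
  have hapos : 0 < σ * cross r (G.z a - G.z v) := by
    have h1 := hmax x₀ ⟨hx₀, hx₀v⟩
    have h2 : 0 < σ * cross r (G.z x₀ - G.z v) / -dot r (G.z x₀ - G.z v) :=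
      div_pos hx₀' (hdot x₀ hx₀ hx₀v)
    exact (div_pos_iff_of_pos_right hda).1 (h2.trans_le h1)
  refine ⟨a, h.adj_of_supporting hav'.symm hv ha hσ fun x hx => ?_, ha, ?_⟩
  · by_cases hxv : x = v
    · rw [hxv, sub_self]
      simp [cross]
    · have h1 := hmax x ⟨hx, hxv⟩
      have hdx := hdot x hx hxv
      rw [div_le_div_iff₀ hdx hda] at h1
      have e : dot r r * cross (G.z a - G.z v) (G.z x - G.z v) =
          dot r (G.z a - G.z v) * cross r (G.z x - G.z v) -
          cross r (G.z a - G.z v) * dot r (G.z x - G.z v) := by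
        simp only [dot, cross]; ring
      have h2 : 0 ≤ dot r r * (σ * cross (G.z a - G.z v) (G.z x - G.z v)) := by
        rw [mul_left_comm, e]
        linarith
      exact nonneg_of_mul_nonneg_right h2 (dot_self_pos hr0)
  · rwa [show G.z a - o = (G.z a - G.z v) + r by rw [hr]; ring, cross_add, cross_self_eq, add_zero]

lemma neighbor_unique (h : G.IsIsoradialDelaunay R) {v a b : V} {f : G.Face}
    (hv : G.OnFace v f) (hva : G.graph.Adj v a) (ha : G.OnFace a f) (hvb : G.graph.Adj v b)
    (hb : G.OnFace b f)
    (hc : 0 < cross (G.z v - G.circumcenter f) (G.z a - G.circumcenter f) *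
      cross (G.z v - G.circumcenter f) (G.z b - G.circumcenter f)) : a = b := by
  have hz : cross (G.z a - G.z v) (G.z b - G.z v) = 0 := by
    have e1 : cross (G.z b - G.z v) (G.z a - G.z v) = -cross (G.z a - G.z v) (G.z b - G.z v) :=
      cross_comm _ _
    rcases pos_and_pos_or_neg_and_neg_of_mul_pos hc with ⟨h1, h2⟩ | ⟨h1, h2⟩
    · have h3 := (h.leftOf_of_cross_pos hva hv ha h1).closure_nonneg (x := G.z b) hb
      have h4 := (h.leftOf_of_cross_pos hvb hv hb h2).closure_nonneg (x := G.z a) ha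
      linarith
    · rw [cross_comm, neg_lt_zero] at h1 h2
      have h3 := (h.leftOf_of_cross_pos hva.symm ha hv h1).closure_nonneg (x := G.z b) hb
      have h4 := (h.leftOf_of_cross_pos hvb.symm hb hv h2).closure_nonneg (x := G.z a) ha
      rw [cross_swap] at h3 h4
      linarith
  have hne : G.z v ≠ G.z a := fun e => hva.ne (G.z_injective e)
  have := eq_or_eq_of_cross_eq_zero (o := G.circumcenter f) (c := G.z b)
    (by rw [h.norm_eq ha, h.norm_eq hv]) (by rw [h.norm_eq hb, h.norm_eq hv]) hne hz
  rcases this with e | e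
  · exact absurd (G.z_injective e).symm hvb.ne
  · exact (G.z_injective e).symm

lemma other_face_unique (h : G.IsIsoradialDelaunay R) {a b : V} (hab : a ≠ b) {f g g' : G.Face}
    (haf : G.OnFace a f) (hbf : G.OnFace b f) (hg : f ≠ g) (hag : G.OnFace a g)
    (hbg : G.OnFace b g) (hg' : f ≠ g') (hag' : G.OnFace a g') (hbg' : G.OnFace b g') : g = g' := by
  have h1 := h.add_eq_add hab hg haf hbf hag hbg
  have h2 := h.add_eq_add hab hg' haf hbf hag' hbg'
  exact h.circumcenter_injective (add_left_cancel (h1.trans h2.symm))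

end IsIsoradialDelaunay

end EmbeddedPlanarGraph

/-! ### The rhombic graph as a net -/

namespace EmbeddedPlanarGraph

variable {V : Type*} {G : EmbeddedPlanarGraph V} {R : ℝ}

lemma adj_inl_inr {v : V} {f : G.Face} :
    G.rhombicGraph.Adj (.inl v) (.inr f) ↔ G.OnFace v f := Iff.rfl

lemma adj_inr_inl {v : V} {f : G.Face} :
    G.rhombicGraph.Adj (.inr f) (.inl v) ↔ G.OnFace v f := Iff.rfl

/-- Every edge of the rhombic graph joins a vertex to a face. -/
lemma exists_of_adj {x y : G.KiteVertex} (h : G.rhombicGraph.Adj x y) :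
    ∃ v f, G.OnFace v f ∧ ((x = .inl v ∧ y = .inr f) ∨ (x = .inr f ∧ y = .inl v)) := by
  rcases x with v | f <;> rcases y with w | g
  · exact h.elim
  · exact ⟨v, g, h, .inl ⟨rfl, rfl⟩⟩
  · exact ⟨w, f, h, .inr ⟨rfl, rfl⟩⟩
  · exact h.elim

/-- Faces in different components of the rhombic graph would have disjoint closures and so
disconnect the plane. -/
lemma reachable_faces (f g : G.Face) : G.rhombicGraph.Reachable (.inr f) (.inr g) := by
  by_contra hcon
  obtain ⟨y, hy⟩ := nonempty_face f
  obtain ⟨y', hy'⟩ := nonempty_face g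
  obtain ⟨x, -, hx₁, hx₂⟩ := isPreconnected_closed_iff.1 (isPreconnected_univ (α := ℂ)) _ _
    (isClosed_iUnion_closure (G := G) fun k => G.rhombicGraph.Reachable (.inr f) (.inr k))
    (isClosed_iUnion_closure (G := G) fun k => ¬G.rhombicGraph.Reachable (.inr f) (.inr k))
    (by
      intro x _
      obtain ⟨k, hk⟩ := exists_mem_closure (G := G) x
      by_cases h : G.rhombicGraph.Reachable (.inr f) (.inr k)
      · exact .inl (Set.mem_iUnion.2 ⟨⟨k, h⟩, hk⟩)
      · exact .inr (Set.mem_iUnion.2 ⟨⟨k, h⟩, hk⟩))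
    ⟨y, Set.mem_univ _, Set.mem_iUnion.2 ⟨⟨f, .refl _⟩, subset_closure hy⟩⟩
    ⟨y', Set.mem_univ _, Set.mem_iUnion.2 ⟨⟨g, hcon⟩, subset_closure hy'⟩⟩
  obtain ⟨⟨k, hk⟩, hxk⟩ := Set.mem_iUnion.1 hx₁
  obtain ⟨⟨k', hk'⟩, hxk'⟩ := Set.mem_iUnion.1 hx₂
  have key : ∀ v, G.OnFace v k → G.OnFace v k' → False := by
    intro v h h'
    have e₁ : G.rhombicGraph.Reachable (.inr k) (.inl v) :=
      SimpleGraph.Adj.reachable (adj_inr_inl.2 h)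
    have e₂ : G.rhombicGraph.Reachable (.inl v) (.inr k') :=
      SimpleGraph.Adj.reachable (adj_inl_inr.2 h')
    exact hk' ((hk.trans e₁).trans e₂)
  by_cases hv : ∃ v, x = G.z v
  · obtain ⟨v, rfl⟩ := hv
    exact key v hxk hxk'
  push Not at hv
  have hxn : x ∉ k.1 := by
    intro h
    obtain ⟨w, hw, hw'⟩ := mem_closure_iff.1 hxk' _ (isOpen_face k) h
    obtain rfl := face_eq_of_mem hw hw'
    exact hk' hk
  obtain ⟨a, b, hab, hx⟩ := exists_edge_of_mem_closure hxk hxn hv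
  exact key a (onFace_of_mem_edge hab hx hxk).1 (onFace_of_mem_edge hab hx hxk').1

lemma exists_onFace (v : V) : ∃ f : G.Face, G.OnFace v f := exists_mem_closure (G.z v)

lemma reachable_rhombicGraph (x y : G.KiteVertex) : G.rhombicGraph.Reachable x y := by
  have key : ∀ x : G.KiteVertex, ∃ f : G.Face, G.rhombicGraph.Reachable x (.inr f) := by
    rintro (v | f)
    · obtain ⟨f, hf⟩ := exists_onFace (G := G) v
      exact ⟨f, SimpleGraph.Adj.reachable (adj_inl_inr.2 hf)⟩
    · exact ⟨f, .refl _⟩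
  obtain ⟨f, hf⟩ := key x
  obtain ⟨g, hg⟩ := key y
  exact (hf.trans (reachable_faces f g)).trans hg.symm

namespace IsIsoradialDelaunay

lemma finite_kiteVertex (h : G.IsIsoradialDelaunay R) (ρ : ℝ) :
    {k | ‖G.zKite k‖ ≤ ρ}.Finite := by
  have hF := finite_meeting (G := G) 0 (ρ + 1)
  have hV : (⋃ f ∈ {f : G.Face | (f.1 ∩ Metric.ball 0 (ρ + 1)).Nonempty},
      graphFaceVertices G.z f.1).Finite := hF.biUnion fun f _ => G.face_finite f.1 f.2
  refine ((hV.image Sum.inl).union (hF.image Sum.inr)).subset ?_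
  have hball : ∀ x : ℂ, ‖x‖ ≤ ρ → x ∈ Metric.ball (0 : ℂ) (ρ + 1) := fun x hx => by
    rw [mem_ball_zero_iff]; linarith
  rintro (v | f) hk
  · obtain ⟨f, hf⟩ := exists_onFace (G := G) v
    exact .inl ⟨v, Set.mem_biUnion (x := f) (meets_ball hf (hball _ hk)) hf, rfl⟩
  · exact .inr ⟨f, ⟨_, h.circumcenter_mem f, hball _ hk⟩, rfl⟩

lemma zKite_injective (h : G.IsIsoradialDelaunay R) : Function.Injective G.zKite := by
  rintro (v | f) (w | g) e
  · rw [G.z_injective e]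
  · have e' : G.z v = G.circumcenter g := e
    exact absurd (h.circumcenter_mem g) (e' ▸ notMem_face_of_vertex v g)
  · have e' : G.circumcenter f = G.z w := e
    exact absurd (h.circumcenter_mem f) (e'.symm ▸ notMem_face_of_vertex w f)
  · rw [h.circumcenter_injective e]

/-- The rhombic graph with its embedding. -/
noncomputable def net (h : G.IsIsoradialDelaunay R) : StraightNet G.KiteVertex where
  graph := G.rhombicGraph
  z := G.zKite
  R := R
  norm_sub {a b} hab := by
    obtain ⟨v, f, hv, ⟨rfl, rfl⟩ | ⟨rfl, rfl⟩⟩ := exists_of_adj hab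
    · rw [norm_sub_rev]; exact h.norm_eq hv
    · exact h.norm_eq hv
  reachable := reachable_rhombicGraph
  finite := h.finite_kiteVertex

lemma combo_mem_face (h : G.IsIsoradialDelaunay R) {f : G.Face} {y : ℂ} (hy : y ∈ closure f.1)
    {t : ℝ} (h0 : 0 ≤ t) (h1 : t < 1) :
    G.circumcenter f + t • (y - G.circumcenter f) ∈ f.1 := by
  have := (convex_face f).combo_interior_closure_mem_interior (x := G.circumcenter f)
    (by rw [(isOpen_face f).interior_eq]; exact h.circumcenter_mem f) hy (sub_pos.2 h1) h0 (by ring)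
  rw [(isOpen_face f).interior_eq] at this
  convert this using 1
  module

/-- A point of an edge of the rhombic graph is a vertex of `G` or lies in a face. -/
lemma mem_face_of_mem_segment (h : G.IsIsoradialDelaunay R) {b : V} {k : G.Face}
    (hb : G.OnFace b k) {x : ℂ} (hx : x ∈ segment ℝ (G.z b) (G.circumcenter k)) :
    x = G.z b ∨ x ∈ k.1 ∧ ∃ t : ℝ, 0 ≤ t ∧ x - G.circumcenter k = t • (G.z b - G.circumcenter k) := by
  rw [segment_symm, segment_eq_image'] at hx
  obtain ⟨t, ⟨ht0, ht1⟩, rfl⟩ := hx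
  rcases ht1.eq_or_lt with rfl | ht1
  · left
    simp
  · exact .inr ⟨h.combo_mem_face hb ht0 ht1, t, ht0, by simp⟩

lemma dot_lt (h : G.IsIsoradialDelaunay R) {v a : V} (hva : v ≠ a) {f : G.Face}
    (hv : G.OnFace v f) (ha : G.OnFace a f) :
    dot (G.z v - G.circumcenter f) (G.z a - G.circumcenter f) < R ^ 2 := by
  have h1 : dot (G.z v - G.circumcenter f) (G.z v - G.circumcenter f) = R ^ 2 := by
    rw [dot_self_eq_norm_sq, h.norm_eq hv]
  have h2 : dot (G.z a - G.circumcenter f) (G.z a - G.circumcenter f) = R ^ 2 := by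
    rw [dot_self_eq_norm_sq, h.norm_eq ha]
  have hd := dot_self_pos (sub_ne_zero.2 fun e : G.z a = G.z v => hva (G.z_injective e).symm)
  have e : dot (G.z a - G.z v) (G.z a - G.z v) =
      dot (G.z v - G.circumcenter f) (G.z v - G.circumcenter f) +
      dot (G.z a - G.circumcenter f) (G.z a - G.circumcenter f) -
      2 * dot (G.z v - G.circumcenter f) (G.z a - G.circumcenter f) := by
    simp only [dot, Complex.sub_re, Complex.sub_im]; ring
  linarith

/-- The triangle spanned by the centre of a face and one of its sides, with the side removed, meets
no edge of the rhombic graph except along its two radii. -/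
lemma eq_of_mem_triangle (h : G.IsIsoradialDelaunay R) {v a b : V} {f k : G.Face}
    (hva : G.graph.Adj v a) (hv : G.OnFace v f) (ha : G.OnFace a f) (hb : G.OnFace b k) {μ ν : ℝ}
    (hμ : 0 < μ) (hν : 0 ≤ ν) (hμν : μ + ν < 1) {x : ℂ}
    (hx : x = G.circumcenter f + μ • (G.z v - G.circumcenter f) +
      ν • (G.z a - G.circumcenter f))
    (hxs : x ∈ segment ℝ (G.z b) (G.circumcenter k)) : k = f ∧ b = v ∧ ν = 0 := by
  have hR := h.radius_pos f
  have hτ : 0 < μ + ν := by linarith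
  have hxf : x ∈ f.1 := by
    have hy : G.z v + (ν / (μ + ν)) • (G.z a - G.z v) ∈ closure f.1 := by
      refine (convex_face f).closure.segment_subset (show G.z v ∈ closure f.1 from hv)
        (show G.z a ∈ closure f.1 from ha) ?_
      rw [segment_eq_image']
      exact ⟨_, ⟨div_nonneg hν hτ.le, (div_le_one hτ).2 (by linarith)⟩, rfl⟩
    have := h.combo_mem_face hy hτ.le hμν
    convert this using 1
    have e : (μ + ν) * (ν / (μ + ν)) = ν := mul_div_cancel₀ _ hτ.ne'
    rw [hx, add_sub_right_comm, smul_add, smul_smul, e]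
    module
  rcases h.mem_face_of_mem_segment hb hxs with rfl | ⟨hxk, t, ht0, ht⟩
  · exact absurd hxf (notMem_face_of_vertex b f)
  obtain rfl := face_eq_of_mem hxk hxf
  refine ⟨rfl, ?_⟩
  set A := G.z a - G.circumcenter k with hA
  set B := G.z b - G.circumcenter k with hB
  set W := G.z v - G.circumcenter k with hW
  have hxB : t • B = μ • W + ν • A := by rw [← ht, hx]; ring
  have hWW : dot W W = R ^ 2 := by rw [dot_self_eq_norm_sq, h.norm_eq hv]
  have hAA : dot A A = R ^ 2 := by rw [dot_self_eq_norm_sq, h.norm_eq ha]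
  have hBB : dot B B = R ^ 2 := by rw [dot_self_eq_norm_sq, h.norm_eq hb]
  have hnorm : t ^ 2 * R ^ 2 = (μ ^ 2 + ν ^ 2) * R ^ 2 + 2 * (μ * ν) * dot W A := by
    have e1 : dot (t • B) (t • B) = t ^ 2 * dot B B := by
      simp only [dot, Complex.smul_re, Complex.smul_im, smul_eq_mul]; ring
    have e2 : dot (μ • W + ν • A) (μ • W + ν • A) = μ ^ 2 * dot W W + ν ^ 2 * dot A A +
        2 * (μ * ν) * dot W A := by
      simp only [dot, Complex.add_re, Complex.add_im, Complex.smul_re, Complex.smul_im,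
        smul_eq_mul]; ring
    rw [← hBB, ← e1, hxB, e2, hWW, hAA, hBB]
    ring
  have hR2 : 0 < R ^ 2 := by positivity
  rcases hν.eq_or_lt with rfl | hν
  · have htμ : t = μ := by
      have : t ^ 2 = μ ^ 2 := by
        apply mul_right_cancel₀ hR2.ne'
        linarith
      exact (pow_left_inj₀ ht0 hμ.le two_ne_zero).1 this
    rw [htμ, zero_smul, add_zero] at hxB
    have := smul_right_injective ℂ hμ.ne' hxB
    exact ⟨G.z_injective (sub_left_injective this), rfl⟩
  · exfalso
    -- The vertex `b` lies on the inner side of the edge, the point of the circle beyond it.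
    have hc := h.cross_ne_zero hva hv ha
    rw [← hW, ← hA] at hc
    set c := cross W A with hcdef
    have hside : 0 ≤ c * cross (G.z a - G.z v) (G.z b - G.z v) := by
      rcases hc.lt_or_gt with hlt | hlt
      · have h1 := h.leftOf_of_cross_pos hva.symm ha hv
          (by rw [cross_comm]; change 0 < -c; linarith)
        have h2 := h1.closure_nonneg (x := G.z b) hb
        rw [cross_swap] at h2
        nlinarith
      · exact mul_nonneg hlt.le ((h.leftOf_of_cross_pos hva hv ha hlt).closure_nonneg hb)
    have e0 : cross (G.z a - G.z v) (G.z b - G.z v) = c + cross A B - cross W B := by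
      simp only [hcdef, hA, hB, hW, cross, Complex.sub_re, Complex.sub_im]; ring
    have e1 : t * cross A B = -(μ * c) := by
      rw [← cross_smul, hxB, cross_add, cross_smul, cross_smul, cross_self_eq, hcdef, cross_comm A W]
      ring
    have e2 : t * cross W B = ν * c := by
      rw [← cross_smul, hxB, cross_add, cross_smul, cross_smul, cross_self_eq, hcdef]
      ring
    have e3 : 0 ≤ c ^ 2 * (t - (μ + ν)) := by
      have := mul_nonneg ht0 hside
      rw [e0] at this
      have e4 : t * (c * (c + cross A B - cross W B)) = c ^ 2 * (t - (μ + ν)) := by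
        linear_combination c * e1 - c * e2
      linarith
    have hc2 : 0 < c ^ 2 := by positivity
    have htge : 0 ≤ t - (μ + ν) := nonneg_of_mul_nonneg_right e3 hc2
    have hlt := h.dot_lt hva.ne hv ha
    rw [← hW, ← hA] at hlt
    have h1 : 0 < 2 * (μ * ν) * (R ^ 2 - dot W A) :=
      mul_pos (by positivity) (by linarith)
    have h2 : (μ + ν) ^ 2 * R ^ 2 ≤ t ^ 2 * R ^ 2 :=
      mul_le_mul_of_nonneg_right (pow_le_pow_left₀ hτ.le (by linarith) 2) hR2.le
    nlinarith

/-- A rhomb, with two opposite open sides and without the other two sides, meets no edge of the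
rhombic graph except those two sides. -/
lemma eq_of_mem_rhomb (h : G.IsIsoradialDelaunay R) {v a b : V} {f g k : G.Face}
    (hva : G.graph.Adj v a) (hv : G.OnFace v f) (ha : G.OnFace a f) (hfg : f ≠ g)
    (hv' : G.OnFace v g) (ha' : G.OnFace a g) (hb : G.OnFace b k) {μ ν : ℝ} (hμ : 0 < μ)
    (hμ' : μ < 1) (hν : 0 ≤ ν) (hν' : ν ≤ 1) {x : ℂ}
    (hx : x = G.circumcenter f + μ • (G.z v - G.circumcenter f) +
      ν • (G.z a - G.circumcenter f))
    (hxs : x ∈ segment ℝ (G.z b) (G.circumcenter k)) : (b = v ∧ k = f) ∨ (b = a ∧ k = g) := by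
  rcases lt_trichotomy (μ + ν) 1 with hlt | heq | hgt
  · obtain ⟨h1, h2, -⟩ := h.eq_of_mem_triangle hva hv ha hb hμ hν hlt hx hxs
    exact .inl ⟨h2, h1⟩
  · exfalso
    have hxo : x ∈ openSegment ℝ (G.z v) (G.z a) := by
      rw [openSegment_eq_image']
      refine ⟨ν, ⟨by linarith, by linarith⟩, ?_⟩
      obtain rfl : μ = 1 - ν := by linarith
      rw [hx]
      module
    rcases h.mem_face_of_mem_segment hb hxs with rfl | ⟨hxk, -⟩
    · exact G.vertex_notMem_edge v a b hva hxo
    · exact notMem_face_of_edge hva (openSegment_subset_segment ℝ _ _ hxo) k hxk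
  · right
    have hsum := h.add_eq_add hva.ne hfg hv ha hv' ha'
    have hx' : x = G.circumcenter g + (1 - μ) • (G.z a - G.circumcenter g) +
        (1 - ν) • (G.z v - G.circumcenter g) := by
      have e : G.circumcenter f = G.z v + G.z a - G.circumcenter g := by rw [← hsum]; ring
      rw [hx, e]
      module
    obtain ⟨h1, h2, -⟩ := h.eq_of_mem_triangle hva.symm ha' hv' hb (sub_pos.2 hμ')
      (sub_nonneg.2 hν') (by linarith) hx' hxs
    exact ⟨h2, h1⟩

end IsIsoradialDelaunay

end EmbeddedPlanarGraph

/-! ### Flags and train-tracks -/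

namespace EmbeddedPlanarGraph

variable {V : Type*} {G : EmbeddedPlanarGraph V} {R : ℝ}

/-- An edge of `G` with one of its end-points and an adjacent face; equivalently, a rhomb with one
of its sides. -/
@[ext] structure Flag (G : EmbeddedPlanarGraph V) where
  vertex : V
  face : G.Face
  nbr : V
  adj : G.graph.Adj vertex nbr
  mem : G.OnFace vertex face
  nbr_mem : G.OnFace nbr face

namespace Flag

/-- The side of a flag, as an edge of the rhombic graph. -/
def tie (φ : G.Flag) : Sym2 G.KiteVertex := s(.inl φ.vertex, .inr φ.face)

/-- The rhomb of a flag. -/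
def rhomb (φ : G.Flag) : G.Rhomb := ⟨s(φ.vertex, φ.nbr), φ.adj⟩

/-- Twice the signed area of the triangle formed by the centre of the face, the vertex and the
neighbour. -/
noncomputable def orient (φ : G.Flag) : ℝ :=
  cross (G.z φ.vertex - G.circumcenter φ.face) (G.z φ.nbr - G.circumcenter φ.face)

lemma tie_eq_iff {φ ψ : G.Flag} : φ.tie = ψ.tie ↔ φ.vertex = ψ.vertex ∧ φ.face = ψ.face := by
  simp [tie]

lemma tie_mem (φ : G.Flag) : φ.tie ∈ G.rhombSides φ.rhomb := by
  refine ⟨φ.vertex, φ.face, Sym2.mem_mk_left _ _, ?_, rfl⟩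
  intro w hw
  rcases Sym2.mem_iff.1 hw with rfl | rfl
  · exact φ.mem
  · exact φ.nbr_mem

lemma exists_of_mem_rhombSides {e : G.Rhomb} {s : Sym2 G.KiteVertex} (hs : s ∈ G.rhombSides e) :
    ∃ φ : G.Flag, φ.tie = s ∧ φ.rhomb = e := by
  obtain ⟨w, f, hw, hf, rfl⟩ := hs
  obtain ⟨e, he⟩ := e
  obtain ⟨a, rfl⟩ := Sym2.mem_iff_exists.1 hw
  exact ⟨⟨w, f, a, he, hf _ hw, hf _ (Sym2.mem_mk_right _ _)⟩, rfl, rfl⟩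

lemma rhomb_eq_iff {φ ψ : G.Flag} : φ.rhomb = ψ.rhomb ↔
    (φ.vertex = ψ.vertex ∧ φ.nbr = ψ.nbr) ∨ (φ.vertex = ψ.nbr ∧ φ.nbr = ψ.vertex) := by
  simp [rhomb, Subtype.ext_iff]

end Flag

lemma cross_eq_zero_of_parallel {v w : V} {f g : G.Face}
    (h : G.Parallel s(.inl v, .inr f) s(.inl w, .inr g)) :
    cross (G.z v - G.circumcenter f) (G.z w - G.circumcenter g) = 0 := by
  obtain ⟨a, b, c, d, h1, h2, t, -, ht⟩ := h
  have key : ∀ {a b : G.KiteVertex} {v : V} {f : G.Face}, s(.inl v, .inr f) = s(a, b) →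
      ∃ ε : ℝ, G.z v - G.circumcenter f = ε • (G.zKite b - G.zKite a) := by
    intro a b v f e
    rcases Sym2.eq_iff.1 e with ⟨rfl, rfl⟩ | ⟨rfl, rfl⟩
    · exact ⟨-1, by simp [zKite]⟩
    · exact ⟨1, by simp [zKite]⟩
  obtain ⟨ε, h3⟩ := key h1
  obtain ⟨δ, h4⟩ := key h2
  rw [h3, h4, ht, cross_smul, cross_comm, cross_smul, cross_smul, cross_self_eq]
  simp

namespace IsIsoradialDelaunay

lemma orient_ne_zero (h : G.IsIsoradialDelaunay R) (φ : G.Flag) : φ.orient ≠ 0 :=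
  h.cross_ne_zero φ.adj φ.mem φ.nbr_mem

/-- The other flag with the same side. -/
noncomputable def turn (h : G.IsIsoradialDelaunay R) (φ : G.Flag) : G.Flag :=
  have e := h.exists_neighbor φ.mem (neg_ne_zero.2 (h.orient_ne_zero φ))
  ⟨φ.vertex, φ.face, e.choose, e.choose_spec.1, φ.mem, e.choose_spec.2.1⟩

/-- The flag of the same rhomb on the opposite side. -/
noncomputable def flip (_ : G.IsIsoradialDelaunay R) (φ : G.Flag) : G.Flag :=
  have e := exists_other_face φ.adj φ.face
  ⟨φ.nbr, e.choose, φ.vertex, φ.adj.symm, e.choose_spec.2.2, e.choose_spec.2.1⟩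

variable (h : G.IsIsoradialDelaunay R)

lemma flip_vertex (φ : G.Flag) : (h.flip φ).vertex = φ.nbr := rfl

lemma flip_nbr (φ : G.Flag) : (h.flip φ).nbr = φ.vertex := rfl

lemma flip_face_ne (φ : G.Flag) : (h.flip φ).face ≠ φ.face :=
  (exists_other_face φ.adj φ.face).choose_spec.1

lemma tie_turn (φ : G.Flag) : (h.turn φ).tie = φ.tie := rfl

lemma rhomb_flip (φ : G.Flag) : (h.flip φ).rhomb = φ.rhomb :=
  Flag.rhomb_eq_iff.2 (.inr ⟨rfl, rfl⟩)

lemma orient_turn (φ : G.Flag) : φ.orient * (h.turn φ).orient < 0 := by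
  have := (h.exists_neighbor φ.mem (neg_ne_zero.2 (h.orient_ne_zero φ))).choose_spec.2.2
  rw [neg_mul] at this
  exact neg_pos.1 this

lemma nbr_turn_ne (φ : G.Flag) : (h.turn φ).nbr ≠ φ.nbr := by
  intro e
  have h1 := h.orient_turn φ
  have h2 : (h.turn φ).orient = φ.orient := by
    unfold Flag.orient
    rw [e]
    rfl
  rw [h2] at h1
  linarith [mul_self_nonneg φ.orient]

lemma rhomb_turn_ne (φ : G.Flag) : (h.turn φ).rhomb ≠ φ.rhomb := by
  intro e
  rcases Flag.rhomb_eq_iff.1 e with ⟨-, e⟩ | ⟨e, -⟩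
  · exact h.nbr_turn_ne φ e
  · exact φ.adj.ne e

lemma eq_of_tie_of_orient (h : G.IsIsoradialDelaunay R) {φ ψ : G.Flag} (ht : φ.tie = ψ.tie) (ho : 0 < φ.orient * ψ.orient) :
    φ = ψ := by
  obtain ⟨v, f, a, h1, h2, h3⟩ := φ
  obtain ⟨v', f', a', h1', h2', h3'⟩ := ψ
  obtain ⟨rfl, rfl⟩ := Flag.tie_eq_iff.1 ht
  exact Flag.ext rfl rfl (h.neighbor_unique h2 h1 h3 h1' h3' ho)

lemma turn_turn (φ : G.Flag) : h.turn (h.turn φ) = φ := by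
  refine h.eq_of_tie_of_orient rfl ?_
  have h1 := h.orient_turn φ
  have h2 := h.orient_turn (h.turn φ)
  have h3 := mul_pos_of_neg_of_neg h1 h2
  have h4 : φ.orient * (h.turn φ).orient * ((h.turn φ).orient * (h.turn (h.turn φ)).orient) =
    (h.turn φ).orient ^ 2 * ((h.turn (h.turn φ)).orient * φ.orient) := by ring
  rw [h4] at h3
  exact pos_of_mul_pos_right h3 (sq_nonneg _)

/-- Flags with the same side are equal or turned. -/
lemma eq_or_eq_turn {φ ψ : G.Flag} (ht : φ.tie = ψ.tie) : φ = ψ ∨ φ = h.turn ψ := by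
  rcases (mul_ne_zero (h.orient_ne_zero φ) (h.orient_ne_zero ψ)).lt_or_gt with h1 | h1
  · right
    refine h.eq_of_tie_of_orient ht ?_
    have h2 := mul_pos_of_neg_of_neg h1 (h.orient_turn ψ)
    have h4 : φ.orient * ψ.orient * (ψ.orient * (h.turn ψ).orient) =
      ψ.orient ^ 2 * (φ.orient * (h.turn ψ).orient) := by ring
    rw [h4] at h2
    exact pos_of_mul_pos_right h2 (sq_nonneg _)
  · exact .inl (h.eq_of_tie_of_orient ht h1)

lemma flip_flip (φ : G.Flag) : h.flip (h.flip φ) = φ :=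
  Flag.ext rfl (h.other_face_unique φ.adj.ne (h.flip φ).nbr_mem (h.flip φ).mem
    (h.flip_face_ne _).symm (h.flip (h.flip φ)).mem (h.flip (h.flip φ)).nbr_mem
    (h.flip_face_ne _) φ.mem φ.nbr_mem) rfl

lemma add_eq_add_flip (φ : G.Flag) : G.circumcenter φ.face + G.circumcenter (h.flip φ).face =
    G.z φ.vertex + G.z φ.nbr :=
  h.add_eq_add φ.adj.ne (h.flip_face_ne φ).symm φ.mem φ.nbr_mem (h.flip φ).nbr_mem (h.flip φ).mem

lemma orient_flip (φ : G.Flag) : (h.flip φ).orient = φ.orient := by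
  have e : G.circumcenter (h.flip φ).face = G.z φ.vertex + G.z φ.nbr - G.circumcenter φ.face := by
    rw [← h.add_eq_add_flip φ]; ring
  unfold Flag.orient
  rw [e, flip_vertex, flip_nbr]
  simp only [cross, Complex.sub_re, Complex.sub_im, Complex.add_re, Complex.add_im]
  ring

/-- Two flags of one rhomb with distinct parallel sides are opposite. -/
lemma eq_flip_of_parallel {φ ψ : G.Flag} (hr : φ.rhomb = ψ.rhomb) (ht : φ.tie ≠ ψ.tie)
    (hp : G.Parallel φ.tie ψ.tie) : φ = h.flip ψ := by
  have hc := cross_eq_zero_of_parallel hp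
  obtain ⟨v, f, a, h1, h2, h3⟩ := φ
  obtain ⟨v', f', a', h1', h2', h3'⟩ := ψ
  rcases Flag.rhomb_eq_iff.1 hr with ⟨e, e'⟩ | ⟨e, e'⟩
  all_goals
    simp only at e e' h1 h2 h3 h1' h2' h3' hc
    subst e e'
  · exfalso
    have hff : f ≠ f' := by
      rintro rfl
      exact ht rfl
    have hsum := h.add_eq_add h1.ne hff h2 h3 h2' h3'
    have e : G.z v - G.circumcenter f' = -(G.z a - G.circumcenter f) := by
      linear_combination -hsum
    rw [e] at hc
    refine h.cross_ne_zero h1 h2 h3 ?_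
    rw [cross_neg] at hc
    linarith
  · by_cases hff : f = f'
    · subst hff
      exact absurd hc (h.cross_ne_zero h1 h2 h3)
    · exact Flag.ext rfl (h.other_face_unique h1.ne h3' h2' (Ne.symm hff) h2 h3
        (h.flip_face_ne ⟨a, f', v, h1', h2', h3'⟩).symm (h.flip _).mem (h.flip _).nbr_mem) rfl

/-- Distinct rhombs share at most one side. -/
lemma eq_of_mem_rhombSides (h : G.IsIsoradialDelaunay R) {e e' : G.Rhomb} (hne : e ≠ e') {s s' : Sym2 G.KiteVertex}
    (h1 : s ∈ G.rhombSides e) (h2 : s ∈ G.rhombSides e') (h1' : s' ∈ G.rhombSides e)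
    (h2' : s' ∈ G.rhombSides e') : s = s' := by
  obtain ⟨φ, rfl, rfl⟩ := Flag.exists_of_mem_rhombSides h1
  obtain ⟨χ, hχ, rfl⟩ := Flag.exists_of_mem_rhombSides h2
  obtain rfl : χ = h.turn φ := (h.eq_or_eq_turn hχ).resolve_left (by rintro rfl; exact hne rfl)
  obtain ⟨w, k, hw, hk, rfl⟩ := h1'
  obtain ⟨w', k', hw', hk', e⟩ := h2'
  obtain ⟨rfl, rfl⟩ : w = w' ∧ k = k' := by simpa using e
  have hwv : w = φ.vertex := by
    rcases Sym2.mem_iff.1 hw with e | e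
    · exact e
    rcases Sym2.mem_iff.1 hw' with e' | e'
    · exact e'
    · exact absurd (e'.symm.trans e) (h.nbr_turn_ne φ)
  subst hwv
  by_cases hkf : φ.face = k
  · rw [← hkf]; rfl
  · exfalso
    have e1 := h.add_eq_add φ.adj.ne hkf φ.mem φ.nbr_mem (hk _ (Sym2.mem_mk_left _ _))
      (hk _ (Sym2.mem_mk_right _ _))
    have e2 := h.add_eq_add (h.turn φ).adj.ne hkf φ.mem (h.turn φ).nbr_mem
      (hk _ (Sym2.mem_mk_left _ _)) (hk' _ (Sym2.mem_mk_right _ _))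
    exact h.nbr_turn_ne φ (G.z_injective (add_left_cancel (e2.symm.trans e1)))

/-- Crossing the rhomb of a flag to its opposite side, and passing to the next rhomb there. -/
noncomputable def step : Equiv.Perm G.Flag :=
  Function.Involutive.toPerm h.turn h.turn_turn * Function.Involutive.toPerm h.flip h.flip_flip

lemma step_apply (φ : G.Flag) : h.step φ = h.turn (h.flip φ) := rfl

lemma step_inv_apply (φ : G.Flag) : h.step⁻¹ φ = h.flip (h.turn φ) := rfl

lemma step_zpow_turn (n : ℤ) (φ : G.Flag) :
    (h.step ^ n) (h.turn φ) = h.turn ((h.step ^ (-n)) φ) := by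
  set j := Function.Involutive.toPerm h.turn h.turn_turn with hj
  set e := Function.Involutive.toPerm h.flip h.flip_flip
  have hjj : j * j = 1 := Equiv.ext h.turn_turn
  have hee : e * e = 1 := Equiv.ext h.flip_flip
  have hstep : h.step = j * h.step⁻¹ * j⁻¹ := by
    have h1 : h.step = j * e := rfl
    rw [h1, mul_inv_rev, inv_eq_of_mul_eq_one_right hjj, inv_eq_of_mul_eq_one_right hee]
    rw [mul_assoc, mul_assoc, hjj, mul_one]
  have h2 : h.step ^ n * j = j * h.step ^ (-n) := by
    conv_lhs => rw [hstep]
    rw [conj_zpow, inv_zpow, zpow_neg, inv_mul_cancel_right]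
  exact congrArg (fun σ : Equiv.Perm G.Flag => σ φ) h2

lemma step_zpow_add_one (n : ℤ) (φ : G.Flag) : (h.step ^ (n + 1)) φ = h.step ((h.step ^ n) φ) := by
  rw [add_comm, zpow_add, zpow_one]; rfl

lemma eq_step_zpow {x : ℤ → G.Flag} (hx : ∀ n, x (n + 1) = h.step (x n)) (n : ℤ) :
    x n = (h.step ^ n) (x 0) := by
  induction n using Int.induction_on with
  | zero => rfl
  | succ n ih => rw [hx, ih, step_zpow_add_one]
  | pred n ih =>
    apply h.step.injective
    rw [← hx, ← step_zpow_add_one, sub_add_cancel, ih]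

lemma tie_step (φ : G.Flag) : (h.step φ).tie = s(.inl φ.nbr, .inr (h.flip φ).face) := rfl

/-- The parametrized train-track of a flag. -/
noncomputable def trackSeq (φ : G.Flag) : G.TrackSeq where
  rhomb n := ((h.step ^ (n - 1)) φ).rhomb
  tie n := ((h.step ^ n) φ).tie
  rhomb_ne n := by
    have e : (h.step ^ (n + 1 - 1)) φ = h.turn (h.flip ((h.step ^ (n - 1)) φ)) := by
      rw [← step_apply, ← step_zpow_add_one]
      congr 2
      ring
    rw [e, ← h.rhomb_flip ((h.step ^ (n - 1)) φ)]
    exact (h.rhomb_turn_ne _).symm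
  tie_mem n := by
    have e : (h.step ^ n) φ = h.turn (h.flip ((h.step ^ (n - 1)) φ)) := by
      rw [← step_apply, ← step_zpow_add_one, sub_add_cancel]
    rw [e, tie_turn, ← h.rhomb_flip ((h.step ^ (n - 1)) φ)]
    exact Flag.tie_mem _
  tie_mem_succ n := by
    rw [add_sub_cancel_right]
    exact Flag.tie_mem _
  tie_ne n := by
    rw [step_zpow_add_one]
    intro e
    exact ((h.step ^ n) φ).adj.ne (Flag.tie_eq_iff.1 e).1
  tie_parallel n := by
    rw [step_zpow_add_one, tie_step]
    refine ⟨_, _, _, _, rfl, rfl, -1, by norm_num, ?_⟩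
    have := h.add_eq_add_flip ((h.step ^ n) φ)
    simp only [zKite, neg_smul, one_smul]
    linear_combination this

/-- The train-track of a flag. -/
noncomputable def track (φ : G.Flag) : G.TrainTrack := Quotient.mk G.trackSetoid (h.trackSeq φ)

/-- A parametrized train-track is determined by any of its rhombs and ties. -/
lemma exists_flag (t : G.TrackSeq) : ∃ φ : G.Flag, ∀ n, t.tie n = ((h.step ^ n) φ).tie ∧
    t.rhomb n = ((h.step ^ (n - 1)) φ).rhomb := by
  choose x hx hx' using fun n => Flag.exists_of_mem_rhombSides (t.tie_mem_succ n)
  have key : ∀ n, x (n + 1) = h.step (x n) := by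
    intro n
    obtain ⟨χ, hχ, hχ'⟩ := Flag.exists_of_mem_rhombSides (t.tie_mem (n + 1))
    obtain rfl : χ = h.flip (x n) := by
      refine h.eq_flip_of_parallel (hχ'.trans (hx' n).symm) ?_ ?_
      · rw [hχ, hx]; exact (t.tie_ne n).symm
      · rw [hχ, hx]
        obtain ⟨a, b, c, d, h1, h2, r, hr, h3⟩ := t.tie_parallel n
        exact ⟨c, d, a, b, h2, h1, r⁻¹, inv_ne_zero hr, by rw [h3, inv_smul_smul₀ hr]⟩
    refine (h.eq_or_eq_turn ((hx (n + 1)).trans hχ.symm)).resolve_left fun e => ?_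
    refine t.rhomb_ne (n + 1) ?_
    rw [← hx' (n + 1), ← hχ', e]
  refine ⟨x 0, fun n => ?_⟩
  rw [← h.eq_step_zpow key, ← h.eq_step_zpow key, hx, hx', sub_add_cancel]
  exact ⟨rfl, rfl⟩

/-- Every train-track is the one of some flag, as parametrizations with the same rhombs agree. -/
lemma exists_track (T : G.TrainTrack) : ∃ φ, T = h.track φ := by
  obtain ⟨t, rfl⟩ := Quotient.exists_rep T
  obtain ⟨φ, hφ⟩ := h.exists_flag t
  exact ⟨φ, Quotient.sound ⟨1, 0, fun n => by simpa [trackSeq] using (hφ n).2.symm⟩⟩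

/-- The ties of a train-track are those of any of its parametrizations: each is the common side of
two consecutive rhombs. -/
lemma mem_ties_track {φ : G.Flag} {s : Sym2 G.KiteVertex} :
    s ∈ (h.track φ).ties ↔ ∃ n : ℤ, ((h.step ^ n) φ).tie = s := by
  constructor
  · rintro ⟨t, ht, n, rfl⟩
    obtain ⟨ε, d, hε⟩ : ∃ (ε : ℤˣ) (d : ℤ), ∀ n : ℤ, t.rhomb n = (h.trackSeq φ).rhomb (ε * n + d) :=
      Quotient.exact ht.symm
    have h1 := t.tie_mem n
    have h2 := t.tie_mem_succ n
    have hne := t.rhomb_ne n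
    rcases Int.units_eq_one_or ε with rfl | rfl
    · refine ⟨n + d, h.eq_of_mem_rhombSides hne ?_ ?_ h1 h2⟩
      · rw [hε]
        change (h.trackSeq φ).tie _ ∈ _
        convert (h.trackSeq φ).tie_mem (n + d) using 3
        simp
      · rw [hε]
        change (h.trackSeq φ).tie _ ∈ _
        convert (h.trackSeq φ).tie_mem_succ (n + d) using 3
        push_cast; ring
    · refine ⟨-n + d - 1, h.eq_of_mem_rhombSides hne ?_ ?_ h1 h2⟩
      · rw [hε]
        change (h.trackSeq φ).tie _ ∈ _
        convert (h.trackSeq φ).tie_mem_succ (-n + d - 1) using 3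
        push_cast; ring
      · rw [hε]
        change (h.trackSeq φ).tie _ ∈ _
        convert (h.trackSeq φ).tie_mem (-n + d - 1) using 3
        push_cast; ring
  · rintro ⟨n, rfl⟩
    exact ⟨_, rfl, n, rfl⟩

lemma track_step_zpow (m : ℤ) (φ : G.Flag) : h.track ((h.step ^ m) φ) = h.track φ := by
  refine Quotient.sound ⟨1, -m, fun n => ?_⟩
  change ((h.step ^ (n - 1)) φ).rhomb = ((h.step ^ (_ : ℤ)) ((h.step ^ m) φ)).rhomb
  rw [← Equiv.Perm.mul_apply, ← zpow_add]
  congr 3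
  push_cast; ring

/-- The orbit of the turned flag is the same train-track, passed in the opposite sense. -/
lemma track_turn (φ : G.Flag) : h.track (h.turn φ) = h.track φ := by
  refine Quotient.sound ⟨-1, 1, fun n => ?_⟩
  change ((h.step ^ (n - 1)) φ).rhomb = ((h.step ^ (_ : ℤ)) (h.turn φ)).rhomb
  rw [step_zpow_turn, ← h.rhomb_flip (h.turn _), ← step_inv_apply, ← zpow_neg_one,
    ← Equiv.Perm.mul_apply, ← zpow_add]
  congr 3
  push_cast; ring

lemma tie_unique (h : G.IsIsoradialDelaunay R) {T T' : G.TrainTrack} {s : Sym2 G.KiteVertex} (hs : s ∈ T.ties)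
    (hs' : s ∈ T'.ties) : T = T' := by
  obtain ⟨φ, rfl⟩ := h.exists_track T
  obtain ⟨ψ, rfl⟩ := h.exists_track T'
  obtain ⟨n, rfl⟩ := h.mem_ties_track.1 hs
  obtain ⟨m, hm⟩ := h.mem_ties_track.1 hs'
  rw [← h.track_step_zpow n φ, ← h.track_step_zpow m ψ]
  rcases h.eq_or_eq_turn hm with e | e
  · rw [e]
  · rw [e, track_turn]

lemma exists_tie (h : G.IsIsoradialDelaunay R) {x y : G.KiteVertex} (hxy : G.rhombicGraph.Adj x y) :
    ∃ T : G.TrainTrack, s(x, y) ∈ T.ties := by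
  have key : ∀ {v f}, G.OnFace v f → ∃ T : G.TrainTrack, s(.inl v, .inr f) ∈ T.ties := by
    intro v f hv
    obtain ⟨a, hva, ha, -⟩ := h.exists_neighbor hv one_ne_zero
    exact ⟨h.track ⟨v, f, a, hva, hv, ha⟩, h.mem_ties_track.2 ⟨0, rfl⟩⟩
  obtain ⟨v, f, hv, ⟨rfl, rfl⟩ | ⟨rfl, rfl⟩⟩ := exists_of_adj hxy
  · exact key hv
  · rw [Sym2.eq_swap]
    exact key hv

end IsIsoradialDelaunay

namespace Flag

/-- The end-points of the side of a flag, ordered so that the rhomb lies on the left of the side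
directed from the first to the second. -/
noncomputable def source (φ : G.Flag) : G.KiteVertex :=
  if 0 < φ.orient then .inr φ.face else .inl φ.vertex

/-- The other end-point of the side. -/
noncomputable def target (φ : G.Flag) : G.KiteVertex :=
  if 0 < φ.orient then .inl φ.vertex else .inr φ.face

lemma tie_eq (φ : G.Flag) : φ.tie = s(φ.source, φ.target) := by
  unfold tie source target
  split_ifs
  · exact Sym2.eq_swap
  · rfl

lemma adj_source_target (φ : G.Flag) : G.rhombicGraph.Adj φ.source φ.target := by
  unfold source target
  split_ifs <;> exact φ.mem

end Flag

namespace IsIsoradialDelaunay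

variable (h : G.IsIsoradialDelaunay R)

lemma orient_step (φ : G.Flag) : 0 < (h.step φ).orient ↔ ¬0 < φ.orient := by
  have h1 := h.orient_turn (h.flip φ)
  rw [← step_apply, orient_flip] at h1
  constructor
  · intro h2 h3
    exact absurd h1 (mul_pos h3 h2).le.not_gt
  · intro h2
    have h3 := (not_lt.1 h2)
    by_contra! h4
    exact absurd h1 (mul_nonneg_of_nonpos_of_nonpos h3 h4).not_gt

lemma source_step (φ : G.Flag) : (h.step φ).source =
    if 0 < φ.orient then .inl φ.nbr else .inr (h.flip φ).face := by
  unfold Flag.source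
  simp only [orient_step]
  split_ifs <;> rfl

lemma target_step (φ : G.Flag) : (h.step φ).target =
    if 0 < φ.orient then .inr (h.flip φ).face else .inl φ.nbr := by
  unfold Flag.target
  simp only [orient_step]
  split_ifs <;> rfl

lemma zKite_source_step (φ : G.Flag) : G.zKite (h.step φ).source - G.zKite φ.source =
    G.z φ.nbr - G.circumcenter φ.face := by
  rw [source_step]
  unfold Flag.source
  split_ifs
  · rfl
  · simp only [zKite]
    linear_combination h.add_eq_add_flip φ

/-- All ties of a train-track have the same direction. -/
lemma zKite_target_sub_source_step (φ : G.Flag) :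
    G.zKite (h.step φ).target - G.zKite (h.step φ).source =
      G.zKite φ.target - G.zKite φ.source := by
  rw [source_step, target_step]
  unfold Flag.source Flag.target
  split_ifs
  · simp only [zKite]
    linear_combination h.add_eq_add_flip φ
  · simp only [zKite]
    linear_combination -h.add_eq_add_flip φ

lemma zKite_target_sub_source_step_zpow (φ : G.Flag) (n : ℤ) :
    G.zKite ((h.step ^ n) φ).target - G.zKite ((h.step ^ n) φ).source =
      G.zKite φ.target - G.zKite φ.source := by
  induction n using Int.induction_on with
  | zero => rfl
  | succ n ih => rw [step_zpow_add_one, zKite_target_sub_source_step, ih]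
  | pred n ih =>
    rw [← ih, ← zKite_target_sub_source_step, ← step_zpow_add_one, sub_add_cancel]

lemma cross_pos (φ : G.Flag) : 0 < cross (G.zKite φ.target - G.zKite φ.source)
    (G.zKite (h.step φ).source - G.zKite φ.source) := by
  have h0 := h.orient_ne_zero φ
  rw [zKite_source_step]
  unfold Flag.source Flag.target
  split_ifs with h1
  · exact h1
  · have h2 : φ.orient < 0 := lt_of_le_of_ne (not_lt.1 h1) h0
    simp only [zKite]
    rw [← neg_sub (G.z _), cross_neg_left]
    exact neg_pos.2 h2

lemma adj_source_step (φ : G.Flag) : G.rhombicGraph.Adj φ.source (h.step φ).source := by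
  rw [source_step]
  unfold Flag.source
  split_ifs
  · exact φ.nbr_mem
  · exact (h.flip φ).nbr_mem

lemma adj_target_step (φ : G.Flag) : G.rhombicGraph.Adj φ.target (h.step φ).target := by
  rw [target_step]
  unfold Flag.target
  split_ifs
  · exact (h.flip φ).nbr_mem
  · exact φ.nbr_mem

lemma eq_tie_of_mem (φ : G.Flag) {x y : G.KiteVertex} (hxy : G.rhombicGraph.Adj x y) {α β : ℝ}
    (hα : 0 < α) (hα' : α < 1) (hβ : 0 ≤ β) (hβ' : β ≤ 1)
    (hm : G.zKite φ.source + α • (G.zKite φ.target - G.zKite φ.source) +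
      β • (G.zKite (h.step φ).source - G.zKite φ.source) ∈ segment ℝ (G.zKite x) (G.zKite y)) :
    s(x, y) = φ.tie ∨ s(x, y) = (h.step φ).tie := by
  rw [zKite_source_step] at hm
  have key : ∀ {b k}, G.OnFace b k → G.zKite φ.source + α • (G.zKite φ.target - G.zKite φ.source) +
      β • (G.z φ.nbr - G.circumcenter φ.face) ∈ segment ℝ (G.z b) (G.circumcenter k) →
      s(.inl b, .inr k) = φ.tie ∨ s(.inl b, .inr k) = (h.step φ).tie := by
    intro b k hb hm
    suffices (b = φ.vertex ∧ k = φ.face) ∨ (b = φ.nbr ∧ k = (h.flip φ).face) by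
      rcases this with ⟨rfl, rfl⟩ | ⟨rfl, rfl⟩
      · exact .inl rfl
      · exact .inr rfl
    unfold Flag.source Flag.target at hm
    split_ifs at hm
    · exact h.eq_of_mem_rhomb φ.adj φ.mem φ.nbr_mem (h.flip_face_ne φ).symm (h.flip φ).nbr_mem
        (h.flip φ).mem hb hα hα' hβ hβ' rfl hm
    · refine h.eq_of_mem_rhomb φ.adj φ.mem φ.nbr_mem (h.flip_face_ne φ).symm (h.flip φ).nbr_mem
        (h.flip φ).mem hb (μ := 1 - α) (by linarith) (by linarith) hβ hβ' ?_ hm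
      simp only [zKite]
      module
  obtain ⟨v, f, hv, ⟨rfl, rfl⟩ | ⟨rfl, rfl⟩⟩ := exists_of_adj hxy
  · exact key hv hm
  · rw [Sym2.eq_swap]
    rw [segment_symm] at hm
    exact key hv hm

/-- The ties of a train-track form a ribbon. -/
noncomputable def ribbon (φ : G.Flag) : h.net.Ribbon (h.track φ).ties where
  l n := ((h.step ^ n) φ).source
  r n := ((h.step ^ n) φ).target
  w := G.zKite φ.target - G.zKite φ.source
  z_r n := by
    rw [← h.zKite_target_sub_source_step_zpow φ n]
    exact (add_sub_cancel _ _).symm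
  adj_l n := by rw [step_zpow_add_one]; exact h.adj_source_step _
  adj_r n := by rw [step_zpow_add_one]; exact h.adj_target_step _
  adj_lr n := Flag.adj_source_target _
  cross_pos n := by
    rw [step_zpow_add_one, ← h.zKite_target_sub_source_step_zpow φ n]
    exact h.cross_pos _
  mem_iff e := by
    rw [mem_ties_track]
    simp only [Flag.tie_eq, eq_comm]
  clear {x y} hxy n α β h1 h2 h3 h4 hm := by
    rw [step_zpow_add_one, ← h.zKite_target_sub_source_step_zpow φ n] at hm
    rw [mem_ties_track]
    rcases h.eq_tie_of_mem _ hxy h1 h2 h3 h4 hm with e | e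
    · exact ⟨n, e.symm⟩
    · exact ⟨n + 1, by rw [step_zpow_add_one, e]⟩

/-- The rhombic graph with its train-tracks. -/
noncomputable def rhombicNet : RhombicNet G.KiteVertex G.TrainTrack where
  toStraightNet := h.net
  ties := TrainTrack.ties
  ribbon T := by
    obtain ⟨φ, rfl⟩ := h.exists_track T
    exact ⟨h.ribbon φ⟩
  exists_tie := h.exists_tie
  tie_unique := h.tie_unique

end IsIsoradialDelaunay

end EmbeddedPlanarGraph

/-! ### Intersection angles -/

namespace EmbeddedPlanarGraph

variable {V : Type*} {G : EmbeddedPlanarGraph V} {R : ℝ}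

/-- The function of a vector that defines `phaseSum`, in a form that is visibly odd for odd `n`. -/
lemma exp_arg_eq_zpow {x : ℂ} (hx : x ≠ 0) (n : ℤ) :
    Complex.exp (Complex.I * n * (x.arg : ℂ)) = (x / ‖x‖) ^ n := by
  have h0 : (‖x‖ : ℂ) ≠ 0 := by exact_mod_cast norm_ne_zero_iff.2 hx
  have h1 : x / ‖x‖ = Complex.exp (x.arg * Complex.I) :=
    (div_eq_iff h0).2 (by rw [mul_comm, Complex.norm_mul_exp_arg_mul_I])
  rw [h1, ← Complex.exp_int_mul]
  congr 1
  ring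

namespace IsIsoradialDelaunay

variable (h : G.IsIsoradialDelaunay R)

open Classical in
lemma intersectionAngle_eq {T : G.TrainTrack} {u v : G.KiteVertex} (hs : T.Separates u v)
    (p : G.rhombicGraph.Walk u v) : intersectionAngle p T = h.rhombicNet.angle T u v := by
  obtain ⟨d, hd, hv⟩ := h.rhombicNet.find_dart (T := T) (u := u) (v := v) hs p
    (fun d => d.edge ∈ T.ties) (fun d => decide_eq_true_iff)
  have hd' : p.darts.find? (fun d => d.edge ∈ T.ties) = some d := hd
  unfold intersectionAngle
  rw [hd', RhombicNet.angle, ← hv]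
  rfl

lemma angleSet_eq {u v : G.KiteVertex} (p : G.rhombicGraph.Walk u v) :
    angleSet p = (fun T => h.rhombicNet.angle T u v) '' {T | h.rhombicNet.Sep T u v} := by
  ext ϑ
  constructor
  · rintro ⟨T, hT, rfl⟩
    exact ⟨T, hT, (h.intersectionAngle_eq hT p).symm⟩
  · rintro ⟨T, hT, rfl⟩
    exact ⟨T, hT, h.intersectionAngle_eq hT p⟩

lemma angleMult_eq {u v : G.KiteVertex} (p : G.rhombicGraph.Walk u v) (ϑ : ℝ) :
    angleMult p ϑ =
      {T ∈ (h.rhombicNet.finite_sep u v).toFinset | h.rhombicNet.angle T u v = ϑ}.card := by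
  rw [angleMult, ← Set.ncard_coe_finset]
  congr 1
  ext T
  simp only [Set.mem_ofPred_eq, Finset.coe_filter, Set.Finite.mem_toFinset]
  refine and_congr_right fun hT => ?_
  rw [h.intersectionAngle_eq hT p]

lemma phaseSum_eq {u v : G.KiteVertex} (p : G.rhombicGraph.Walk u v) {n : ℤ} (hn : Odd n) :
    phaseSum p n = ∑ T ∈ (h.rhombicNet.finite_sep u v).toFinset,
      Complex.exp (Complex.I * n * (h.rhombicNet.angle T u v : ℂ)) := by
  have key := h.rhombicNet.sum_darts (fun x : ℂ => (x / ‖x‖) ^ n)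
    (fun x => by rw [norm_neg, neg_div, hn.neg_zpow]) p
  refine Eq.trans ?_ (key.trans (Finset.sum_congr rfl fun T hT => ?_))
  · refine congrArg List.sum (List.map_congr_left fun d _ => exp_arg_eq_zpow ?_ n)
    exact sub_ne_zero.2 fun e => d.adj.ne (h.zKite_injective e).symm
  · have hs : h.rhombicNet.Sep T u v := (Set.Finite.mem_toFinset _).1 hT
    have h0 : h.rhombicNet.vec T u v ≠ 0 := by
      rw [← norm_ne_zero_iff, h.rhombicNet.norm_vec hs]
      exact (h.rhombicNet.R_pos hs).ne'
    rw [RhombicNet.angle, exp_toIocMod, exp_arg_eq_zpow h0]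

lemma pSum_eq (u v : G.KiteVertex) {n : ℤ} (hn : Odd n) :
    G.pSum n u v = ∑ T ∈ (h.rhombicNet.finite_sep u v).toFinset,
      Complex.exp (Complex.I * n * (h.rhombicNet.angle T u v : ℂ)) := by
  rw [pSum, dif_pos (show Nonempty _ from reachable_rhombicGraph u v), h.phaseSum_eq _ hn]

lemma finite_angleSet (h : G.IsIsoradialDelaunay R) {u v : G.KiteVertex} (p : G.rhombicGraph.Walk u v) :
    (angleSet p).Finite := by
  rw [h.angleSet_eq]
  exact (h.rhombicNet.finite_sep u v).image _

lemma exists_isGreatest_isLeast (h : G.IsIsoradialDelaunay R) {u v : G.KiteVertex} (huv : u ≠ v)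
    (p : G.rhombicGraph.Walk u v) : ∃ α β : ℝ, IsGreatest (angleSet p) α ∧
      IsLeast (angleSet p) β ∧ α - β < π ∧ β ≤ G.direction u v ∧ G.direction u v ≤ α := by
  have hz : h.rhombicNet.z u ≠ h.rhombicNet.z v := fun e => huv (h.zKite_injective e)
  have hS := h.angleSet_eq p
  obtain ⟨⟨T, hT, h1⟩, T', hT', h2⟩ := h.rhombicNet.exists_angle_le_and_le hz
  have hmem : h.rhombicNet.angle T u v ∈ angleSet p := hS ▸ ⟨T, hT, rfl⟩
  have hmem' : h.rhombicNet.angle T' u v ∈ angleSet p := hS ▸ ⟨T', hT', rfl⟩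
  obtain ⟨α, hα, hmax⟩ := Set.exists_max_image _ id (h.finite_angleSet p) ⟨_, hmem⟩
  obtain ⟨β, hβ, hmin⟩ := Set.exists_min_image _ id (h.finite_angleSet p) ⟨_, hmem⟩
  refine ⟨α, β, ⟨hα, hmax⟩, ⟨hβ, hmin⟩, ?_, (hmin _ hmem).trans h1, h2.trans (hmax _ hmem')⟩
  rw [hS] at hα hβ
  obtain ⟨A, hA, rfl⟩ := hα
  obtain ⟨B, hB, rfl⟩ := hβ
  exact h.rhombicNet.angle_sub_lt hA hB hz

end IsIsoradialDelaunay

end EmbeddedPlanarGraph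

theorem mainTheorem5 {V : Type*} (G : EmbeddedPlanarGraph V) (R : ℝ)
    (hiso : G.IsIsoradial R) (hdel : G.IsDelaunay) :
    (∀ (u v : G.KiteVertex) (p : G.rhombicGraph.Walk u v), u ≠ v →
      (EmbeddedPlanarGraph.angleSet p).Finite ∧
      ∃ α β : ℝ,
        IsGreatest (EmbeddedPlanarGraph.angleSet p) α ∧
        IsLeast (EmbeddedPlanarGraph.angleSet p) β ∧
        α - β < π ∧ β ≤ G.direction u v ∧ G.direction u v ≤ α ∧
        EmbeddedPlanarGraph.angleSet p ⊆
          Set.Ioo ((α + β) / 2 - π / 2) ((α + β) / 2 + π / 2) ∧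
        G.direction u v ∈ Set.Ioo ((α + β) / 2 - π / 2) ((α + β) / 2 + π / 2)) ∧
    (∀ u v : G.KiteVertex,
      G.rhombicGraph.Reachable u v ∧
      (∀ (n : ℤ), Odd n → ∀ p : G.rhombicGraph.Walk u v,
        EmbeddedPlanarGraph.phaseSum p n = G.pSum n u v) ∧
      ∃ (Θ : Finset ℝ) (m : ℝ → ℕ),
        (∀ p : G.rhombicGraph.Walk u v, EmbeddedPlanarGraph.angleSet p = (Θ : Set ℝ) ∧
          ∀ ϑ ∈ Θ, EmbeddedPlanarGraph.angleMult p ϑ = m ϑ) ∧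
        (∀ ϑ ∈ Θ, 0 < m ϑ) ∧
        (Θ : Set ℝ) ⊆ Set.Ioo (G.direction u v - π) (G.direction u v + π) ∧
        (∃ a b : ℝ, b - a < π ∧ (Θ : Set ℝ) ⊆ Set.Ioo a b ∧
          Set.Ioo a b ⊆ Set.Ioo (G.direction u v - π) (G.direction u v + π) ∧
          (u ≠ v → G.direction u v ∈ Set.Ioo a b)) ∧
        ∀ n : ℤ, Odd n →
          G.pSum n u v =
            ∑ ϑ ∈ Θ, (m ϑ : ℂ) * Complex.exp (Complex.I * (n : ℂ) * (ϑ : ℂ))) := by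
  have h : G.IsIsoradialDelaunay R := ⟨hiso, hdel⟩
  have hpi := Real.pi_pos
  constructor
  · intro u v p huv
    obtain ⟨α, β, hα, hβ, hlt, h1, h2⟩ := h.exists_isGreatest_isLeast huv p
    refine ⟨h.finite_angleSet p, α, β, hα, hβ, hlt, h1, h2, fun ϑ hϑ => ?_, ?_⟩
    · have h3 := hα.2 hϑ
      have h4 := hβ.2 hϑ
      constructor <;> linarith
    · constructor <;> linarith
  · intro u v
    have hreach := G.reachable_rhombicGraph u v
    refine ⟨hreach, fun n hn p => (h.phaseSum_eq p hn).trans (h.pSum_eq u v hn).symm, ?_⟩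
    set S := (h.rhombicNet.finite_sep u v).toFinset with hS
    set Θ := S.image fun T => h.rhombicNet.angle T u v with hΘ
    have hΘp : ∀ p : G.rhombicGraph.Walk u v, EmbeddedPlanarGraph.angleSet p = (Θ : Set ℝ) := by
      intro p
      rw [h.angleSet_eq, hΘ, Finset.coe_image, hS, Set.Finite.coe_toFinset]
    obtain ⟨p⟩ := hreach
    refine ⟨Θ, fun ϑ => {T ∈ S | h.rhombicNet.angle T u v = ϑ}.card,
      fun p => ⟨hΘp p, fun ϑ _ => h.angleMult_eq p ϑ⟩, ?_, ?_, ?_, ?_⟩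
    · intro ϑ hϑ
      obtain ⟨T, hT, rfl⟩ := Finset.mem_image.1 hϑ
      exact Finset.card_pos.2 ⟨T, Finset.mem_filter.2 ⟨hT, rfl⟩⟩
    · intro ϑ hϑ
      obtain ⟨T, hT, rfl⟩ := Finset.mem_image.1 (Finset.mem_coe.1 hϑ)
      exact ⟨(h.rhombicNet.angle_mem T u v).1,
        h.rhombicNet.angle_lt ((Set.Finite.mem_toFinset _).1 hT)⟩
    · rw [← hΘp p]
      by_cases huv : u = v
      · subst huv
        refine ⟨0, 0, by linarith, ?_, by simp, fun e => absurd rfl e⟩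
        rintro _ ⟨T, hT, rfl⟩
        exact absurd (SimpleGraph.Reachable.refl _) hT
      · obtain ⟨α, β, hα, hβ, hlt, h1, h2⟩ := h.exists_isGreatest_isLeast huv p
        -- Enlarge `[β, α]` on both sides by a third of the room left.
        refine ⟨β - (π - (α - β)) / 3, α + (π - (α - β)) / 3, by linarith, fun ϑ hϑ => ?_,
          fun ϑ hϑ => ?_, fun _ => ⟨by linarith, by linarith⟩⟩
        · have h3 := hα.2 hϑ
          have h4 := hβ.2 hϑ
          constructor <;> linarith
        · obtain ⟨h3, h4⟩ := hϑ
          constructor <;> linarith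
    · intro n hn
      rw [h.pSum_eq u v hn, hΘ,
        Finset.sum_comp (fun ϑ : ℝ => Complex.exp (Complex.I * n * ϑ))
          (fun T => h.rhombicNet.angle T u v)]
      simp only [nsmul_eq_mul]
      rfl
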